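/- **Definitions.** For a non-decreasing sequence $D=\langle d_1,\dots,d_n\rangle$ of positive integers, its *discretized sequence* $A=\langle a_1,\dots,a_n\rangle$ is given by $a_n=d_n$ and $a_i=\min\{a_{i+1}-1,d_i\}$ for $i<n$. An instance of *Position Matching* is a triple $(D,A,T)$, where $D=\langle d_1,\dots,d_n\rangle$ is a non-decreasing sequence of positive integers, $A$ is its discretized sequence and $T$ is a set of $n$ distinct positive integers (targets). It is *solvable* if the entries of $D$, $A$ and $T$ can be grouped into $n$ triplets $(d,a,t)$, every entry being used exactly once, such that $d\ge a$ and $d+a\ge t$ for each triplet. An instance of *2-Visits* is a non-decreasing sequence $\langle d_1,\dots,d_n\rangle$ of positive integers (deadlines). It is *feasible* if there is a schedule with positions $1,\dots,2n$ that contains exactly one primary and one secondary visit of each node $i\in\{1,\dots,n\}$, such that the primary visit of $i$ is at a position at most $d_i$, and the secondary visit of $i$ is either before its primary visit or at most $d_i$ positions after it. **Theorem.** Position Matching reduces to 2-Visits in polynomial time: there is a function $f$ from instances of Position Matching to instances of 2-Visits, computable by a Turing machine in time polynomial in the length of the input (instances being written as lists of numbers in binary), such that $(D,A,T)$ is solvable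 if and only if $f(D,A,T)$ is feasible, for every instance $(D,A,T)$ of Position Matching. Moreover, let $(D,A,T)$ be an instance of Position Matching with $n\ge 1$ such that $A$ consists of consecutive integers, $a_1$ is odd, and $t>a$ for all $t\in T$ and $a\in A$. Let $S$ be the increasing sequence of the odd positive integers smaller than $a_1$, and let $L$ be the increasing sequence of the elements of $[a_n+1,2a_n]\setminus T$. Then the concatenation $S\,\|\,D\,\|\,L$ is an instance of 2-Visits, and it is feasible if and only if $(D,A,T)$ is solvable. -/

import Mathlib

open Computability

/-! ### Position Matching -/

/-- The discretized sequence `A` of a sequence `D = ⟨d₁, …, dₙ⟩`, computed from the right: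
`aₙ = dₙ` and `aᵢ = min (aᵢ₊₁ - 1) dᵢ` for `i < n`. Its entries may be non-positive. -/
def discretized : List ℤ → List ℤ
  | [] => []
  | d :: ds =>
    (match discretized ds with
      | [] => d
      | a :: _ => min (a - 1) d) :: discretized ds

/-- An instance `(D, A, T)` of Position Matching: a non-decreasing sequence `D` of positive
integers, its discretized sequence `A`, and a set `T` of `|D|` distinct positive integers,
listed in increasing order. -/
structure PMInstance where
  D : List ℕ
  A : List ℤ
  T : List ℕ
  D_pos : ∀ d ∈ D, 0 < d
  D_sorted : D.Pairwise (· ≤ ·)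
  A_eq : A = discretized (D.map (fun d : ℕ => (d : ℤ)))
  T_pos : ∀ t ∈ T, 0 < t
  T_sorted : T.Pairwise (· < ·)
  T_length : T.length = D.length

/-- `(D, A, T)` is a yes-instance: the (indexed) entries of `D`, `A`, `T` can be grouped into
triplets `(d, a, t)`, each entry being used exactly once, with `d ≥ a` and `d + a ≥ t`. -/
def PMInstance.Solvable (I : PMInstance) : Prop :=
  ∃ (α : Fin I.D.length ≃ Fin I.A.length) (τ : Fin I.D.length ≃ Fin I.T.length),
    ∀ i : Fin I.D.length,
      I.A.get (α i) ≤ (I.D.get i : ℤ) ∧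
      (I.T.get (τ i) : ℤ) ≤ (I.D.get i : ℤ) + I.A.get (α i)

/-! ### 2-Visits -/

/-- A list is an admissible input of 2-Visits: a non-decreasing sequence of positive integers. -/
structure IsDeadlineSeq (D : List ℕ) : Prop where
  pos : ∀ d ∈ D, 0 < d
  sorted : D.Pairwise (· ≤ ·)

/-- `D = ⟨d₁, …, dₙ⟩` has a feasible 2-Visits schedule: a schedule with positions `1, …, 2n`
in which every node `i` has a primary visit (at position `pos (inl i)`) and a secondary visit
(at position `pos (inr i)`); the primary visit is at position at most `dᵢ`, and the secondary
visit is either before the primary visit or at most `dᵢ` positions after it. -/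
def TwoVisitsFeasible (D : List ℕ) : Prop :=
  ∃ pos : Fin D.length ⊕ Fin D.length ≃ Finset.Icc 1 (2 * D.length),
    ∀ i : Fin D.length,
      (pos (Sum.inl i) : ℕ) ≤ D.get i ∧
      ((pos (Sum.inr i) : ℕ) < (pos (Sum.inl i) : ℕ) ∨
        (pos (Sum.inr i) : ℕ) ≤ (pos (Sum.inl i) : ℕ) + D.get i)

/-- The type of instances of 2-Visits. -/
def TwoVisitsInstance : Type := {D : List ℕ // IsDeadlineSeq D}

/-! ### Encodings of instances as strings and polynomial-time reductions -/

/-- A sequence of objects, each given by a bit string, written over the alphabet `Γ'` as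
`[w₁,w₂,…,wₙ,]`. -/
def encodeSeq {α : Type} (e : α → List Bool) (l : List α) : List Γ' :=
  Γ'.bra :: (l.flatMap (fun x => (e x).map Γ'.bit ++ [Γ'.comma]) ++ [Γ'.ket])

/-- Integers are written as a sign bit followed by the absolute value in binary. -/
def encodeInt (z : ℤ) : List Bool := decide (z < 0) :: encodeNat z.natAbs

/-- The three sequences `D`, `A`, `T`, one after the other, with all numbers in binary. -/
def encodePM (I : PMInstance) : List Γ' :=
  encodeSeq encodeNat I.D ++ encodeSeq encodeInt I.A ++ encodeSeq encodeNat I.T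

/-- The sequence of deadlines, with all numbers in binary. -/
def encodeTwoVisits (D : TwoVisitsInstance) : List Γ' := encodeSeq encodeNat D.1

/-- Polynomial-time many-one reducibility between two decision problems, given by the predicates
`P` and `Q` on their instances and by encodings of the instances as strings: some function `f`
computable by a Turing machine in time polynomial in the length of the encoded instance maps
yes-instances to yes-instances and no-instances to no-instances. -/
def PolyTimeReducible {α β : Type} (ea : α → List Γ') (P : α → Prop)
    (eb : β → List Γ') (Q : β → Prop) : Prop :=
  ∃ f : α → β, Nonempty (Turing.TM2ComputableInPolyTime ea eb f) ∧ ∀ x, P x ↔ Q (f x)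

/-! ### The explicit construction for normalized instances -/

/-- `A` consists of consecutive integers, its first element is odd, and every target exceeds
every element of `A`. (In particular the instance is non-empty.) -/
structure PMInstance.Normalized (I : PMInstance) : Prop where
  consecutive : I.A.IsChain (fun a b => b = a + 1)
  odd_head : ∃ a ∈ I.A.head?, Odd a
  lt_target : ∀ t ∈ I.T, ∀ a ∈ I.A, a < (t : ℤ)

/-- The small deadlines: the odd positive integers below `a₁`, in increasing order. -/
def PMInstance.small (I : PMInstance) : List ℕ :=
  (List.range (I.A.headD 0).toNat).filter (fun s => s % 2 = 1)

/-- The large deadlines: the elements of `[aₙ + 1, 2aₙ] \ T`, in increasing order. -/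
def PMInstance.large (I : PMInstance) : List ℕ :=
  (List.range' ((I.A.getLastD 0).toNat + 1) (I.A.getLastD 0).toNat).filter (fun l => l ∉ I.T)

/-! ### The encodings are faithful -/

theorem encodeNat_inj : Function.Injective encodeNat :=
  Function.LeftInverse.injective decode_encodeNat

theorem encodeInt_inj : Function.Injective encodeInt := by
  intro x y h
  simp only [encodeInt, List.cons.injEq, decide_eq_decide] at h
  have := encodeNat_inj h.2
  omega

theorem encodeWord_append_inj : ∀ (u v : List Bool) (r s : List Γ'),
    u.map Γ'.bit ++ Γ'.comma :: r = v.map Γ'.bit ++ Γ'.comma :: s → u = v ∧ r = s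
  | [], [], r, s, h => by simpa using h
  | [], _ :: _, r, s, h => by simp at h
  | _ :: _, [], r, s, h => by simp at h
  | a :: u, b :: v, r, s, h => by
    simp only [List.map_cons, List.cons_append, List.cons.injEq, Γ'.bit.injEq] at h
    have := encodeWord_append_inj u v r s h.2
    exact ⟨by rw [h.1, this.1], this.2⟩

theorem encodeSeq_append_inj {α : Type} {e : α → List Bool} (he : Function.Injective e) :
    ∀ (l m : List α) (r s : List Γ'),
      encodeSeq e l ++ r = encodeSeq e m ++ s → l = m ∧ r = s
  | [], [], r, s, h => by simpa [encodeSeq] using h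
  | [], y :: m, r, s, h => by
    cases hy : e y <;> simp [encodeSeq, hy] at h
  | x :: l, [], r, s, h => by
    cases hx : e x <;> simp [encodeSeq, hx] at h
  | x :: l, y :: m, r, s, h => by
    simp only [encodeSeq, List.flatMap_cons, List.cons_append, List.append_assoc,
      List.cons.injEq, true_and, List.nil_append] at h
    obtain ⟨h₁, h₂⟩ := encodeWord_append_inj _ _ _ _ h
    have := encodeSeq_append_inj he l m r s (by simpa [encodeSeq] using h₂)
    exact ⟨by rw [he h₁, this.1], this.2⟩

theorem encodePM_inj : Function.Injective encodePM := by
  rintro ⟨D, A, T, _, _, _, _, _, _⟩ ⟨D', A', T', _, _, _, _, _, _⟩ h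
  simp only [encodePM, List.append_assoc] at h
  obtain ⟨rfl, h₁⟩ := encodeSeq_append_inj encodeNat_inj _ _ _ _ h
  obtain ⟨rfl, h₂⟩ := encodeSeq_append_inj encodeInt_inj _ _ _ _ h₁
  obtain ⟨rfl, -⟩ := encodeSeq_append_inj encodeNat_inj T T' [] [] (by simpa using h₂)
  rfl

theorem encodeTwoVisits_inj : Function.Injective encodeTwoVisits := by
  intro D D' h
  exact Subtype.ext (encodeSeq_append_inj encodeNat_inj D.1 D'.1 [] [] (by
    simpa [encodeTwoVisits] using h)).1

/-! The normalized case. Among all feasible schedules take one whose primary visits are as late as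
possible (`VisitFeasible.exists_late`). A counting argument (`primary_mem_of_late`) then determines
the set of primary positions: the odd positions below `a₁`, the interval `[a₁, aₙ]`, and `L`. Every
small node sits exactly at its deadline, and every deadline `d` of `D` receives a position `a ≤ d`
of the interval, which is a matching of `D` with `A`. Up to `2aₙ` the positions left for secondary
visits are the even numbers below `a₁` and the complement of `L`, that is, the targets. The nodes of
`S` and `D` need their secondary visits by `2aₙ`, and there are no more free positions than such
nodes, so every target is used. A target above `2a₁` is out of reach for the small nodes and must be
covered by some sum `d + a`; the lower targets lie below all sums anyway. Hence the sums `d + a`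
dominate `T` threshold by threshold, which by Hall's theorem (`exists_equiv_le_iff`) is the same as
a matching with the targets. Conversely a matching yields a schedule directly
(`visitFeasible_of_assignment`).

The general case. Every deadline occurs in `A`, at an index `δ j`, and a matching is a permutation
`α` of indices with `α j ≤ δ j`. If `aᵢ₊₁ ≠ aᵢ + 1`, then `aᵢ = dᵢ`, so the deadlines up to index
`i` are at most `aᵢ`; therefore `δ`, and with it `α`, preserves the initial segment of indices up to
`i`. No matched pair straddles the gap, and no sum lies strictly between `2aᵢ` and `2aᵢ₊₁`. Of the
targets in that range only their number `k` matters. So the gap may be resized to `K = k - 1` extra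
positions (none if `k = 0`). Each extra position is its own deadline, hence is matched with itself,
and it brings one extra target. For `k > 0` the resized gap has `2K + 1` slots for targets, and
these are exactly filled by the `k` old and the `K` extra ones. Inside the gap every extra position
costs two targets and only one sum, so domination there follows from domination at its lower end.
This is `GapFilling.solvable_iff`.

After resizing there are `N ≤ 2n` positions, however large the input numbers are. Shifting them to
`[2N + 1, 3N]` makes the first one odd and puts all targets above all positions. Targets above `2aₙ`
cannot be covered; they have no slot, so `L` has more than `2N` elements and the constructed
instance is infeasible too (`PMInstance.solvable_iff_reduction`).

Complexity. One merging pass through `A`, `T` and `D` finds the data of each step. The output is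
non-decreasing with entries linear in `n`, so it is described by a word of linear length over the
instructions "increment" and "print" for a single counter. Small structured stack programs, compiled
to machines of type `TM2`, write this word and then execute it with a binary counter. -/

/-! ### Matching and reindexing finite families -/

/-- Two families of the same size can be matched with `T (e i) ≤ f i` iff every threshold is
exceeded at least as often by `f` as by `T`. -/
theorem exists_equiv_le_iff {ι κ : Type*} [Fintype ι] [Fintype κ] {R : Type*}
    [LinearOrder R] (f : ι → R) (T : κ → R)
    (h : Fintype.card ι = Fintype.card κ) :
    (∃ e : ι ≃ κ, ∀ i, T (e i) ≤ f i) ↔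
      ∀ y, (Finset.univ.filter fun k => y ≤ T k).card ≤
        (Finset.univ.filter fun i => y ≤ f i).card := by
  classical
  constructor
  · rintro ⟨e, he⟩ y
    refine Finset.card_le_card_of_injOn e.symm ?_ e.symm.injective.injOn
    intro k hk
    simp only [Finset.coe_filter, Finset.mem_univ, true_and, Set.mem_ofPred_eq] at hk ⊢
    have := he (e.symm k)
    rw [e.apply_symm_apply] at this
    exact hk.trans this
  · intro hy
    -- The admissible partners of the targets form a chain under inclusion, so Hall's condition for
    -- a set `s` only concerns the smallest target in `s`; the hypothesis at that threshold supplies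
    -- it.
    have hall := (Finset.all_card_le_biUnion_card_iff_exists_injective
      (fun k : κ => Finset.univ.filter fun i => T k ≤ f i)).1 (by
        intro s
        rcases s.eq_empty_or_nonempty with rfl | hs
        · simp
        obtain ⟨k₀, hk₀, hmin⟩ := s.exists_min_image T hs
        calc s.card ≤ (Finset.univ.filter fun k => T k₀ ≤ T k).card := by
              refine Finset.card_le_card fun k hk => ?_
              simpa using hmin k hk
          _ ≤ _ := hy _
          _ ≤ _ := Finset.card_le_card (by
              intro i hi
              exact Finset.mem_biUnion.2 ⟨k₀, hk₀, hi⟩))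
    obtain ⟨g, hg, hgm⟩ := hall
    have hb : Function.Bijective g :=
      (Fintype.bijective_iff_injective_and_card g).2 ⟨hg, h.symm⟩
    refine ⟨(Equiv.ofBijective g hb).symm, fun i => ?_⟩
    have := hgm ((Equiv.ofBijective g hb).symm i)
    simp only [Finset.mem_filter, Finset.mem_univ, true_and] at this
    have h2 : g ((Equiv.ofBijective g hb).symm i) = i :=
      (Equiv.ofBijective g hb).apply_symm_apply i
    rwa [h2] at this

/-- A list and a finite family with the same multiset of values are reindexings of each other. -/
theorem exists_equiv_of_coe_eq_map {ι β : Type*} [Fintype ι] [DecidableEq β] (l : List β)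
    (f : ι → β) (h : (l : Multiset β) = Finset.univ.val.map f) :
    ∃ e : Fin l.length ≃ ι, ∀ i, l.get i = f (e i) := by
  classical
  have h1 : (Finset.univ.val.map l.get : Multiset β) = l := by
    simp
  have key : ∀ b, Nonempty ({i // l.get i = b} ≃ {i // f i = b}) := by
    intro b
    have h3 := congrArg (Multiset.count b) (h1.trans h)
    rw [Multiset.count_map, Multiset.count_map] at h3
    refine ⟨Fintype.equivOfCardEq ?_⟩
    rw [Fintype.card_subtype, Fintype.card_subtype]
    simpa [Finset.card, eq_comm] using h3
  refine ⟨Equiv.ofFiberEquiv (f := l.get) (g := f) fun b => (key b).some, fun i => ?_⟩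
  exact (Equiv.ofFiberEquiv_map _ i).symm

/-! ### Schedules of 2-Visits and late schedules -/

/-- The conditions on a 2-Visits schedule for nodes `v : V` with deadlines `d v`. -/
def IsVisitSchedule {V : Type*} [Fintype V] (d : V → ℕ)
    (pos : V ⊕ V ≃ Finset.Icc 1 (2 * Fintype.card V)) : Prop :=
  ∀ v, (pos (Sum.inl v) : ℕ) ≤ d v ∧
    ((pos (Sum.inr v) : ℕ) < (pos (Sum.inl v) : ℕ) ∨
      (pos (Sum.inr v) : ℕ) ≤ (pos (Sum.inl v) : ℕ) + d v)

/-- Feasibility of 2-Visits for a family of deadlines indexed by an arbitrary finite type. -/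
def VisitFeasible {V : Type*} [Fintype V] (d : V → ℕ) : Prop :=
  ∃ pos, IsVisitSchedule d pos

theorem VisitFeasible.reindex {V W : Type*} [Fintype V] [Fintype W] {d : V → ℕ} {d' : W → ℕ}
    (e : V ≃ W) (h : ∀ v, d v = d' (e v)) (hd : VisitFeasible d) : VisitFeasible d' := by
  obtain ⟨pos, hpos⟩ := hd
  have hc : Fintype.card V = Fintype.card W := Fintype.card_congr e
  refine ⟨(Equiv.sumCongr e.symm e.symm).trans (pos.trans (Equiv.subtypeEquivRight ?_)), ?_⟩
  · intro x; rw [hc]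
  · intro w
    have := hpos (e.symm w)
    rw [h, e.apply_symm_apply] at this
    exact this

/-- Only the multiset of deadlines matters, so the sorted list may be replaced by a family indexed
by a sum type that separates the groups of nodes. -/
theorem twoVisitsFeasible_iff {V : Type*} [Fintype V] (D : List ℕ) (d : V → ℕ)
    (h : (D : Multiset ℕ) = Finset.univ.val.map d) :
    TwoVisitsFeasible D ↔ VisitFeasible d := by
  obtain ⟨e, he⟩ := exists_equiv_of_coe_eq_map D d h
  have : TwoVisitsFeasible D ↔ VisitFeasible D.get := by
    unfold TwoVisitsFeasible VisitFeasible IsVisitSchedule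
    rw [Fintype.card_fin]
  rw [this]
  exact ⟨fun hf => hf.reindex e he, fun hf => hf.reindex e.symm fun w => by
    rw [he, e.apply_symm_apply]⟩

/-- Swapping a primary visit with a later secondary visit keeps a schedule valid as long as the
deadline of the primary visit is respected. -/
theorem IsVisitSchedule.swap {V : Type*} [Fintype V] [DecidableEq V] {d : V → ℕ}
    {pos : V ⊕ V ≃ Finset.Icc 1 (2 * Fintype.card V)} (hpos : IsVisitSchedule d pos) {v w : V}
    (hlt : (pos (Sum.inl v) : ℕ) < pos (Sum.inr w)) (hd : (pos (Sum.inr w) : ℕ) ≤ d v) :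
    IsVisitSchedule d ((Equiv.swap (Sum.inl v) (Sum.inr w)).trans pos) := by
  intro u
  have hu := hpos u
  have hv := hpos v
  have hw := hpos w
  by_cases huv : u = v <;> by_cases huw : u = w
  · subst huv; subst huw
    simp only [Equiv.trans_apply, Equiv.swap_apply_left, Equiv.swap_apply_right]
    omega
  · subst huv
    have h1 : Equiv.swap (Sum.inl u) (Sum.inr w) (Sum.inr u) = Sum.inr u :=
      Equiv.swap_apply_of_ne_of_ne (by simp) (by simpa using huw)
    simp only [Equiv.trans_apply, Equiv.swap_apply_left, h1]
    omega
  · subst huw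
    have h1 : Equiv.swap (Sum.inl v) (Sum.inr u) (Sum.inl u) = Sum.inl u :=
      Equiv.swap_apply_of_ne_of_ne (by simpa using huv) (by simp)
    simp only [Equiv.trans_apply, Equiv.swap_apply_right, h1]
    omega
  · have h1 : Equiv.swap (Sum.inl v) (Sum.inr w) (Sum.inl u) = Sum.inl u :=
      Equiv.swap_apply_of_ne_of_ne (by simpa using huv) (by simp)
    have h2 : Equiv.swap (Sum.inl v) (Sum.inr w) (Sum.inr u) = Sum.inr u :=
      Equiv.swap_apply_of_ne_of_ne (by simp) (by simpa using huw)
    simp only [Equiv.trans_apply, h1, h2]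
    exact hu

/-- A feasible instance has a schedule with all primary visits as late as possible: a primary
visit before some secondary visit cannot be moved to the position of the latter. -/
theorem VisitFeasible.exists_late {V : Type*} [Fintype V] {d : V → ℕ} (h : VisitFeasible d) :
    ∃ pos, IsVisitSchedule d pos ∧ ∀ v w, (pos (Sum.inl v) : ℕ) < pos (Sum.inr w) →
      d v < pos (Sum.inr w) := by
  classical
  obtain ⟨pos₀, h₀⟩ := h
  -- Each admissible swap strictly increases the sum of the primary positions, so a maximizer of
  -- that sum admits none.
  obtain ⟨pos, hmem, hmax⟩ := (Finset.univ.filter fun pos => IsVisitSchedule d pos).exists_max_image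
    (fun pos => ∑ v, (pos (Sum.inl v) : ℕ)) ⟨pos₀, by simpa using h₀⟩
  have hpos : IsVisitSchedule d pos := by simpa using hmem
  refine ⟨pos, hpos, fun v w hlt => ?_⟩
  by_contra! hd
  have h1 := hmax _ (by simpa using hpos.swap hlt hd)
  refine absurd h1 (not_le.2 ?_)
  refine Finset.sum_lt_sum (fun u _ => ?_) ⟨v, Finset.mem_univ _, ?_⟩
  · by_cases huv : u = v
    · subst huv
      simp only [Equiv.trans_apply, Equiv.swap_apply_left]
      exact hlt.le
    · rw [Equiv.trans_apply, Equiv.swap_apply_of_ne_of_ne (by simpa using huv) (by simp)]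
  · simp only [Equiv.trans_apply, Equiv.swap_apply_left]
    exact hlt

/-- In a late schedule every primary position lies in `A`, provided that deadlines dominate an
injection `g` into `A` that does not cross elements outside `A`. -/
theorem primary_mem_of_late {V : Type*} [Fintype V] {d g : V → ℕ} {A : Set ℕ}
    {pos : V ⊕ V ≃ Finset.Icc 1 (2 * Fintype.card V)} (hpos : IsVisitSchedule d pos)
    (hlate : ∀ v w, (pos (Sum.inl v) : ℕ) < pos (Sum.inr w) → d v < pos (Sum.inr w))
    (hd : ∀ v, d v ≤ 2 * Fintype.card V) (hg : Function.Injective g) (hgA : ∀ v, g v ∈ A)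
    (hgd : ∀ v, g v ≤ d v) (hcross : ∀ x, x ∉ A → ∀ v, x ≤ d v → x ≤ g v) (v : V) :
    (pos (Sum.inl v) : ℕ) ∈ A := by
  classical
  by_contra hx
  set x := (pos (Sum.inl v) : ℕ) with hxdef
  set p : V → ℕ := fun u => pos (Sum.inl u) with hp
  have hpinj : Function.Injective p := fun u w h => by
    simpa using pos.injective (Subtype.ext h)
  have hpmem : ∀ u, 1 ≤ p u ∧ p u ≤ 2 * Fintype.card V := fun u =>
    Finset.mem_Icc.1 (pos (Sum.inl u)).2
  -- `q` is the first position after `x` without a primary visit; it is either a secondary position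
  -- or the fictitious position `2|V| + 1`. All of `[x, q)` is then primary.
  have hex : ∃ q, x < q ∧ ∀ u, p u ≠ q := ⟨2 * Fintype.card V + 1, by
    have := hpmem v; simp only [hp] at this; omega, fun u hu => by have := hpmem u; omega⟩
  obtain ⟨hxq, hq⟩ := Nat.find_spec hex
  have hmin := fun y (hy : y < Nat.find hex) => Nat.find_min hex hy
  have hqle : Nat.find hex ≤ 2 * Fintype.card V + 1 := Nat.find_min' hex ⟨by
    have := hpmem v; simp only [hp] at this; omega, fun u hu => by have := hpmem u; omega⟩
  generalize Nat.find hex = q at hxq hq hmin hqle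
  -- By lateness a primary visit before the secondary position `q` could not be moved there, so its
  -- deadline is below `q`; at the end of the schedule the bound on the deadlines does the same.
  have hpd : ∀ u, p u < q → d u < q := by
    intro u hu
    by_cases hq2 : q = 2 * Fintype.card V + 1
    · have := hd u; omega
    · have hqm : q ∈ Finset.Icc 1 (2 * Fintype.card V) := Finset.mem_Icc.2 (by omega)
      obtain ⟨s, hs⟩ := pos.surjective ⟨q, hqm⟩
      rcases s with s | s
      · exact absurd (by simp [hp, hs]) (hq s)
      · have := hlate u s
        rw [hs] at this
        exact this hu
  have hsub : (Finset.univ.filter fun u => d u < x) ⊆ Finset.univ.filter fun u => p u < x := by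
    intro u hu
    simp only [Finset.mem_filter, Finset.mem_univ, true_and] at hu ⊢
    exact lt_of_le_of_lt (hpos u).1 hu
  have hI : (Finset.Ico x q).card ≤ (Finset.univ.filter fun u => x ≤ p u ∧ p u < q).card := by
    refine (Finset.card_le_card (t := (Finset.univ.filter fun u => x ≤ p u ∧ p u < q).image p)
      ?_).trans Finset.card_image_le
    intro y hy
    rw [Finset.mem_Ico] at hy
    rcases hy.1.eq_or_lt with rfl | hlt
    · exact Finset.mem_image.2 ⟨v, by simp [hp, ← hxdef, hxq], rfl⟩
    · have := hmin y hy.2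
      push Not at this
      obtain ⟨u, hu⟩ := this hlt
      exact Finset.mem_image.2 ⟨u, by simp [hu, hy], hu⟩
  -- `g` sends the nodes with deadline in `[x, q)` injectively into `(x, q)`, which leaves room for
  -- `q - x - 1` of them. But the `q - x` primary visits in `[x, q)` need at least `q - x` such
  -- nodes, because nodes with deadline below `x` are visited before `x`.
  have hJ : (Finset.univ.filter fun u => x ≤ d u ∧ d u < q).card ≤ (Finset.Ioo x q).card := by
    refine Finset.card_le_card_of_injOn g ?_ hg.injOn
    intro u hu
    simp only [Finset.coe_filter, Finset.mem_univ, true_and, Set.mem_ofPred_eq] at hu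
    have h1 := hcross x hx u hu.1
    have h2 : g u ≠ x := fun h => hx (h ▸ hgA u)
    have h3 := hgd u
    simp only [Finset.coe_Ioo, Set.mem_Ioo]
    omega
  have split : ∀ f : V → ℕ, (Finset.univ.filter fun u => f u < q).card =
      (Finset.univ.filter fun u => f u < x).card +
        (Finset.univ.filter fun u => x ≤ f u ∧ f u < q).card := by
    intro f
    rw [← Finset.card_union_of_disjoint]
    · congr 1; ext u; simp; omega
    · rw [Finset.disjoint_left]; intro u; simp; omega
  have h1 := split p
  have h2 := split d
  have h3 : (Finset.univ.filter fun u => p u < q).card ≤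
      (Finset.univ.filter fun u => d u < q).card :=
    Finset.card_le_card fun u => by simpa using hpd u
  have h4 := Finset.card_le_card hsub
  rw [Nat.card_Ico] at hI
  rw [Nat.card_Ioo] at hJ
  omega

/-! ### Instances with small odd, middle and large deadlines -/

/-- The deadlines `1, 3, …, 2k - 1`, followed by the deadlines `d`, followed by the set `L`. -/
def blockDeadlines {ι : Type*} (k : ℕ) (d : ι → ℕ) (L : Finset ℕ) : Fin k ⊕ ι ⊕ L → ℕ :=
  Sum.elim (fun s => 2 * (s : ℕ) + 1) (Sum.elim d (fun l => l))

section Block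

variable {ι : Type*} [Fintype ι] {k n : ℕ} {a d : ι → ℕ} {L : Finset ℕ}

/-- A late schedule has its primary visits exactly on the odd numbers below `2k`, the interval `[2k
+ 1, 2k + n]` and `L`. The primary positions of the middle nodes give `α`. The secondary visits of
small and middle nodes fit only into the `k` even positions up to `2k` and the complement of `L`.
There are `k + n` of them and at most that many places, which forces `L.card = 2 * k` and makes
every target occupied. -/
theorem exists_assignment_of_visitFeasible (hn : Fintype.card ι = n) (ha : Function.Injective a)
    (haI : ∀ i, 2 * k + 1 ≤ a i ∧ a i ≤ 2 * k + n) (had : ∀ i, a i ≤ d i)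
    (hd : ∀ i, d i ≤ 2 * k + n) (hL : L ⊆ Finset.Icc (2 * k + n + 1) (4 * k + 2 * n))
    (hLc : 2 * k ≤ L.card) (h : VisitFeasible (blockDeadlines k d L)) :
    L.card = 2 * k ∧ ∃ α : Equiv.Perm ι, (∀ i, a (α i) ≤ d i) ∧
      ∀ y, ((Finset.Icc (2 * k + n + 1) (4 * k + 2 * n) \ L).filter fun t => y ≤ t).card ≤
        (Finset.univ.filter fun i => y ≤ d i + a (α i)).card := by
  classical
  have hLm : ∀ l ∈ L, 2 * k + n + 1 ≤ l ∧ l ≤ 4 * k + 2 * n := fun l hl => Finset.mem_Icc.1 (hL hl)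
  have hcard : Fintype.card (Fin k ⊕ ι ⊕ L) = k + (n + L.card) := by simp [hn]
  set A : Finset ℕ := ((Finset.range k).image (fun s => 2 * s + 1) ∪
    Finset.Icc (2 * k + 1) (2 * k + n)) ∪ L with hA
  have memA : ∀ x, x ∈ A ↔ (∃ s < k, 2 * s + 1 = x) ∨ (2 * k + 1 ≤ x ∧ x ≤ 2 * k + n) ∨ x ∈ L := by
    intro x; simp [hA]
  have cardA : A.card ≤ k + (n + L.card) := by
    refine (Finset.card_union_le _ _).trans ?_
    have h1 := Finset.card_union_le ((Finset.range k).image (fun s => 2 * s + 1))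
      (Finset.Icc (2 * k + 1) (2 * k + n))
    have h2 := Finset.card_image_le (s := Finset.range k) (f := fun s => 2 * s + 1)
    simp only [Finset.card_range, Nat.card_Icc] at h1 h2
    omega
  obtain ⟨pos, hpos, hlate⟩ := h.exists_late
  have hposA : ∀ v, (pos (Sum.inl v) : ℕ) ∈ (A : Set ℕ) := by
    -- Here `g` replaces the middle deadlines `d` by `a` and leaves the others alone. Only middle
    -- nodes can cross a position between `a i` and `d i`, and all those positions belong to `A`.
    refine primary_mem_of_late (g := blockDeadlines k a L) hpos hlate ?_ ?_ ?_ ?_ ?_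
    · rw [hcard]
      rintro (s | i | ⟨l, hl⟩) <;> simp only [blockDeadlines, Sum.elim_inl, Sum.elim_inr]
      · have := s.2; omega
      · have := hd i; omega
      · have := hLm l hl; omega
    · rintro (s | i | ⟨l, hl⟩) (s' | i' | ⟨l', hl'⟩) hh <;>
        simp only [blockDeadlines, Sum.elim_inl, Sum.elim_inr] at hh
      · congr 1; ext; omega
      · have := s.2; have := haI i'; omega
      · have := s.2; have := hLm l' hl'; omega
      · have := s'.2; have := haI i; omega
      · rw [ha hh]
      · have := haI i; have := hLm l' hl'; omega
      · have := s'.2; have := hLm l hl; omega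
      · have := haI i'; have := hLm l hl; omega
      · subst hh; rfl
    · rintro (s | i | ⟨l, hl⟩) <;>
        simp only [blockDeadlines, Sum.elim_inl, Sum.elim_inr, Finset.mem_coe, memA]
      · exact Or.inl ⟨s, s.2, rfl⟩
      · exact Or.inr (Or.inl (haI i))
      · exact Or.inr (Or.inr hl)
    · rintro (s | i | ⟨l, hl⟩) <;> simp only [blockDeadlines, Sum.elim_inl, Sum.elim_inr, le_refl]
      exact had i
    · rintro x hx (s | i | ⟨l, hl⟩) hxd <;>
        simp only [blockDeadlines, Sum.elim_inl, Sum.elim_inr] at hxd ⊢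
      · exact hxd
      · simp only [Finset.mem_coe, memA, not_or] at hx
        have := hd i; have := haI i; omega
      · exact hxd
  set p : Fin k ⊕ ι ⊕ L → ℕ := fun v => pos (Sum.inl v) with hp
  set q : Fin k ⊕ ι ⊕ L → ℕ := fun v => pos (Sum.inr v) with hq
  have hpinj : Function.Injective p := fun u w h => by
    simpa using pos.injective (Subtype.ext h)
  have hqinj : Function.Injective q := fun u w h => by
    simpa using pos.injective (Subtype.ext h)
  have hpq : ∀ u w, p u ≠ q w := fun u w h => by
    simpa using pos.injective (Subtype.ext h)
  have hq1 : ∀ u, 1 ≤ q u := fun u => (Finset.mem_Icc.1 (pos (Sum.inr u)).2).1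
  have hpA : Finset.univ.image p = A := by
    refine Finset.eq_of_subset_of_card_le ?_ ?_
    · intro x hx
      obtain ⟨v, -, rfl⟩ := Finset.mem_image.1 hx
      exact hposA v
    · rw [Finset.card_image_of_injective _ hpinj, Finset.card_univ, hcard]
      exact cardA
  have hqA : ∀ u, q u ∉ A := by
    intro u hu
    rw [← hpA] at hu
    obtain ⟨v, -, hv⟩ := Finset.mem_image.1 hu
    exact hpq v u hv
  -- The `m`-th small node must sit at some odd position `2s + 1` with `s ≤ m`, and those with `s <
  -- m` are already taken by the previous nodes.
  have hps : ∀ m, ∀ hm : m < k, p (Sum.inl ⟨m, hm⟩) = 2 * m + 1 := by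
    intro m
    induction m using Nat.strong_induction_on with
    | _ m ih =>
      intro hm
      have h1 := (hpos (Sum.inl ⟨m, hm⟩)).1
      have h2 := (memA _).1 (hposA (Sum.inl ⟨m, hm⟩))
      simp only [blockDeadlines, Sum.elim_inl] at h1
      change p _ ≤ _ at h1
      change (∃ s < k, 2 * s + 1 = p _) ∨ (2 * k + 1 ≤ p _ ∧ p _ ≤ 2 * k + n) ∨ p _ ∈ L at h2
      rcases h2 with ⟨s, hs, h2⟩ | h2 | h2
      · by_contra hne
        have hlt : s < m := by omega
        have h3 := ih s hlt hs
        have := hpinj (h3.trans h2)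
        simp at this
        omega
      · omega
      · have := hLm _ h2; omega
  have hpi : ∀ i, 2 * k + 1 ≤ p (Sum.inr (Sum.inl i)) ∧ p (Sum.inr (Sum.inl i)) ≤ 2 * k + n := by
    intro i
    have h1 := (hpos (Sum.inr (Sum.inl i))).1
    have h2 := (memA _).1 (hposA (Sum.inr (Sum.inl i)))
    simp only [blockDeadlines, Sum.elim_inl, Sum.elim_inr] at h1
    change p _ ≤ _ at h1
    change (∃ s < k, 2 * s + 1 = p _) ∨ (2 * k + 1 ≤ p _ ∧ p _ ≤ 2 * k + n) ∨ p _ ∈ L at h2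
    have := hd i
    rcases h2 with ⟨s, hs, h2⟩ | h2 | h2
    · have := hpinj ((hps s hs).trans h2)
      simp at this
    · exact h2
    · have := hLm _ h2; omega
  -- the matching
  have hasurj : Finset.univ.image a = Finset.Icc (2 * k + 1) (2 * k + n) := by
    refine Finset.eq_of_subset_of_card_le ?_ ?_
    · intro x hx
      obtain ⟨i, -, rfl⟩ := Finset.mem_image.1 hx
      exact Finset.mem_Icc.2 (haI i)
    · rw [Finset.card_image_of_injective _ ha, Finset.card_univ, hn, Nat.card_Icc]
      omega
  have hα : ∀ i, ∃ j, a j = p (Sum.inr (Sum.inl i)) := by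
    intro i
    have := Finset.mem_Icc.2 (hpi i)
    rw [← hasurj] at this
    obtain ⟨j, -, hj⟩ := Finset.mem_image.1 this
    exact ⟨j, hj⟩
  choose α hα using hα
  have hαinj : Function.Injective α := by
    intro i j hij
    have := (hα i).symm.trans ((congrArg a hij).trans (hα j))
    simpa using hpinj this
  have hαb : Function.Bijective α := Finite.injective_iff_bijective.1 hαinj
  set T : Finset ℕ := Finset.Icc (2 * k + n + 1) (4 * k + 2 * n) \ L with hT
  have memT : ∀ x, x ∈ T ↔ (2 * k + n + 1 ≤ x ∧ x ≤ 4 * k + 2 * n) ∧ x ∉ L := by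
    intro x; simp [hT]
  have cardT : T.card = 2 * k + n - L.card := by
    rw [hT, Finset.card_sdiff_of_subset hL, Nat.card_Icc]; omega
  -- secondary visits of the first two groups
  set r : Fin k ⊕ ι → ℕ := Sum.elim (fun s => q (Sum.inl s)) (fun i => q (Sum.inr (Sum.inl i)))
    with hr
  have hrinj : Function.Injective r := by
    rintro (s | i) (s' | i') hh <;> simp only [hr, Sum.elim_inl, Sum.elim_inr] at hh <;>
      have := hqinj hh <;> simp at this <;> simp [this]
  have hrs : ∀ s, r (Sum.inl s) ≤ 4 * (s : ℕ) + 2 := by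
    intro s
    have h1 := (hpos (Sum.inl s)).2
    have h2 := hps s s.2
    simp only [blockDeadlines, Sum.elim_inl] at h1
    change q _ < p _ ∨ q _ ≤ p _ + _ at h1
    simp only [Fin.eta] at h2
    simp only [hr, Sum.elim_inl]
    omega
  have hri : ∀ i, r (Sum.inr i) < p (Sum.inr (Sum.inl i)) ∨
      r (Sum.inr i) ≤ p (Sum.inr (Sum.inl i)) + d i := fun i => (hpos (Sum.inr (Sum.inl i))).2
  -- `E` consists of the non-primary positions up to `4k + 2n`. Every secondary visit of a small or
  -- middle node lands in it, since `4k + 2n` is twice the last middle position.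
  set E : Finset ℕ := (Finset.range k).image (fun s => 2 * s + 2) ∪ T with hE
  have cardE : E.card ≤ k + T.card := by
    refine (Finset.card_union_le _ _).trans ?_
    have h2 := Finset.card_image_le (s := Finset.range k) (f := fun s => 2 * s + 2)
    simp only [Finset.card_range] at h2
    omega
  have hrE : ∀ v, r v ∈ E := by
    intro v
    have hle : r v ≤ 4 * k + 2 * n := by
      rcases v with s | i
      · have := hrs s; have := s.2; omega
      · have := hri i; have := hpi i; have := hd i; omega
    have h1 : 1 ≤ r v := by rcases v with s | i <;> exact hq1 _
    have h2 : r v ∉ A := by rcases v with s | i <;> exact hqA _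
    rw [memA] at h2
    push Not at h2
    obtain ⟨h2, h3, h4⟩ := h2
    rw [hE, Finset.mem_union, memT]
    by_cases hlt : r v ≤ 2 * k
    · left
      rcases Nat.even_or_odd' (r v) with ⟨m, hm | hm⟩
      · exact Finset.mem_image.2 ⟨m - 1, by rw [Finset.mem_range]; omega, by omega⟩
      · exact absurd hm.symm (h2 m (by omega))
    · exact Or.inr ⟨⟨by have := h3 (by omega); omega, hle⟩, h4⟩
  have hrcard : (Finset.univ.image r).card = k + n := by
    rw [Finset.card_image_of_injective _ hrinj, Finset.card_univ]; simp [hn]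
  have hsubE : Finset.univ.image r ⊆ E := by
    intro x hx
    obtain ⟨v, -, rfl⟩ := Finset.mem_image.1 hx
    exact hrE v
  have hle := Finset.card_le_card hsubE
  have hLe : L.card ≤ 2 * k + n := by
    have := Finset.card_le_card hL; rw [Nat.card_Icc] at this; omega
  have hL2 : L.card = 2 * k := by omega
  have heqE : Finset.univ.image r = E := Finset.eq_of_subset_of_card_le hsubE (by omega)
  refine ⟨hL2, Equiv.ofBijective α hαb, fun i => ?_, fun y => ?_⟩
  · have := (hpos (Sum.inr (Sum.inl i))).1
    simp only [Equiv.ofBijective_apply, hα]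
    exact this
  · simp only [Equiv.ofBijective_apply, hα]
    -- Every sum is at least twice the first middle position, namely `4k + 2`, so lower thresholds
    -- are met by all nodes. Beyond it the small nodes, whose secondary visits come by `4k - 2`,
    -- cannot help; a middle node visited there is past its primary visit, so its sum reaches the
    -- target.
    by_cases hy : y ≤ 4 * k + 2
    · refine (Finset.card_filter_le _ _).trans ?_
      rw [Finset.filter_true_of_mem, Finset.card_univ, hn]
      · omega
      · intro i _
        have := hpi i; have := had i; have := haI i; omega
    · refine (Finset.card_le_card (t := (Finset.univ.filter fun i =>
        y ≤ d i + p (Sum.inr (Sum.inl i))).image (fun i => r (Sum.inr i))) ?_).trans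
          Finset.card_image_le
      intro t ht
      rw [Finset.mem_filter] at ht
      have htE : t ∈ E := Finset.mem_union_right _ ht.1
      rw [← heqE] at htE
      obtain ⟨v, -, hv⟩ := Finset.mem_image.1 htE
      rcases v with s | i
      · have := hrs s; have := s.2; omega
      · refine Finset.mem_image.2 ⟨i, ?_, hv⟩
        have := hri i; have := hpi i; have := (memT t).1 ht.1
        simp only [Finset.mem_filter, Finset.mem_univ, true_and]
        omega

/-- The schedule puts small nodes on the pairs `2s + 1, 2s + 2`, middle nodes on `a (α i)` and their
target, and large nodes on their deadline. The secondary visits of the large nodes follow after `4k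
+ 2n` in increasing order of deadline. -/
theorem visitFeasible_of_assignment (hn : Fintype.card ι = n) (ha : Function.Injective a)
    (haI : ∀ i, 2 * k + 1 ≤ a i ∧ a i ≤ 2 * k + n)
    (hL : L ⊆ Finset.Icc (2 * k + n + 1) (4 * k + 2 * n))
    (hLc : L.card = 2 * k) (α : Equiv.Perm ι) (hα : ∀ i, a (α i) ≤ d i)
    (hdom : ∀ y, ((Finset.Icc (2 * k + n + 1) (4 * k + 2 * n) \ L).filter fun t => y ≤ t).card ≤
        (Finset.univ.filter fun i => y ≤ d i + a (α i)).card) :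
    VisitFeasible (blockDeadlines k d L) := by
  classical
  have hLm : ∀ l ∈ L, 2 * k + n + 1 ≤ l ∧ l ≤ 4 * k + 2 * n := fun l hl => Finset.mem_Icc.1 (hL hl)
  have hcard : Fintype.card (Fin k ⊕ ι ⊕ L) = 3 * k + n := by simp [hn, hLc]; ring
  set T : Finset ℕ := Finset.Icc (2 * k + n + 1) (4 * k + 2 * n) \ L with hT
  have memT : ∀ x ∈ T, (2 * k + n + 1 ≤ x ∧ x ≤ 4 * k + 2 * n) ∧ x ∉ L := by
    intro x; simp [hT]
  have cardT : T.card = n := by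
    rw [hT, Finset.card_sdiff_of_subset hL, Nat.card_Icc]; omega
  obtain ⟨τ, hτ⟩ := (exists_equiv_le_iff (fun i => d i + a (α i)) (fun t : T => (t : ℕ))
    (by rw [hn, Fintype.card_coe, cardT])).2 (by
      intro y
      refine le_trans (le_of_eq ?_) (hdom y)
      rw [← Finset.card_map (Function.Embedding.subtype _)]
      congr 1
      ext t
      simp [and_comm]
      )
  set rk : ℕ → ℕ := fun l => (L.filter fun x => x < l).card with hrk
  have rk_lt : ∀ l ∈ L, rk l < 2 * k := by
    intro l hl
    rw [← hLc]
    refine Finset.card_lt_card ⟨Finset.filter_subset _ _, fun h => ?_⟩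
    simpa using h hl
  -- The element of rank `r` in `L` is at least `2k + n + 1 + r`, so twice it is at least `4k + 2n +
  -- 1 + r`, its secondary position.
  have rk_le : ∀ l ∈ L, 2 * k + n + 1 + rk l ≤ l := by
    intro l hl
    have : rk l ≤ (Finset.Ico (2 * k + n + 1) l).card := by
      refine Finset.card_le_card fun x hx => ?_
      rw [Finset.mem_filter] at hx
      exact Finset.mem_Ico.2 ⟨(hLm x hx.1).1, hx.2⟩
    rw [Nat.card_Ico] at this
    have := hLm l hl
    omega
  have rk_inj : ∀ l ∈ L, ∀ l' ∈ L, rk l = rk l' → l = l' := by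
    have key : ∀ l ∈ L, ∀ l' ∈ L, l < l' → rk l < rk l' := by
      intro l hl l' _ hlt
      refine Finset.card_lt_card ⟨fun x hx => ?_, fun h => ?_⟩
      · rw [Finset.mem_filter] at hx ⊢
        exact ⟨hx.1, hx.2.trans hlt⟩
      · have := h (Finset.mem_filter.2 ⟨hl, hlt⟩)
        simp at this
    intro l hl l' hl' h
    rcases lt_trichotomy l l' with h1 | h1 | h1
    · have := key l hl l' hl' h1; omega
    · exact h1
    · have := key l' hl' l hl h1; omega
  set p : Fin k ⊕ ι ⊕ L → ℕ := blockDeadlines k (fun i => a (α i)) L with hp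
  set q : Fin k ⊕ ι ⊕ L → ℕ := Sum.elim (fun s => 2 * (s : ℕ) + 2)
    (Sum.elim (fun i => (τ i : ℕ)) (fun l => 4 * k + 2 * n + 1 + rk l)) with hq
  have hτm : ∀ i, (2 * k + n + 1 ≤ (τ i : ℕ) ∧ (τ i : ℕ) ≤ 4 * k + 2 * n) ∧ (τ i : ℕ) ∉ L :=
    fun i => memT _ (τ i).2
  have hrange : ∀ u, Sum.elim p q u ∈ Finset.Icc 1 (2 * Fintype.card (Fin k ⊕ ι ⊕ L)) := by
    intro u
    rw [hcard, Finset.mem_Icc]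
    rcases u with (s | i | ⟨l, hl⟩) | (s | i | ⟨l, hl⟩) <;>
      simp only [hp, hq, blockDeadlines, Sum.elim_inl, Sum.elim_inr]
    · have := s.2; omega
    · have := haI (α i); omega
    · have := hLm l hl; omega
    · have := s.2; omega
    · have := hτm i; omega
    · have := rk_lt l hl; omega
  have hinj : Function.Injective (Sum.elim p q) := by
    refine Function.Injective.sumElim ?_ ?_ ?_
    · rintro (s | i | ⟨l, hl⟩) (s' | i' | ⟨l', hl'⟩) hh <;>
        simp only [hp, blockDeadlines, Sum.elim_inl, Sum.elim_inr] at hh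
      · congr 1; ext; omega
      · have := s.2; have := haI (α i'); omega
      · have := s.2; have := hLm l' hl'; omega
      · have := s'.2; have := haI (α i); omega
      · rw [α.injective (ha hh)]
      · have := haI (α i); have := hLm l' hl'; omega
      · have := s'.2; have := hLm l hl; omega
      · have := haI (α i'); have := hLm l hl; omega
      · subst hh; rfl
    · rintro (s | i | ⟨l, hl⟩) (s' | i' | ⟨l', hl'⟩) hh <;>
        simp only [hq, Sum.elim_inl, Sum.elim_inr] at hh
      · congr 1; ext; omega
      · have := s.2; have := hτm i'; omega
      · have := s.2; omega
      · have := s'.2; have := hτm i; omega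
      · rw [τ.injective (Subtype.ext hh)]
      · have := hτm i; omega
      · have := s'.2; omega
      · have := hτm i'; omega
      · obtain rfl := rk_inj l hl l' hl' (by omega); rfl
    · rintro (s | i | ⟨l, hl⟩) (s' | i' | ⟨l', hl'⟩) hh <;>
        simp only [hp, hq, blockDeadlines, Sum.elim_inl, Sum.elim_inr] at hh
      · omega
      · have := s.2; have := hτm i'; omega
      · have := s.2; omega
      · have := s'.2; have := haI (α i); omega
      · have := haI (α i); have := hτm i'; omega
      · have := haI (α i); omega
      · have := s'.2; have := hLm l hl; omega
      · exact (hτm i').2 (hh ▸ hl)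
      · have := hLm l hl; omega
  have hbij : Function.Bijective (fun u => (⟨Sum.elim p q u, hrange u⟩ :
      Finset.Icc 1 (2 * Fintype.card (Fin k ⊕ ι ⊕ L)))) := by
    rw [Fintype.bijective_iff_injective_and_card]
    refine ⟨fun u v h => hinj (congrArg Subtype.val h), ?_⟩
    rw [Fintype.card_sum, Fintype.card_coe, Nat.card_Icc]; omega
  refine ⟨Equiv.ofBijective _ hbij, ?_⟩
  rintro (s | i | ⟨l, hl⟩) <;>
    simp only [Equiv.ofBijective_apply, hp, hq, blockDeadlines, Sum.elim_inl, Sum.elim_inr]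
  · omega
  · have := hα i; have := hτ i; omega
  · have := rk_le l hl; omega

/-- Feasibility of the instance made of small odd deadlines, the deadlines `d`, and large deadlines
`L`: the free positions in `[2k + n + 1, 4k + 2n]` have to be dominated by the sums `d i + a (α i)`
of some matching `α`. -/
theorem visitFeasible_blockDeadlines_iff (hn : Fintype.card ι = n) (ha : Function.Injective a)
    (haI : ∀ i, 2 * k + 1 ≤ a i ∧ a i ≤ 2 * k + n) (had : ∀ i, a i ≤ d i)
    (hd : ∀ i, d i ≤ 2 * k + n) (hL : L ⊆ Finset.Icc (2 * k + n + 1) (4 * k + 2 * n))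
    (hLc : 2 * k ≤ L.card) :
    VisitFeasible (blockDeadlines k d L) ↔
      L.card = 2 * k ∧ ∃ α : Equiv.Perm ι, (∀ i, a (α i) ≤ d i) ∧
        ∀ y, ((Finset.Icc (2 * k + n + 1) (4 * k + 2 * n) \ L).filter fun t => y ≤ t).card ≤
          (Finset.univ.filter fun i => y ≤ d i + a (α i)).card :=
  ⟨exists_assignment_of_visitFeasible hn ha haI had hd hL hLc,
    fun ⟨h, α, hα, hdom⟩ => visitFeasible_of_assignment hn ha haI hL h α hα hdom⟩

end Block

/-! ### The discretized sequence -/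

theorem length_discretized (l : List ℤ) : (discretized l).length = l.length := by
  induction l with
  | nil => rfl
  | cons d ds ih => simp [discretized, ih]

theorem discretized_cons_cons (d d' : ℤ) (ds : List ℤ) :
    ∃ a as, discretized (d' :: ds) = a :: as ∧
      discretized (d :: d' :: ds) = min (a - 1) d :: a :: as := by
  obtain ⟨a, as, h⟩ := List.exists_cons_of_length_pos (l := discretized (d' :: ds))
    (by rw [length_discretized]; simp)
  refine ⟨a, as, h, ?_⟩
  rw [discretized, h]

theorem discretized_getElem_succ (l : List ℤ) (i : ℕ) (hi : i + 1 < l.length) :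
    (discretized l)[i]'(by rw [length_discretized]; omega) =
      min ((discretized l)[i + 1]'(by rw [length_discretized]; omega) - 1) l[i] := by
  induction l generalizing i with
  | nil => simp at hi
  | cons d ds ih =>
    cases ds with
    | nil => simp at hi
    | cons d' ds =>
      obtain ⟨a, as, h1, h2⟩ := discretized_cons_cons d d' ds
      cases i with
      | zero => simp [h2]
      | succ i =>
        have := ih i (by simpa using hi)
        simp only [h1] at this
        simpa [h2] using this

theorem discretized_getElem_last (l : List ℤ) (i : ℕ) (hi : i + 1 = l.length) :
    (discretized l)[i]'(by rw [length_discretized]; omega) = l[i] := by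
  induction l generalizing i with
  | nil => simp at hi
  | cons d ds ih =>
    cases ds with
    | nil =>
      obtain rfl : i = 0 := by simpa using hi
      simp [discretized]
    | cons d' ds =>
      obtain ⟨a, as, h1, h2⟩ := discretized_cons_cons d d' ds
      cases i with
      | zero => simp at hi
      | succ i =>
        have := ih i (by simpa using hi)
        simp only [h1] at this
        simpa [h2] using this

/-- Every integer between the first entries of the discretized sequence and of the sequence itself
occurs in the discretized sequence. -/
theorem mem_discretized_of_le (d : ℤ) (ds : List ℤ) (hs : (d :: ds).Pairwise (· ≤ ·)) (x : ℤ)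
    (hx : ∀ a ∈ (discretized (d :: ds)).head?, a ≤ x) (hxd : x ≤ d) :
    x ∈ discretized (d :: ds) := by
  induction ds generalizing d with
  | nil =>
    simp [discretized] at hx ⊢
    omega
  | cons d' ds ih =>
    obtain ⟨a, as, h1, h2⟩ := discretized_cons_cons d d' ds
    rw [h2] at hx ⊢
    simp only [List.head?_cons, Option.mem_some_iff, forall_eq'] at hx
    have hd' : d ≤ d' := by simp at hs; exact hs.1.1
    rw [List.mem_cons]
    by_cases hx2 : x = min (a - 1) d
    · exact Or.inl hx2
    · right
      rw [← h1]
      refine ih d' hs.tail ?_ (hxd.trans hd')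
      rw [h1]
      simp only [List.head?_cons, Option.mem_some_iff, forall_eq']
      omega

/-- Below an entry `d` the discretized tail can only skip values larger than `d`: each later entry
is either one less than its successor or equal to its own deadline, which is at least `d`. So the
values from the entry of `A` beneath `d` up to `d` are all present. -/
theorem mem_discretized (l : List ℤ) (hs : l.Pairwise (· ≤ ·)) : ∀ d ∈ l, d ∈ discretized l := by
  induction l with
  | nil => simp
  | cons d ds ih =>
    intro x hx
    rcases List.mem_cons.1 hx with rfl | hx
    · refine mem_discretized_of_le x ds hs x ?_ le_rfl
      cases ds with
      | nil => simp [discretized]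
      | cons d' ds =>
        obtain ⟨a, as, h1, h2⟩ := discretized_cons_cons x d' ds
        simp [h2]
    · exact List.mem_cons_of_mem _ (ih hs.tail x hx)

/-! ### Position Matching as a domination problem -/

namespace PMInstance

variable (I : PMInstance)

theorem length_A : I.A.length = I.D.length := by
  rw [I.A_eq, length_discretized, List.length_map]

/-- The entry of `A` with the index of an entry of `D`. -/
def entryA (i : Fin I.D.length) : ℤ := I.A.get (i.cast I.length_A.symm)

theorem entryA_le (i : Fin I.D.length) : I.entryA i ≤ I.D.get i := by
  by_cases hi : (i : ℕ) + 1 = I.D.length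
  · have := discretized_getElem_last (I.D.map (fun d : ℕ => (d : ℤ))) i (by simpa using hi)
    simp [entryA, I.A_eq, this]
  · have := discretized_getElem_succ (I.D.map (fun d : ℕ => (d : ℤ))) i
      (by simp; have := i.2; omega)
    simp only [entryA, I.A_eq, List.get_eq_getElem, Fin.val_cast, this, List.getElem_map]
    exact min_le_right _ _

theorem entryA_last (i : Fin I.D.length) (hi : (i : ℕ) + 1 = I.D.length) :
    I.entryA i = I.D.get i := by
  have := discretized_getElem_last (I.D.map (fun d : ℕ => (d : ℤ))) i (by simpa using hi)
  simp [entryA, I.A_eq, this]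

theorem entryA_succ (i j : Fin I.D.length) (hij : (j : ℕ) = i + 1) :
    I.entryA i = min (I.entryA j - 1) (I.D.get i) := by
  have := discretized_getElem_succ (I.D.map (fun d : ℕ => (d : ℤ))) i
      (by simp; have := j.2; omega)
  simp only [entryA, I.A_eq, List.get_eq_getElem, Fin.val_cast, this, List.getElem_map, hij]

theorem get_D_mono {i j : Fin I.D.length} (h : i ≤ j) : I.D.get i ≤ I.D.get j := by
  rcases h.eq_or_lt with rfl | h
  · exact le_rfl
  · exact List.pairwise_iff_getElem.1 I.D_sorted i j i.2 j.2 h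

theorem countP_T (y : ℤ) : I.T.countP (fun t : ℕ => decide (y ≤ (t : ℤ))) =
    (Finset.univ.filter fun j => y ≤ (I.T.get j : ℤ)).card := by
  have h : (I.T : Multiset ℕ) = Finset.univ.val.map I.T.get := by simp
  rw [← Multiset.coe_countP (fun t : ℕ => y ≤ (t : ℤ)), h, Multiset.countP_map]
  rfl

/-- An instance is solvable iff some matching of `D` and `A` has sums that dominate `T`. -/
theorem solvable_iff : I.Solvable ↔ ∃ α : Equiv.Perm (Fin I.D.length),
    (∀ i, I.entryA (α i) ≤ I.D.get i) ∧ ∀ y : ℤ, I.T.countP (fun t : ℕ => decide (y ≤ (t : ℤ))) ≤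
      (Finset.univ.filter fun i => y ≤ (I.D.get i : ℤ) + I.entryA (α i)).card := by
  have hc : Fintype.card (Fin I.D.length) = Fintype.card (Fin I.T.length) := by
    simp [I.T_length]
  constructor
  · rintro ⟨α, τ, h⟩
    refine ⟨α.trans (finCongr I.length_A), fun i => (h i).1, ?_⟩
    simp only [countP_T]
    exact (exists_equiv_le_iff _ (fun j => (I.T.get j : ℤ)) hc).1 ⟨τ, fun i => (h i).2⟩
  · rintro ⟨α, h1, h2⟩
    simp only [countP_T] at h2
    obtain ⟨τ, hτ⟩ := (exists_equiv_le_iff _ (fun j => (I.T.get j : ℤ)) hc).2 h2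
    exact ⟨α.trans (finCongr I.length_A.symm), τ, fun i => ⟨h1 i, hτ i⟩⟩

end PMInstance

/-! ### Instances built from three lists -/

theorem twoVisitsFeasible_append_iff {ι : Type*} [Fintype ι] (k : ℕ) (S D L : List ℕ) (d : ι → ℕ)
    (hS : S = (List.range k).map (fun s => 2 * s + 1))
    (hD : (D : Multiset ℕ) = Finset.univ.val.map d) (hL : L.Nodup) :
    TwoVisitsFeasible (S ++ D ++ L) ↔ VisitFeasible (blockDeadlines k d L.toFinset) := by
  refine twoVisitsFeasible_iff _ _ ?_
  have h3 : (Finset.univ : Finset (Fin k ⊕ ι ⊕ L.toFinset)).val =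
    Finset.univ.val.map Sum.inl + (Finset.univ.val.map Sum.inl +
      Finset.univ.val.map Sum.inr).map Sum.inr := rfl
  have h4 : Finset.univ.val.map (fun l : L.toFinset => (l : ℕ)) = L := by
    rw [Finset.univ_eq_attach, Finset.attach_val]
    refine (Multiset.attach_map_val _).trans ?_
    rw [List.toFinset_val, hL.dedup]
  have h5 : Finset.univ.val.map (fun s : Fin k => 2 * (s : ℕ) + 1) = S := by
    rw [hS]
    have : (Finset.univ : Finset (Fin k)).val = (List.finRange k : Multiset (Fin k)) := rfl
    rw [this, Multiset.map_coe]
    congr 1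
    rw [← List.map_coe_finRange_eq_range, List.map_map]
    rfl
  rw [h3, Multiset.map_add, Multiset.map_map, Multiset.map_map, Multiset.map_add, Multiset.map_map,
    Multiset.map_map]
  rw [← Multiset.coe_add, ← Multiset.coe_add, hD, ← h4, ← h5, add_assoc]
  rfl

/-! ### Normalized instances -/

namespace PMInstance

variable {I : PMInstance}

theorem Normalized.entryA_eq (h : I.Normalized) (h0 : 0 < I.D.length) (i : Fin I.D.length) :
    I.entryA i = I.entryA ⟨0, h0⟩ + (i : ℕ) := by
  obtain ⟨i, hi⟩ := i
  induction i with
  | zero => simp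
  | succ i ih =>
    have h1 := List.isChain_iff_getElem.1 h.consecutive i (by rw [I.length_A]; exact hi)
    have h2 := ih (by omega)
    simp only [entryA, List.get_eq_getElem, Fin.val_cast] at h2 ⊢
    rw [h1, h2]
    push_cast
    ring

theorem filter_odd_range (k : ℕ) : (List.range (2 * k + 1)).filter (fun s => s % 2 = 1) =
    (List.range k).map (fun s => 2 * s + 1) := by
  induction k with
  | zero => rfl
  | succ k ih =>
    rw [show 2 * (k + 1) + 1 = 2 * k + 1 + 1 + 1 by ring, List.range_succ, List.range_succ,
      List.filter_append, List.filter_append, ih, List.range_succ (n := k), List.map_append]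
    have h1 : (2 * k + 1) % 2 = 1 := by omega
    have h2 : ¬ (2 * k + 1 + 1) % 2 = 1 := by omega
    simp [h1]

/-- The facts about a normalized instance that the construction uses. -/
theorem Normalized.facts (h : I.Normalized) : ∃ (a₁ : ℤ) (m : ℕ), 0 < I.D.length ∧ Odd a₁ ∧
    (m : ℤ) = a₁ + I.D.length - 1 ∧ 0 < m ∧ I.A.headD 0 = a₁ ∧ I.A.getLastD 0 = m ∧
    (∀ i, I.entryA i = a₁ + (i : ℕ)) ∧ (∀ i, I.D.get i ≤ m) ∧ ∀ t ∈ I.T, m < t := by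
  obtain ⟨a, ha, hodd⟩ := h.odd_head
  have h0 : 0 < I.D.length := by
    rw [← I.length_A]
    cases hA : I.A with
    | nil => simp [hA] at ha
    | cons b l => simp
  have hA : I.entryA ⟨0, h0⟩ = a := by
    rw [Option.mem_def, List.head?_eq_getElem?] at ha
    simp only [entryA, List.get_eq_getElem, Fin.val_cast]
    exact List.getElem_eq_iff _ |>.2 ha
  have hent := h.entryA_eq h0
  rw [hA] at hent
  set e : Fin I.D.length := ⟨I.D.length - 1, by omega⟩ with he
  have hlast := I.entryA_last e (by simp [he]; omega)
  have hpos := I.D_pos _ (List.get_mem I.D e)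
  have hlD : I.A.getLastD 0 = I.D.get e := by
    rw [← hlast, List.getLastD_eq_getLast?, List.getLast?_eq_getElem?]
    simp only [entryA, List.get_eq_getElem, Fin.val_cast, he, I.length_A]
    rw [List.getElem?_eq_getElem (by rw [I.length_A]; omega), Option.getD_some]
  refine ⟨a, I.D.get e, h0, hodd, ?_, hpos, ?_, hlD, hent, fun i => I.get_D_mono ?_, ?_⟩
  · have := hent e
    rw [hlast] at this
    rw [this, he]
    simp only
    rw [Nat.cast_sub (by omega)]
    push_cast; ring
  · rw [List.headD_eq_head?_getD, Option.mem_def.1 ha, Option.getD_some]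
  · rw [Fin.le_def, he]; have := i.2; simp only; omega
  · intro t ht
    have := h.lt_target t ht _ (List.get_mem I.A (e.cast I.length_A.symm))
    change I.entryA e < t at this
    rw [hlast] at this
    exact_mod_cast this

theorem Normalized.isDeadlineSeq (h : I.Normalized) :
    IsDeadlineSeq (I.small ++ I.D ++ I.large) := by
  obtain ⟨a₁, m, h0, hodd, hm, hm0, hhead, hlast, hent, hD, hT⟩ := h.facts
  have hDge : ∀ d ∈ I.D, a₁ ≤ d := by
    intro d hd
    obtain ⟨i, rfl⟩ := List.get_of_mem hd
    have := I.entryA_le i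
    rw [hent] at this
    omega
  have hDle : ∀ d ∈ I.D, d ≤ m := by
    intro d hd
    obtain ⟨i, rfl⟩ := List.get_of_mem hd
    exact hD i
  have hS : ∀ s ∈ I.small, (s : ℤ) < a₁ ∧ 0 < s := by
    intro s hs
    simp only [small, hhead, List.mem_filter, List.mem_range, decide_eq_true_eq] at hs
    omega
  have hL : ∀ l ∈ I.large, m < l := by
    intro l hl
    simp only [large, hlast, List.mem_filter, List.mem_range'_1, Int.toNat_natCast] at hl
    omega
  constructor
  · intro d hd
    rw [List.mem_append, List.mem_append] at hd
    rcases hd with (hd | hd) | hd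
    · exact (hS d hd).2
    · exact I.D_pos d hd
    · have := hL d hd; omega
  · rw [List.pairwise_append, List.pairwise_append]
    refine ⟨⟨?_, I.D_sorted, ?_⟩, ?_, ?_⟩
    · exact (List.pairwise_le_range).filter _
    · intro s hs d hd
      have := hS s hs; have := hDge d hd; omega
    · exact (List.pairwise_le_range').filter _
    · intro x hx l hl
      have := hL l hl
      rcases List.mem_append.1 hx with hx | hx
      · have := hS x hx; omega
      · have := hDle x hx; omega

/-- With `a₁ = 2k + 1` this is an instance of `visitFeasible_blockDeadlines_iff` with last middle
position `m = 2k + n`. The complement of `L` in `[m + 1, 2m]` equals `T` as soon as `T` lies in that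
interval, and each side of the equivalence forces this inclusion: solvability because sums are at
most `2m`, feasibility through the cardinality of `L`. -/
theorem Normalized.feasible_iff (h : I.Normalized) :
    TwoVisitsFeasible (I.small ++ I.D ++ I.large) ↔ I.Solvable := by
  classical
  obtain ⟨a₁, m, h0, hodd, hm, hm0, hhead, hlast, hent, hD, hT⟩ := h.facts
  have hLnodup : I.large.Nodup := List.Nodup.filter _ List.nodup_range'
  have hLmem : ∀ l, l ∈ I.large.toFinset ↔ (m + 1 ≤ l ∧ l ≤ 2 * m) ∧ l ∉ I.T := by
    intro l
    simp only [large, hlast, List.mem_toFinset, List.mem_filter, List.mem_range'_1,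
      Int.toNat_natCast, decide_eq_true_eq]
    refine and_congr_left fun _ => ?_
    omega
  have hDm : (I.D : Multiset ℕ) = Finset.univ.val.map I.D.get := by simp
  have hTnodup : I.T.Nodup := I.T_sorted.imp fun h => h.ne
  have hTcard : I.T.toFinset.card = I.D.length := by
    rw [List.toFinset_card_of_nodup hTnodup, I.T_length]
  have hTbound : I.Solvable → I.T.toFinset ⊆ Finset.Icc (m + 1) (2 * m) := by
    rintro ⟨α, τ, hs⟩ t ht
    rw [List.mem_toFinset] at ht
    have h1 := hT t ht
    obtain ⟨j, rfl⟩ := List.get_of_mem ht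
    have h2 := (hs (τ.symm j)).2
    rw [τ.apply_symm_apply] at h2
    have h3 := hD (τ.symm j)
    have h4 := hent ((α (τ.symm j)).cast I.length_A)
    simp only [entryA, Fin.cast_cast, Fin.cast_eq_self] at h4
    have h5 := ((α (τ.symm j)).cast I.length_A).2
    rw [Finset.mem_Icc]
    omega
  -- If `a₁` is negative, then `m < n` and both sides fail: `n` primary visits would need distinct
  -- positions up to `m`, and `n` targets would have to fit into the `m` numbers of `[m + 1, 2m]`.
  -- The value `a₁ = 0` is excluded by parity.
  by_cases hneg : a₁ < 0
  · have hsmall : I.small = (List.range 0).map (fun s => 2 * s + 1) := by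
      rw [small, hhead, Int.toNat_of_nonpos hneg.le]; rfl
    rw [twoVisitsFeasible_append_iff 0 _ _ _ I.D.get hsmall hDm hLnodup]
    refine iff_of_false ?_ fun hs => ?_
    · rintro ⟨pos, hpos⟩
      have : (Finset.univ : Finset (Fin I.D.length)).card ≤ (Finset.Icc 1 m).card := by
        refine Finset.card_le_card_of_injOn
          (fun i => (pos (Sum.inl (Sum.inr (Sum.inl i))) : ℕ)) ?_ ?_
        · intro i _
          have h1 := (hpos (Sum.inr (Sum.inl i))).1
          have h2 := (Finset.mem_Icc.1 (pos (Sum.inl (Sum.inr (Sum.inl i)))).2).1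
          simp only [blockDeadlines, Sum.elim_inr, Sum.elim_inl] at h1
          rw [Finset.mem_coe, Finset.mem_Icc]
          exact ⟨h2, h1.trans (hD i)⟩
        · intro i _ j _ hij
          simpa using pos.injective (Subtype.ext hij)
      rw [Finset.card_univ, Fintype.card_fin, Nat.card_Icc] at this
      omega
    · have := Finset.card_le_card (hTbound hs)
      rw [hTcard, Nat.card_Icc] at this
      omega
  obtain ⟨k, hk⟩ : ∃ k : ℕ, a₁ = 2 * k + 1 := by
    obtain ⟨c, hc⟩ := hodd
    exact ⟨c.toNat, by omega⟩
  have hsmall : I.small = (List.range k).map (fun s => 2 * s + 1) := by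
    rw [← filter_odd_range, small, hhead, show a₁.toNat = 2 * k + 1 by omega]
  have hm' : m = 2 * k + I.D.length := by omega
  have hLeq : I.large.toFinset = Finset.Icc (2 * k + I.D.length + 1) (4 * k + 2 * I.D.length) \
      I.T.toFinset := by
    ext l
    rw [hLmem, Finset.mem_sdiff, Finset.mem_Icc, List.mem_toFinset]
    refine and_congr_left fun _ => ?_
    omega
  have hLsub := hLeq.le.trans Finset.sdiff_subset
  have hLcard : 2 * k ≤ I.large.toFinset.card := by
    have := Finset.le_card_sdiff I.T.toFinset
      (Finset.Icc (2 * k + I.D.length + 1) (4 * k + 2 * I.D.length))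
    rw [← hLeq, hTcard, Nat.card_Icc] at this
    omega
  rw [twoVisitsFeasible_append_iff k _ _ _ I.D.get hsmall hDm hLnodup,
    visitFeasible_blockDeadlines_iff (a := fun i : Fin I.D.length => 2 * k + 1 + (i : ℕ))
      (Fintype.card_fin _) (fun i j hij => by ext; simp only at hij; omega)
      (fun i => ⟨by omega, by have := i.2; omega⟩)
      (fun i => by have := I.entryA_le i; rw [hent] at this; omega)
      (fun i => hm' ▸ hD i) hLsub hLcard]
  have hcompl : I.T.toFinset ⊆ Finset.Icc (m + 1) (2 * m) →
      Finset.Icc (2 * k + I.D.length + 1) (4 * k + 2 * I.D.length) \ I.large.toFinset =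
        I.T.toFinset := by
    intro hsub
    rw [hLeq, Finset.sdiff_sdiff_self_left]
    refine Finset.inter_eq_right.2 (hsub.trans (Finset.Icc_subset_Icc ?_ ?_)) <;> omega
  have hcount : ∀ y : ℕ, I.T.countP (fun t : ℕ => decide ((y : ℤ) ≤ (t : ℤ))) =
      (I.T.toFinset.filter fun t => y ≤ t).card := by
    intro y
    rw [List.countP_eq_length_filter, ← List.toFinset_card_of_nodup (hTnodup.filter _)]
    congr 1
    ext t
    simp
  have hsum : ∀ (α : Equiv.Perm (Fin I.D.length)) (y : ℕ),
      (Finset.univ.filter fun i => (y : ℤ) ≤ (I.D.get i : ℤ) + I.entryA (α i)) =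
      Finset.univ.filter fun i => y ≤ I.D.get i + (2 * k + 1 + (α i : ℕ)) := by
    intro α y
    ext i
    simp only [Finset.mem_filter, Finset.mem_univ, true_and, hent, hk]
    omega
  constructor
  · rintro ⟨hc, α, hα, hdom⟩
    -- The interval has `2k + n` elements and loses all but `2k` of them to `T`, so all `n` targets
    -- lie inside.
    have hsub : I.T.toFinset ⊆ Finset.Icc (2 * k + I.D.length + 1) (4 * k + 2 * I.D.length) := by
      have h1 := Finset.card_sdiff_add_card_inter
        (Finset.Icc (2 * k + I.D.length + 1) (4 * k + 2 * I.D.length)) I.T.toFinset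
      rw [← hLeq, hc, Nat.card_Icc] at h1
      exact Finset.inter_eq_right.1 (Finset.eq_of_subset_of_card_le Finset.inter_subset_right
        (by omega))
    rw [hcompl (hsub.trans (Finset.Icc_subset_Icc (by omega) (by omega)))] at hdom
    refine I.solvable_iff.2 ⟨α, fun i => ?_, fun y => ?_⟩
    · have := hα i; rw [hent, hk]; omega
    · rcases le_or_gt 0 y with hy | hy
      · lift y to ℕ using hy
        rw [hcount, hsum]
        exact hdom y
      · refine List.countP_le_length.trans ?_
        rw [Finset.filter_true_of_mem, Finset.card_univ, Fintype.card_fin, I.T_length]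
        intro i _
        rw [hent, hk]
        omega
  · intro hs
    have hsub := hTbound hs
    obtain ⟨α, hα, hdom⟩ := I.solvable_iff.1 hs
    refine ⟨?_, α, fun i => ?_, fun y => ?_⟩
    · rw [hLeq, Finset.card_sdiff_of_subset
        (hsub.trans (Finset.Icc_subset_Icc (by omega) (by omega))), hTcard, Nat.card_Icc]
      omega
    · have := hα i; rw [hent, hk] at this; omega
    · rw [hcompl hsub, ← hcount, ← hsum]
      exact hdom y

end PMInstance

/-! ### Filling the gaps of the discretized sequence -/

/-- A permutation below `δ` preserves the initial segments preserved by `δ`. -/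
theorem Equiv.Perm.lt_iff_of_le {n x : ℕ} (α : Equiv.Perm (Fin n)) (δ : ℕ → ℕ)
    (hα : ∀ j, (α j : ℕ) ≤ δ j) (hx : ∀ j < n, j < x → δ j < x) (j : Fin n) :
    (α j : ℕ) < x ↔ (j : ℕ) < x := by
  have himg : (Finset.univ.filter fun j : Fin n => (j : ℕ) < x).image α =
      Finset.univ.filter fun j : Fin n => (j : ℕ) < x := by
    refine Finset.eq_of_subset_of_card_le ?_ ?_
    · intro y hy
      obtain ⟨u, hu, rfl⟩ := Finset.mem_image.1 hy
      simp only [Finset.mem_filter, Finset.mem_univ, true_and] at hu ⊢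
      exact (hα u).trans_lt (hx u u.2 hu)
    · rw [Finset.card_image_of_injective _ α.injective]
  constructor
  · intro h
    have : α j ∈ (Finset.univ.filter fun j : Fin n => (j : ℕ) < x).image α := by
      rw [himg]; simpa using h
    obtain ⟨u, hu, hju⟩ := Finset.mem_image.1 this
    rw [← α.injective hju]
    simpa using hu
  · intro h
    exact (hα j).trans_lt (hx j j.2 h)

/-- The number of positions before the `i`-th gap, if the `j`-th gap holds `K j` extra positions and
is followed by one proper position. -/
def gapStart (K : ℕ → ℕ) (i : ℕ) : ℕ := ∑ j ∈ Finset.range i, (K j + 1)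

/-- The `i`-th proper position. -/
def properPos (K : ℕ → ℕ) (i : ℕ) : ℕ := gapStart K i + K i

theorem gapStart_succ (K : ℕ → ℕ) (i : ℕ) : gapStart K (i + 1) = properPos K i + 1 := by
  simp [gapStart, properPos, Finset.sum_range_succ, add_assoc]

theorem properPos_succ (K : ℕ → ℕ) (i : ℕ) :
    properPos K (i + 1) = properPos K i + 1 + K (i + 1) := by
  rw [properPos, gapStart_succ]

theorem properPos_strictMono (K : ℕ → ℕ) : StrictMono (properPos K) :=
  strictMono_nat_of_lt_succ fun i => by rw [properPos_succ]; omega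

theorem gapStart_strictMono (K : ℕ → ℕ) : StrictMono (gapStart K) :=
  strictMono_nat_of_lt_succ fun i => by rw [gapStart_succ, properPos]; omega

theorem properPos_lt_gapStart (K : ℕ → ℕ) {i n : ℕ} : properPos K i < gapStart K n ↔ i < n := by
  rw [← Nat.succ_le_iff, Nat.succ_eq_add_one, ← gapStart_succ, (gapStart_strictMono K).le_iff_le]
  omega

/-- Every position belongs to a gap or is proper. -/
theorem exists_eq_gapStart_add (K : ℕ → ℕ) (n p : ℕ) (hp : p < gapStart K n) :
    ∃ i < n, ∃ r ≤ K i, p = gapStart K i + r := by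
  induction n with
  | zero => simp [gapStart] at hp
  | succ n ih =>
    by_cases h : p < gapStart K n
    · obtain ⟨i, hi, r, hr⟩ := ih h
      exact ⟨i, by omega, r, hr⟩
    · rw [gapStart_succ, properPos] at hp
      exact ⟨n, by omega, p - gapStart K n, by omega, by omega⟩

theorem exists_gap_of_notMem_range (K : ℕ → ℕ) (n p : ℕ) (hp : p < gapStart K n)
    (hr : ¬ ∃ j, properPos K j = p) : ∃ i < n, ∃ r < K i, p = gapStart K i + r := by
  obtain ⟨i, hi, r, hrK, h⟩ := exists_eq_gapStart_add K n p hp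
  refine ⟨i, hi, r, lt_of_le_of_ne hrK ?_, h⟩
  rintro rfl
  exact hr ⟨i, h.symm⟩

/-- The extension of `δ` to all positions by the identity on the extra positions. -/
noncomputable def extendPos (K δ : ℕ → ℕ) : ℕ → ℕ :=
  Function.extend (properPos K) (fun j => properPos K (δ j)) id

theorem extendPos_properPos (K δ : ℕ → ℕ) (j : ℕ) :
    extendPos K δ (properPos K j) = properPos K (δ j) :=
  (properPos_strictMono K).injective.extend_apply _ _ j

theorem extendPos_of_notMem (K δ : ℕ → ℕ) {p : ℕ} (h : ¬ ∃ j, properPos K j = p) :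
    extendPos K δ p = p :=
  Function.extend_apply' _ _ _ h

theorem extendPos_lt {n : ℕ} {K δ : ℕ → ℕ} (hδ : ∀ j < n, δ j < n) {p : ℕ}
    (hp : p < gapStart K n) : extendPos K δ p < gapStart K n := by
  by_cases hr : ∃ j, properPos K j = p
  · obtain ⟨j, rfl⟩ := hr
    rw [properPos_lt_gapStart] at hp
    rw [extendPos_properPos, properPos_lt_gapStart]
    exact hδ j hp
  · rwa [extendPos_of_notMem _ _ hr]

theorem le_extendPos {n : ℕ} {K δ : ℕ → ℕ} (hδ : ∀ j < n, j ≤ δ j) {p : ℕ}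
    (hp : p < gapStart K n) : p ≤ extendPos K δ p := by
  by_cases hr : ∃ j, properPos K j = p
  · obtain ⟨j, rfl⟩ := hr
    rw [properPos_lt_gapStart] at hp
    rw [extendPos_properPos]
    exact (properPos_strictMono K).monotone (hδ j hp)
  · rw [extendPos_of_notMem _ _ hr]

/-- The data of an instance whose deadlines are the entries of `a` with indices `δ j`, whose targets
are counted by `F`, together with numbers `K` of extra positions and the targets `τ` of the instance
with filled gaps. -/
structure GapFilling (n : ℕ) (K δ : ℕ → ℕ) (a : ℕ → ℤ) (F : ℤ → ℕ) (τ : ℕ → ℕ) : Prop where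
  le_δ : ∀ j < n, j ≤ δ j
  δ_lt : ∀ j < n, δ j < n
  a_lt : ∀ i j, i < j → j < n → a i < a j
  F_anti : Antitone F
  F_le : ∀ y, F y ≤ n
  τ_anti : Antitone τ
  τ_zero : τ 0 ≤ gapStart K n
  τ_top : τ (2 * gapStart K n) = 0
  -- Slot `2p + 1` plays the role of the value `2a` at position `p`, and slot `2p + 2` that of `2a +
  -- 1`. The targets from there on are the old ones above the threshold together with one for each
  -- later extra position; the number of the latter is the difference of the two subtractions,
  -- written without truncation problems.
  τ_low : ∀ i < n, τ (2 * properPos K i + 1) + (n - (i + 1)) =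
    F (2 * a i) + (gapStart K n - gapStart K (i + 1))
  τ_high : ∀ i < n, τ (2 * properPos K i + 2) + (n - (i + 1)) =
    F (2 * a i + 1) + (gapStart K n - gapStart K (i + 1))
  -- Both slots `2p` and `2p + 1` of an extra position `p` are targets.
  τ_gap : ∀ i < n, ∀ r < K i, τ (2 * (gapStart K i + r) + 1) + 1 = τ (2 * (gapStart K i + r)) ∧
    τ (2 * (gapStart K i + r) + 2) + 2 = τ (2 * (gapStart K i + r))
  cut_of_gap : ∀ i < n, 0 < K i → ∀ j < i, δ j < i
  cut_or_succ : ∀ i, i + 1 < n →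
    (∀ j ≤ i, δ j ≤ i) ∨ (a (i + 1) = a i + 1 ∧ K (i + 1) = 0)

namespace GapFilling

variable {n : ℕ} {K δ : ℕ → ℕ} {a : ℕ → ℤ} {F : ℤ → ℕ} {τ : ℕ → ℕ}

/-- An extra position lies in a non-empty gap, which is a cut of `δ`. So deadlines of proper
positions before it also stay before it, and a valid matching cannot cross it. -/
theorem cut_notMem (h : GapFilling n K δ a F τ) {p : ℕ} (hp : p < gapStart K n)
    (hr : ¬ ∃ j, properPos K j = p) (j : ℕ) (hj : properPos K j < p) :
    properPos K (δ j) < p := by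
  obtain ⟨i, hi, r, hrK, rfl⟩ := exists_gap_of_notMem_range K n p hp hr
  have h1 : ∀ j, properPos K j < gapStart K i + r ↔ j < i := by
    intro j
    refine ⟨fun h2 => ?_, fun h2 => by have := (properPos_lt_gapStart K).2 h2; omega⟩
    by_contra h3
    rw [not_lt] at h3
    have := (properPos_strictMono K).monotone h3
    simp only [properPos] at this h2
    omega
  rw [h1] at hj ⊢
  exact h.cut_of_gap i hi (by omega) j hj

/-- At a cut the two entries of a matched pair lie on the same side: `δ` preserves the initial
segment, and a permutation below `δ` then does so as well. -/
theorem lt_iff_of_valid (h : GapFilling n K δ a F τ) {α : Equiv.Perm (Fin n)}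
    (hα : ∀ j, (α j : ℕ) ≤ δ j) {m : ℕ} (hcut : ∀ j ≤ m, δ j ≤ m) (j : Fin n) :
    ((α j : ℕ) ≤ m ↔ (j : ℕ) ≤ m) ∧ (δ j ≤ m ↔ (j : ℕ) ≤ m) := by
  refine ⟨?_, fun h1 => (h.le_δ j j.2).trans h1, hcut j⟩
  have := α.lt_iff_of_le δ hα (x := m + 1) (fun i _ hi => by have := hcut i (by omega); omega) j
  omega

/-- Between the two entries of a matched pair both `a` and the positions are consecutive. -/
theorem consecutive (h : GapFilling n K δ a F τ) {α : Equiv.Perm (Fin n)}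
    (hα : ∀ j, (α j : ℕ) ≤ δ j) (j : Fin n) (x : ℕ) (hx : (α j : ℕ) + x ≤ δ j) :
    a ((α j : ℕ) + x) = a (α j) + x ∧ properPos K ((α j : ℕ) + x) = properPos K (α j) + x := by
  induction x with
  | zero => simp
  | succ x ih =>
    obtain ⟨h1, h2⟩ := ih (by omega)
    have hlt := h.δ_lt j j.2
    rcases h.cut_or_succ ((α j : ℕ) + x) (by omega) with hc | ⟨h3, h4⟩
    · have := h.lt_iff_of_valid hα hc j
      omega
    · rw [← add_assoc, h3, h1, properPos_succ, h2, h4]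
      push_cast
      constructor <;> ring

/-- If index `i` lies outside the range from `α j` to `δ j`, monotonicity decides both inequalities
alike. If it lies within, both `a` and the positions increase by one at each step of the range, so
they differ by a common shift that cancels. -/
theorem sum_le_iff (h : GapFilling n K δ a F τ) {α : Equiv.Perm (Fin n)}
    (hα : ∀ j, (α j : ℕ) ≤ δ j) (j : Fin n) (i : ℕ) (hi : i < n) (e : ℕ) (he : e ≤ 1) :
    2 * properPos K i + e ≤ properPos K (δ j) + properPos K (α j) ↔
      2 * a i + e ≤ a (δ j) + a (α j) := by
  have hm := properPos_strictMono K
  have hα' := hα j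
  have hδn := h.δ_lt j j.2
  have hcmp : ∀ u w, u < n → w < n → (properPos K u < properPos K w ∧ a u < a w) ∨ u = w ∨
      (properPos K w < properPos K u ∧ a w < a u) := by
    intro u w hu hw
    rcases lt_trichotomy u w with h1 | h1 | h1
    · exact Or.inl ⟨hm h1, h.a_lt u w h1 hw⟩
    · exact Or.inr (Or.inl h1)
    · exact Or.inr (Or.inr ⟨hm h1, h.a_lt w u h1 hu⟩)
  -- The condition `e ≤ 1` matters for `i` outside the range: both entries then differ from `a i` by
  -- at least one, so the sum misses `2 * a i` by at least two.
  rcases lt_trichotomy i (α j : ℕ) with h1 | h1 | h1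
  · have h2 := hm h1
    have h3 := h.a_lt _ _ h1 (α j).2
    have h4 := hm (h1.trans_le hα')
    have h5 := h.a_lt _ _ (h1.trans_le hα') hδn
    omega
  · rcases hα'.eq_or_lt with h6 | h6
    · rw [← h6, ← h1]; omega
    · have h4 := hm h6
      have h5 := h.a_lt _ _ h6 hδn
      rw [← h1] at h4 h5 ⊢
      omega
  · have h2 := hm h1
    have h3 := h.a_lt _ _ h1 hi
    rcases lt_trichotomy i (δ j) with h4 | h4 | h4
    · obtain ⟨c1, c2⟩ := h.consecutive hα j (δ j - α j) (by omega)
      obtain ⟨c3, c4⟩ := h.consecutive hα j (i - α j) (by omega)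
      rw [Nat.add_sub_cancel' (by omega)] at c1 c2 c3 c4
      omega
    · rw [← h4]; omega
    · have h5 := hm h4
      have h6 := h.a_lt _ _ h4 hi
      omega

/-- Splitting a count over all positions into proper and extra positions. -/
theorem card_filter_positions (n : ℕ) (K : ℕ → ℕ) (P : ℕ → Prop) [DecidablePred P]
    [DecidablePred fun p : Fin (gapStart K n) => P p ∧ ¬ ∃ j, properPos K j = p] :
    (Finset.univ.filter fun p : Fin (gapStart K n) => P p).card =
      (Finset.univ.filter fun j : Fin n => P (properPos K j)).card +
      (Finset.univ.filter fun p : Fin (gapStart K n) => P p ∧ ¬ ∃ j, properPos K j = p).card := by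
  classical
  rw [← Finset.card_filter_add_card_filter_not (s := Finset.univ.filter fun p : Fin _ => P p)
    (fun p => ∃ j, properPos K j = p), Finset.filter_filter, Finset.filter_filter]
  congr 1
  swap
  · congr
  refine (Finset.card_bij (fun j _ => ⟨properPos K j, (properPos_lt_gapStart K).2 j.2⟩) ?_ ?_ ?_).symm
  · intro j hj
    simp only [Finset.mem_filter, Finset.mem_univ, true_and] at hj ⊢
    exact ⟨hj, j, rfl⟩
  · intro j _ j' _ hjj
    exact Fin.ext ((properPos_strictMono K).injective (congrArg Fin.val hjj))
  · rintro ⟨p, hp⟩ hmem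
    simp only [Finset.mem_filter, Finset.mem_univ, true_and] at hmem
    obtain ⟨hP, j, rfl⟩ := hmem
    exact ⟨⟨j, (properPos_lt_gapStart K).1 hp⟩, by simpa using hP, rfl⟩

/-- Among the positions after the `i`-th proper one, exactly `n - (i + 1)` are proper; the rest are
extra. -/
theorem card_extra_gt (n : ℕ) (K : ℕ → ℕ) (i : ℕ) (hi : i < n) [DecidablePred
      fun p : Fin (gapStart K n) => properPos K i < p ∧ ¬ ∃ j, properPos K j = p] :
    (Finset.univ.filter fun p : Fin (gapStart K n) =>
      properPos K i < p ∧ ¬ ∃ j, properPos K j = p).card + (n - (i + 1)) =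
        gapStart K n - gapStart K (i + 1) := by
  have h := card_filter_positions n K (fun p => properPos K i < p)
  have hlt : i < n ↔ properPos K i < gapStart K n := (properPos_lt_gapStart K).symm
  have h1 : (Finset.univ.filter fun p : Fin (gapStart K n) => properPos K i < p).card =
      gapStart K n - gapStart K (i + 1) := by
    have := Fin.card_Ioi (⟨properPos K i, hlt.1 hi⟩ : Fin (gapStart K n))
    rw [gapStart_succ]
    rw [← Nat.sub_sub, Nat.sub_right_comm]
    rw [← this]
    congr 1
    ext p
    simp [Fin.lt_def]
  have h2 : (Finset.univ.filter fun j : Fin n => properPos K i < properPos K j).card =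
      n - (i + 1) := by
    have := Fin.card_Ioi (⟨i, hi⟩ : Fin n)
    rw [← Nat.sub_sub, Nat.sub_right_comm]
    rw [← this]
    congr 1
    ext p
    simp [Fin.lt_def, (properPos_strictMono K).lt_iff_lt]
  omega

/-- `α'` acts as `α` on the proper positions and fixes the extra positions. -/
structure Extends (K : ℕ → ℕ) (α : Equiv.Perm (Fin n))
    (α' : Equiv.Perm (Fin (gapStart K n))) : Prop where
  proper : ∀ (j : Fin n) (p : Fin (gapStart K n)), (p : ℕ) = properPos K j →
    (α' p : ℕ) = properPos K (α j)
  extra : ∀ p : Fin (gapStart K n), (¬ ∃ j, properPos K j = p) → α' p = p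

/-- Counting sums above a threshold at a proper position. -/
theorem card_sums (h : GapFilling n K δ a F τ) {α : Equiv.Perm (Fin n)}
    (hα : ∀ j, (α j : ℕ) ≤ δ j) {α' : Equiv.Perm (Fin (gapStart K n))} (hext : Extends K α α')
    (i : ℕ) (hi : i < n) (e : ℕ) (he : e ≤ 1) :
    (Finset.univ.filter fun p : Fin (gapStart K n) =>
      2 * properPos K i + e ≤ extendPos K δ p + α' p).card + (n - (i + 1)) =
    (Finset.univ.filter fun j : Fin n => 2 * a i + e ≤ a (δ j) + a (α j)).card +
      (gapStart K n - gapStart K (i + 1)) := by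
  classical
  have h1 := card_filter_positions n K (fun p => ∃ hp : p < gapStart K n,
    2 * properPos K i + e ≤ extendPos K δ p + α' ⟨p, hp⟩)
  have h2 : (Finset.univ.filter fun j : Fin n => ∃ hp : properPos K j < gapStart K n,
      2 * properPos K i + e ≤ extendPos K δ (properPos K j) + α' ⟨properPos K j, hp⟩) =
      Finset.univ.filter fun j : Fin n => 2 * a i + e ≤ a (δ j) + a (α j) := by
    ext j
    have hp : properPos K j < gapStart K n := (properPos_lt_gapStart K).2 j.2
    simp only [Finset.mem_filter, Finset.mem_univ, true_and, hp, exists_true_left,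
      extendPos_properPos]
    rw [hext.proper j ⟨_, hp⟩ rfl, h.sum_le_iff hα j i hi e he]
  have h3 : (Finset.univ.filter fun p : Fin (gapStart K n) => (∃ hp : (p : ℕ) < gapStart K n,
      2 * properPos K i + e ≤ extendPos K δ p + α' ⟨p, hp⟩) ∧ ¬ ∃ j, properPos K j = p) =
      Finset.univ.filter fun p : Fin (gapStart K n) =>
        properPos K i < p ∧ ¬ ∃ j, properPos K j = p := by
    ext p
    simp only [Finset.mem_filter, Finset.mem_univ, true_and, p.2, exists_true_left, Fin.eta]
    refine and_congr_left fun hr => ?_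
    rw [extendPos_of_notMem _ _ hr, hext.extra p hr]
    have : properPos K i ≠ p := fun h => hr ⟨i, h⟩
    omega
  have h0 : (Finset.univ.filter fun p : Fin (gapStart K n) =>
      2 * properPos K i + e ≤ extendPos K δ p + α' p).card =
      (Finset.univ.filter fun p : Fin (gapStart K n) => ∃ hp : (p : ℕ) < gapStart K n,
        2 * properPos K i + e ≤ extendPos K δ p + α' ⟨p, hp⟩).card := by
    congr 1
    ext p
    simp
  rw [h0, h1, h2, h3]
  have := card_extra_gt n K i hi
  omega

/-- No sum lies in the range of an extra position, except its own. -/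
theorem card_sums_extra (h : GapFilling n K δ a F τ) {α : Equiv.Perm (Fin n)}
    (hα : ∀ j, (α j : ℕ) ≤ δ j) {α' : Equiv.Perm (Fin (gapStart K n))} (hext : Extends K α α')
    (p : ℕ) (hp : p < gapStart K n) (hr : ¬ ∃ j, properPos K j = p) :
    (Finset.univ.filter fun q : Fin (gapStart K n) => 2 * p ≤ extendPos K δ q + α' q + 1).card =
    (Finset.univ.filter fun q : Fin (gapStart K n) =>
      2 * p + 2 ≤ extendPos K δ q + α' q + 1).card + 1 := by
  classical
  -- The sum of the extra position `p` is `2p`, which separates the two thresholds. Any other extra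
  -- position is at distance at least one, and a proper pair lies entirely before or entirely after
  -- the gap containing `p`.
  have hkey : (Finset.univ.filter fun q : Fin (gapStart K n) =>
      2 * p ≤ extendPos K δ q + α' q + 1) = insert ⟨p, hp⟩ (Finset.univ.filter
        fun q : Fin (gapStart K n) => 2 * p + 2 ≤ extendPos K δ q + α' q + 1) := by
    ext q
    simp only [Finset.mem_filter, Finset.mem_univ, true_and, Finset.mem_insert]
    by_cases hq : ∃ j, properPos K j = q
    · obtain ⟨j, hj⟩ := hq
      have hjn : j < n := by rw [← properPos_lt_gapStart K, hj]; exact q.2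
      have hne : ¬ q = ⟨p, hp⟩ := by
        rintro rfl; exact hr ⟨j, hj⟩
      rw [or_iff_right hne, hext.proper ⟨j, hjn⟩ q hj.symm, ← hj, extendPos_properPos]
      obtain ⟨i, hi, r, hrK, rfl⟩ := exists_gap_of_notMem_range K n p hp hr
      have hcut := h.cut_of_gap i hi (by omega)
      have h1 := α.lt_iff_of_le δ hα (x := i) (fun j _ hj => hcut j hj) ⟨j, hjn⟩
      have h2 := h.le_δ j hjn
      have hmono := (properPos_strictMono K).monotone
      have hlow : ∀ u, u < i → properPos K u < gapStart K i := fun u =>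
        (properPos_lt_gapStart K).2
      have hhigh : ∀ u, i ≤ u → gapStart K i + r < properPos K u := by
        intro u hu
        have := hmono hu
        simp only [properPos] at this ⊢
        omega
      simp only at h1
      by_cases hji : j < i
      · have := hlow _ (h1.2 hji)
        have := hlow _ (hcut j hji)
        omega
      · have := hhigh _ (not_lt.1 (fun h => hji (h1.1 h)))
        have := hhigh (δ j) (by omega)
        omega
    · rw [extendPos_of_notMem _ _ hq, hext.extra q hq, Fin.ext_iff]
      simp only
      omega
  rw [hkey, Finset.card_insert_of_notMem]
  simp [extendPos_of_notMem _ _ hr, hext.extra ⟨p, hp⟩ hr]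
  omega

/-- Domination of the targets before and after filling the gaps. -/
theorem dominates_iff (h : GapFilling n K δ a F τ) {α : Equiv.Perm (Fin n)}
    (hα : ∀ j, (α j : ℕ) ≤ δ j) {α' : Equiv.Perm (Fin (gapStart K n))} (hext : Extends K α α') :
    (∀ y : ℤ, F y ≤ (Finset.univ.filter fun j : Fin n => y ≤ a (δ j) + a (α j)).card) ↔
      ∀ s, τ s ≤ (Finset.univ.filter fun p : Fin (gapStart K n) =>
        s ≤ extendPos K δ p + α' p + 1).card := by
  constructor
  · intro hF
    have hproper : ∀ i < n, ∀ e ≤ 1, τ (2 * properPos K i + e + 1) ≤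
        (Finset.univ.filter fun p : Fin (gapStart K n) =>
          2 * properPos K i + e + 1 ≤ extendPos K δ p + α' p + 1).card := by
      intro i hi e he
      have h1 := h.card_sums hα hext i hi e he
      have h2 := hF (2 * a i + e)
      have h3 := h.τ_low i hi
      have h4 := h.τ_high i hi
      simp only [add_le_add_iff_right]
      interval_cases e
      · simp only [Nat.cast_zero, add_zero] at h1 h2 ⊢; omega
      · simp only [Nat.cast_one, add_assoc, Nat.reduceAdd] at h1 h2 h4 ⊢; omega
    -- Even thresholds are handled by induction on the position. Passing a proper position, the
    -- claim is the given domination at `2a + 1`; passing an extra position removes two targets and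
    -- one sum, so the inequality survives.
    have hmain : ∀ p ≤ gapStart K n, τ (2 * p) ≤
        (Finset.univ.filter fun q : Fin (gapStart K n) =>
          2 * p ≤ extendPos K δ q + α' q + 1).card := by
      intro p
      induction p with
      | zero =>
        intro _
        simpa using h.τ_zero
      | succ p ih =>
        intro hp
        by_cases hr : ∃ j, properPos K j = p
        · obtain ⟨j, rfl⟩ := hr
          exact hproper j ((properPos_lt_gapStart K).1 (by omega)) 1 le_rfl
        · have h1 := ih (by omega)
          have h2 := h.card_sums_extra hα hext p (by omega) hr
          obtain ⟨i, hi, r, hrK, rfl⟩ := exists_gap_of_notMem_range K n p (by omega) hr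
          have h3 := (h.τ_gap i hi r hrK).2
          rw [mul_add 2 _ 1, mul_one]
          omega
    intro s
    by_cases hs : 2 * gapStart K n ≤ s
    · have := h.τ_anti hs
      rw [h.τ_top] at this
      omega
    rcases Nat.even_or_odd' s with ⟨p, rfl | rfl⟩
    · exact hmain p (by omega)
    · by_cases hr : ∃ j, properPos K j = p
      · obtain ⟨j, rfl⟩ := hr
        exact hproper j ((properPos_lt_gapStart K).1 (by omega)) 0 (by omega)
      · have h1 := hmain p (by omega)
        have h2 := h.card_sums_extra hα hext p (by omega) hr
        obtain ⟨i, hi, r, hrK, rfl⟩ := exists_gap_of_notMem_range K n p (by omega) hr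
        have h3 := (h.τ_gap i hi r hrK).1
        have h4 : (Finset.univ.filter fun q : Fin (gapStart K n) =>
            2 * (gapStart K i + r) + 2 ≤ extendPos K δ q + α' q + 1).card ≤
            (Finset.univ.filter fun q : Fin (gapStart K n) =>
            2 * (gapStart K i + r) + 1 ≤ extendPos K δ q + α' q + 1).card := by
          refine Finset.card_le_card fun q hq => ?_
          simp only [Finset.mem_filter, Finset.mem_univ, true_and] at hq ⊢
          omega
        omega
  · intro hτ
    have hproper : ∀ i < n, ∀ e : ℕ, e ≤ 1 → F (2 * a i + e) ≤
        (Finset.univ.filter fun j : Fin n => 2 * a i + e ≤ a (δ j) + a (α j)).card := by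
      intro i hi e he
      have h1 := h.card_sums hα hext i hi e he
      have h2 := hτ (2 * properPos K i + e + 1)
      have h3 := h.τ_low i hi
      have h4 := h.τ_high i hi
      simp only [add_le_add_iff_right] at h2
      interval_cases e
      · simp only [Nat.cast_zero, add_zero] at h1 h2 ⊢; omega
      · simp only [Nat.cast_one, add_assoc, Nat.reduceAdd] at h1 h2 h4 ⊢; omega
    intro y
    by_cases hex : ∃ i < n, 2 * a i < y
    · -- the last index with `2 * a i < y`
      obtain ⟨i, ⟨hi, hiy⟩, hmax⟩ : ∃ i, (i < n ∧ 2 * a i < y) ∧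
          ∀ i', (i' < n ∧ 2 * a i' < y) → i' ≤ i := by
        classical
        obtain ⟨i₀, h₀⟩ := hex
        obtain ⟨i, hi, hmax⟩ := ((Finset.range n).filter fun i => 2 * a i < y).exists_max_image id
          ⟨i₀, by simpa using h₀⟩
        refine ⟨i, by simpa using hi, fun i' hi' => hmax i' (by simpa using hi')⟩
      have hF := h.F_anti (show 2 * a i + 1 ≤ y by omega)
      have hG := hproper i hi 1 le_rfl
      push_cast at hG
      -- If the next value is adjacent, only `2a i + 1` and `2a (i + 1)` are possible for `y`, and
      -- both are controlled. Otherwise there is a cut or no further index: a sum exceeding `2a i`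
      -- comes from a pair beyond `i`, so it is already at least `2a (i + 1)`, and the count at `2a
      -- i + 1` serves for `y`.
      by_cases hy : (i + 1 < n ∧ a (i + 1) = a i + 1)
      · have h2 : ¬ 2 * a (i + 1) < y := fun hlt => by
          have := hmax (i + 1) ⟨hy.1, hlt⟩; omega
        rcases (show y = 2 * a i + 1 ∨ y = 2 * a (i + 1) by omega) with h3 | h3
        · rw [h3]; exact hG
        · have := hproper (i + 1) hy.1 0 (by omega)
          simpa [h3] using this
      · refine hF.trans (hG.trans (Finset.card_le_card fun j hj => ?_))
        simp only [Finset.mem_filter, Finset.mem_univ, true_and] at hj ⊢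
        have hαj := hα j
        have hmono : ∀ u w, u ≤ w → w < n → a u ≤ a w := by
          intro u w huw hw
          rcases huw.eq_or_lt with rfl | hlt
          · exact le_rfl
          · exact (h.a_lt u w hlt hw).le
        by_cases hin : i + 1 < n
        · have hy2 : y ≤ 2 * a (i + 1) := by
            by_contra hlt
            have := hmax (i + 1) ⟨hin, by omega⟩; omega
          rcases h.cut_or_succ i hin with hc | hc
          · have h5 := h.lt_iff_of_valid hα hc j
            have hlt : i + 1 ≤ (α j : ℕ) := by
              by_contra hlt
              have h6 := hmono (α j) i (by omega) hi
              have h7 := hmono (δ j) i (by omega) hi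
              omega
            have h6 := hmono _ _ hlt (α j).2
            have h7 := hmono _ _ (hlt.trans hαj) (h.δ_lt j j.2)
            omega
          · exact absurd ⟨hin, hc.1⟩ hy
        · have h6 := hmono (α j) i (by have := (α j).2; omega) hi
          have h7 := hmono (δ j) i (by have := h.δ_lt j j.2; omega) hi
          omega
    · push Not at hex
      refine (h.F_le y).trans ?_
      rw [Finset.filter_true_of_mem, Finset.card_univ, Fintype.card_fin]
      intro j _
      have h1 := hex (δ j) (h.δ_lt j j.2)
      have h2 := hex (α j) (α j).2
      omega

theorem exists_extends (n : ℕ) (K : ℕ → ℕ) (α : Equiv.Perm (Fin n)) :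
    ∃ α' : Equiv.Perm (Fin (gapStart K n)), Extends K α α' := by
  classical
  have hb : Function.Bijective (fun j : Fin n => (⟨⟨properPos K j,
      (properPos_lt_gapStart K).2 j.2⟩, j, rfl⟩ :
        {p : Fin (gapStart K n) // ∃ j, properPos K j = p})) := by
    constructor
    · intro j j' hj
      simp only [Subtype.mk.injEq, Fin.mk.injEq] at hj
      exact Fin.ext ((properPos_strictMono K).injective hj)
    · rintro ⟨⟨p, hp⟩, j, hj⟩
      simp only at hj
      subst hj
      exact ⟨⟨j, (properPos_lt_gapStart K).1 hp⟩, rfl⟩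
  refine ⟨α.extendDomain (Equiv.ofBijective _ hb), fun j p hp => ?_, fun p hp => ?_⟩
  · have := Equiv.Perm.extendDomain_apply_image α (Equiv.ofBijective _ hb) j
    have h2 : ((Equiv.ofBijective _ hb) j : Fin (gapStart K n)) = p := Fin.ext hp.symm
    rw [h2] at this
    rw [this]
    rfl
  · exact Equiv.Perm.extendDomain_apply_not_subtype α _ hp

/-- An extra position `p` is a cut and is its own deadline, so a valid permutation sends it neither
below nor above itself. Extra positions being fixed, the proper ones are permuted among themselves.
-/
theorem exists_extends_of_valid (h : GapFilling n K δ a F τ)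
    (α' : Equiv.Perm (Fin (gapStart K n))) (hα' : ∀ p, (α' p : ℕ) ≤ extendPos K δ p) :
    ∃ α : Equiv.Perm (Fin n), Extends K α α' := by
  have hfix : ∀ p : Fin (gapStart K n), (¬ ∃ j, properPos K j = p) → α' p = p := by
    intro p hr
    have hcut : ∀ q < gapStart K n, q < (p : ℕ) → extendPos K δ q < p := by
      intro q hq hqp
      by_cases hqr : ∃ j, properPos K j = q
      · obtain ⟨j, rfl⟩ := hqr
        rw [extendPos_properPos]
        exact h.cut_notMem p.2 hr j hqp
      · rwa [extendPos_of_notMem _ _ hqr]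
    have h1 := α'.lt_iff_of_le _ hα' hcut p
    have h2 := hα' p
    rw [extendPos_of_notMem _ _ hr] at h2
    exact Fin.ext (by omega)
  have hmaps : ∀ j : Fin n, ∃ j' : Fin n,
      (α' ⟨properPos K j, (properPos_lt_gapStart K).2 j.2⟩ : ℕ) = properPos K j' := by
    intro j
    by_contra hno
    have hr : ¬ ∃ j', properPos K j' =
        (α' ⟨properPos K j, (properPos_lt_gapStart K).2 j.2⟩ : ℕ) := by
      rintro ⟨j', hj'⟩
      refine hno ⟨⟨j', ?_⟩, hj'.symm⟩
      rw [← properPos_lt_gapStart K, hj']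
      exact Fin.is_lt _
    have := α'.injective (hfix _ hr)
    rw [this] at hr
    exact hr ⟨j, rfl⟩
  choose β hβ using hmaps
  have hinj : Function.Injective β := by
    intro j j' hj
    have := (hβ j).trans ((congrArg (fun x : Fin n => properPos K x) hj).trans (hβ j').symm)
    have := α'.injective (Fin.ext this)
    rw [Fin.mk.injEq] at this
    exact Fin.ext ((properPos_strictMono K).injective this)
  refine ⟨Equiv.ofBijective β (Finite.injective_iff_bijective.1 hinj), fun j p hp => ?_, hfix⟩
  rw [Equiv.ofBijective_apply, ← hβ]
  congr 2
  exact Fin.ext hp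

/-- Filling the gaps preserves solvability. -/
theorem solvable_iff (h : GapFilling n K δ a F τ) :
    (∃ α : Equiv.Perm (Fin n), (∀ j, (α j : ℕ) ≤ δ j) ∧
      ∀ y : ℤ, F y ≤ (Finset.univ.filter fun j : Fin n => y ≤ a (δ j) + a (α j)).card) ↔
    ∃ α' : Equiv.Perm (Fin (gapStart K n)), (∀ p, (α' p : ℕ) ≤ extendPos K δ p) ∧
      ∀ s, τ s ≤ (Finset.univ.filter fun p : Fin (gapStart K n) =>
        s ≤ extendPos K δ p + α' p + 1).card := by
  constructor
  · rintro ⟨α, hα, hF⟩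
    obtain ⟨α', hext⟩ := exists_extends n K α
    refine ⟨α', fun p => ?_, (h.dominates_iff hα hext).1 hF⟩
    by_cases hr : ∃ j, properPos K j = p
    · obtain ⟨j, hj⟩ := hr
      have hjn : j < n := by rw [← properPos_lt_gapStart K, hj]; exact p.2
      rw [hext.proper ⟨j, hjn⟩ p hj.symm, ← hj, extendPos_properPos]
      exact (properPos_strictMono K).monotone (hα _)
    · rw [hext.extra p hr, extendPos_of_notMem _ _ hr]
  · rintro ⟨α', hα', hτ⟩
    obtain ⟨α, hext⟩ := h.exists_extends_of_valid α' hα'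
    have hα : ∀ j, (α j : ℕ) ≤ δ j := by
      intro j
      have := hα' ⟨properPos K j, (properPos_lt_gapStart K).2 j.2⟩
      rw [hext.proper j _ rfl, extendPos_properPos] at this
      exact (properPos_strictMono K).le_iff_le.1 this
    exact ⟨α, hα, (h.dominates_iff hα hext).2 hτ⟩

end GapFilling

/-! ### Words of counter instructions -/

/-- The values of a counter output by a word of instructions, where `false` increments the counter
and `true` outputs it. -/
def emitted : ℕ → List Bool → List ℕ
  | _, [] => []
  | x, false :: w => emitted (x + 1) w
  | x, true :: w => x :: emitted x w

theorem emitted_append (x : ℕ) (u v : List Bool) :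
    emitted x (u ++ v) = emitted x u ++ emitted (x + u.count false) v := by
  induction u generalizing x with
  | nil => simp [emitted]
  | cons b u ih =>
    cases b
    · simp [emitted, ih, add_assoc, add_comm 1]
    · simp [emitted, ih]

theorem le_of_mem_emitted {x y : ℕ} {w : List Bool} (h : y ∈ emitted x w) : x ≤ y := by
  induction w generalizing x with
  | nil => simp [emitted] at h
  | cons b w ih =>
    cases b
    · have := ih h; omega
    · rcases List.mem_cons.1 h with rfl | h
      · exact le_rfl
      · exact ih h

theorem emitted_sorted (x : ℕ) (w : List Bool) : (emitted x w).Pairwise (· ≤ ·) := by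
  induction w generalizing x with
  | nil => exact List.Pairwise.nil
  | cons b w ih =>
    cases b
    · exact ih _
    · exact List.pairwise_cons.2 ⟨fun y hy => le_of_mem_emitted hy, ih _⟩

theorem emitted_replicate_true (x c : ℕ) :
    emitted x (List.replicate c true) = List.replicate c x := by
  induction c with
  | zero => rfl
  | succ c ih => simp [List.replicate_succ, emitted, ih]

/-- The instructions for a sequence of slots: each slot increments the counter, and a slot marked
`true` also outputs it. -/
def slotWord (s : List Bool) : List Bool := s.flatMap fun f => if f then [false, true] else [false]

theorem slotWord_append (s s' : List Bool) : slotWord (s ++ s') = slotWord s ++ slotWord s' := by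
  simp [slotWord]

theorem slotWord_replicate_true (n : ℕ) :
    slotWord (List.replicate n true) = (List.replicate n [false, true]).flatten := by
  induction n with
  | zero => rfl
  | succ n ih => simp_all [List.replicate_succ, slotWord]

theorem emitted_slotWord_cons (x : ℕ) (f : Bool) (s : List Bool) :
    emitted x (slotWord (f :: s)) =
      (if f then [x + 1] else []) ++ emitted (x + 1) (slotWord s) := by
  cases f <;> simp [slotWord, emitted]

theorem mem_emitted_slotWord {x y : ℕ} {s : List Bool} (h : y ∈ emitted x (slotWord s)) :
    x + 1 ≤ y ∧ y ≤ x + s.length := by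
  induction s generalizing x with
  | nil => simp [slotWord, emitted] at h
  | cons f s ih =>
    rw [emitted_slotWord_cons, List.mem_append] at h
    rw [List.length_cons]
    rcases h with h | h
    · cases f <;> simp at h
      omega
    · have := ih h; omega

theorem emitted_slotWord_nodup (x : ℕ) (s : List Bool) : (emitted x (slotWord s)).Nodup := by
  induction s generalizing x with
  | nil => simp [slotWord, emitted]
  | cons f s ih =>
    rw [emitted_slotWord_cons]
    cases f
    · simpa using ih _
    · simp only [if_true, List.singleton_append, List.nodup_cons]
      exact ⟨fun h => by have := mem_emitted_slotWord h; omega, ih _⟩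

/-- Marked slots become elements of `L`, so the complement of `L` is read off from the unmarked
slots. This turns thresholds on the complement into counts of `false` in a dropped word. -/
theorem card_unmarked_slots (x : ℕ) (s : List Bool) (m : ℕ) :
    ((Finset.Icc (x + 1) (x + s.length) \ (emitted x (slotWord s)).toFinset).filter
      fun t => x + 1 + m ≤ t).card = (s.drop m).count false := by
  induction s generalizing x m with
  | nil => simp
  | cons f s ih =>
    have hrec : (Finset.Icc (x + 1) (x + (f :: s).length) \
        (emitted x (slotWord (f :: s))).toFinset) = (if f then ∅ else {x + 1}) ∪
        (Finset.Icc (x + 1 + 1) (x + 1 + s.length) \ (emitted (x + 1) (slotWord s)).toFinset) := by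
      ext y
      have hy : y ∈ emitted (x + 1) (slotWord s) → x + 1 + 1 ≤ y := fun h =>
        (mem_emitted_slotWord h).1
      rw [emitted_slotWord_cons]
      by_cases hmem : y ∈ emitted (x + 1) (slotWord s)
      · have := hy hmem
        cases f
        · simp [hmem]; omega
        · simp [hmem]
      · cases f
        · simp [hmem]; omega
        · simp [hmem]; omega
    rw [hrec, Finset.filter_union]
    cases m with
    | zero =>
      have := ih (x + 1) 0
      rw [Finset.filter_true_of_mem] at this
      · rw [Finset.filter_true_of_mem, Finset.filter_true_of_mem]
        · cases f
          · rw [Finset.card_union_of_disjoint, this]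
            · simp [add_comm]
            · simp
          · simp [this]
        · intro y hy; simp at hy; omega
        · intro y hy; cases f <;> simp at hy; omega
      · intro y hy; simp at hy; omega
    | succ m =>
      have h1 : (if f then ∅ else {x + 1} : Finset ℕ).filter (fun t => x + 1 + (m + 1) ≤ t) = ∅ := by
        cases f <;> simp
      rw [h1, Finset.empty_union, List.drop_succ_cons, ← ih (x + 1) m]
      congr 1
      ext y
      simp only [Finset.mem_filter]
      refine and_congr_right fun _ => ?_
      omega

/-! ### The reduction -/

/-- One step of the reduction for each entry `a` of `A`: the number of targets below `2a` not
treated before, whether `2a` is a target, and the number of deadlines equal to `a`. -/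
def pmSteps : List ℤ → List ℕ → List ℕ → List (ℕ × Bool × ℕ)
  | [], _, _ => []
  | a :: A, T, D =>
    let T₁ := T.dropWhile fun t : ℕ => decide ((t : ℤ) < 2 * a)
    let b := decide (T₁.head?.map (fun t : ℕ => (t : ℤ)) = some (2 * a))
    let D₁ := D.dropWhile fun d : ℕ => decide ((d : ℤ) = a)
    (T.length - T₁.length, b, D.length - D₁.length) :: pmSteps A (if b then T₁.tail else T₁) D₁

/-- The deadlines of a step: one for each extra position, and the deadlines of the proper one. -/
def stepDeadlines (s : ℕ × Bool × ℕ) : List Bool :=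
  (List.replicate (s.1 - 1) [false, true]).flatten ++ false :: List.replicate s.2.2 true

/-- The slots of a step for large deadlines; the unmarked slots are the targets. -/
def stepSlots (s : ℕ × Bool × ℕ) : List Bool :=
  List.replicate (s.1 + (s.1 - 1)) false ++ List.replicate (s.1 - 1 + 1 - s.1) true ++ [!s.2.1]

/-- The number of positions of all steps. -/
def stepsSize (l : List (ℕ × Bool × ℕ)) : ℕ := (l.map fun s => s.1 - 1 + 1).sum

/-- The instructions that output the constructed instance of 2-Visits. -/
def reductionWord (l : List (ℕ × Bool × ℕ)) : List Bool :=
  (List.replicate (stepsSize l) [false, true, false]).flatten ++ l.flatMap stepDeadlines ++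
    ((List.replicate (stepsSize l) [false, true]).flatten ++
      l.flatMap fun s => slotWord (stepSlots s))

/-- The counter never decreases, and a non-empty word starts with an increment, so nothing is
printed at value zero. -/
theorem isDeadlineSeq_reductionWord (l : List (ℕ × Bool × ℕ)) :
    IsDeadlineSeq (emitted 0 (reductionWord l)) := by
  refine ⟨fun d hd => ?_, emitted_sorted _ _⟩
  cases l with
  | nil => simp [reductionWord, stepsSize, emitted] at hd
  | cons s l =>
    have : ∃ w, reductionWord (s :: l) = false :: w := by
      simp only [reductionWord, stepsSize, List.map_cons, List.sum_cons]
      rw [show s.1 - 1 + 1 + (l.map fun s => s.1 - 1 + 1).sum =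
        (s.1 - 1 + (l.map fun s => s.1 - 1 + 1).sum) + 1 by ring, List.replicate_succ]
      exact ⟨_, rfl⟩
    obtain ⟨w, hw⟩ := this
    rw [hw] at hd
    exact le_of_mem_emitted (x := 1) hd

/-- The reduction from Position Matching to 2-Visits. -/
def reduction (I : PMInstance) : TwoVisitsInstance :=
  ⟨emitted 0 (reductionWord (pmSteps I.A I.T I.D)), isDeadlineSeq_reductionWord _⟩

/-! ### The steps in terms of the targets and deadlines -/

/-- For sorted lists the machine's single pass, which only removes from the front, agrees with
filtering by a threshold; counting arguments use the latter form. -/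
theorem dropWhile_lt_eq_filter (T : List ℕ) (hT : T.Pairwise (· < ·)) (y : ℤ) :
    T.dropWhile (fun t : ℕ => decide ((t : ℤ) < y)) = T.filter (fun t : ℕ => decide (y ≤ (t : ℤ))) := by
  induction T with
  | nil => rfl
  | cons t T ih =>
    rw [List.pairwise_cons] at hT
    by_cases h : (t : ℤ) < y
    · rw [List.dropWhile_cons_of_pos (by simpa using h), ih hT.2,
        List.filter_cons_of_neg (by simpa using h)]
    · rw [List.dropWhile_cons_of_neg (by simpa using h), List.filter_eq_self.2]
      intro u hu
      rcases List.mem_cons.1 hu with rfl | hu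
      · simpa using h
      · have := hT.1 u hu
        simp; omega

theorem dropWhile_tail_eq_filter (T : List ℕ) (hT : T.Pairwise (· < ·)) (y : ℤ) :
    (if decide ((T.dropWhile fun t : ℕ => decide ((t : ℤ) < y)).head?.map (fun t : ℕ => (t : ℤ)) = some y)
      then (T.dropWhile fun t : ℕ => decide ((t : ℤ) < y)).tail
      else T.dropWhile fun t : ℕ => decide ((t : ℤ) < y)) =
        T.filter (fun t : ℕ => decide (y + 1 ≤ (t : ℤ))) := by
  induction T with
  | nil => simp
  | cons t T ih =>
    rw [List.pairwise_cons] at hT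
    by_cases h : (t : ℤ) < y
    · rw [List.dropWhile_cons_of_pos (by simpa using h), ih hT.2,
        List.filter_cons_of_neg (by simp; omega)]
    · rw [List.dropWhile_cons_of_neg (by simpa using h)]
      by_cases h2 : (t : ℤ) = y
      · simp only [List.head?_cons, Option.map_some, h2, decide_true, if_true, List.tail_cons]
        rw [List.filter_cons_of_neg (by simp; omega), List.filter_eq_self.2]
        intro u hu
        have := hT.1 u hu
        simp; omega
      · simp only [List.head?_cons, Option.map_some, Option.some.injEq, h2, decide_false,
          Bool.false_eq_true, if_false]
        rw [List.filter_eq_self.2]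
        intro u hu
        rcases List.mem_cons.1 hu with rfl | hu
        · simp; omega
        · have := hT.1 u hu
          simp; omega

theorem dropWhile_eq_eq_filter (D : List ℕ) (hD : D.Pairwise (· ≤ ·)) (a : ℤ)
    (ha : ∀ d ∈ D, a ≤ (d : ℤ)) :
    D.dropWhile (fun d : ℕ => decide ((d : ℤ) = a)) = D.filter (fun d : ℕ => decide (a < (d : ℤ))) := by
  induction D with
  | nil => rfl
  | cons d D ih =>
    rw [List.pairwise_cons] at hD
    have had := ha d List.mem_cons_self
    by_cases h : (d : ℤ) = a
    · rw [List.dropWhile_cons_of_pos (by simpa using h), ih hD.2 fun u hu =>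
        ha u (List.mem_cons_of_mem _ hu), List.filter_cons_of_neg (by simp; omega)]
    · rw [List.dropWhile_cons_of_neg (by simpa using h), List.filter_eq_self.2]
      intro u hu
      rcases List.mem_cons.1 hu with rfl | hu
      · simp; omega
      · have := hD.1 u hu
        simp; omega

/-- The number of targets that are at least `y`. -/
def targetCount (T : List ℕ) (y : ℤ) : ℕ := T.countP fun t : ℕ => decide (y ≤ (t : ℤ))

theorem targetCount_filter (T : List ℕ) {x y : ℤ} (h : x ≤ y) :
    targetCount (T.filter fun t : ℕ => decide (x ≤ (t : ℤ))) y = targetCount T y := by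
  rw [targetCount, List.countP_filter]
  refine List.countP_congr fun t _ => ?_
  simp; omega

theorem targetCount_antitone (T : List ℕ) : Antitone (targetCount T) := fun x y h =>
  List.countP_mono_left fun t _ => by simp; omega

theorem length_pmSteps (A : List ℤ) (T D : List ℕ) : (pmSteps A T D).length = A.length := by
  induction A generalizing T D with
  | nil => rfl
  | cons a A ih => simp [pmSteps, ih]

/-- When the pass reaches `a`, exactly the targets above twice the previous entry and the deadlines
above that entry remain. The first component of a step is thus the number of targets strictly
between `2aᵢ₋₁` and `2aᵢ`, or below `2a₀` at the start. That every deadline occurs in `A` ensures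
that none blocks the front of the list. -/
theorem pmSteps_spec (A : List ℤ) (T D : List ℕ) (hA : A.Pairwise (· < ·))
    (hT : T.Pairwise (· < ·)) (hD : D.Pairwise (· ≤ ·)) (hDA : ∀ d ∈ D, (d : ℤ) ∈ A) (i : ℕ)
    (hi : i < A.length) :
    ((pmSteps A T D).getD i default).2.2 = D.countP (fun d : ℕ => decide ((d : ℤ) = A.getD i 0)) ∧
    targetCount T (2 * A.getD i 0) =
      ((pmSteps A T D).getD i default).2.1.toNat + targetCount T (2 * A.getD i 0 + 1) ∧
    (i = 0 → ((pmSteps A T D).getD i default).1 + targetCount T (2 * A.getD i 0) = T.length) ∧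
    ∀ j, i = j + 1 → ((pmSteps A T D).getD i default).1 + targetCount T (2 * A.getD i 0) =
      targetCount T (2 * A.getD j 0 + 1) := by
  induction A generalizing T D i with
  | nil => simp at hi
  | cons a A ih =>
    rw [List.pairwise_cons] at hA
    have hDa : ∀ d ∈ D, a ≤ (d : ℤ) := by
      intro d hd
      rcases List.mem_cons.1 (hDA d hd) with h | h
      · exact h.ge
      · exact (hA.1 _ h).le
    have hsteps : pmSteps (a :: A) T D = (T.length - targetCount T (2 * a),
        decide ((T.filter fun t : ℕ => decide (2 * a ≤ (t : ℤ))).head?.map (fun t : ℕ => (t : ℤ)) =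
          some (2 * a)), D.length - (D.filter fun d : ℕ => decide (a < (d : ℤ))).length) ::
        pmSteps A (T.filter fun t : ℕ => decide (2 * a + 1 ≤ (t : ℤ)))
          (D.filter fun d : ℕ => decide (a < (d : ℤ))) := by
      rw [pmSteps, dropWhile_tail_eq_filter T hT, dropWhile_lt_eq_filter T hT,
        dropWhile_eq_eq_filter D hD a hDa, targetCount, List.countP_eq_length_filter]
    cases i with
    | zero =>
      rw [hsteps]
      simp only [List.getD_cons_zero]
      refine ⟨?_, ?_, fun _ => ?_, fun j hj => by omega⟩
      · have h1 := List.length_eq_countP_add_countP (fun d : ℕ => decide ((d : ℤ) = a)) (l := D)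
        rw [← List.countP_eq_length_filter]
        have h2 : D.countP (fun d : ℕ => decide (a < (d : ℤ))) =
            D.countP (fun d : ℕ => decide ¬ (decide ((d : ℤ) = a) = true)) := by
          refine List.countP_congr fun d hd => ?_
          have := hDa d hd
          simp; omega
        omega
      · have h3 := dropWhile_tail_eq_filter T hT (2 * a)
        rw [dropWhile_lt_eq_filter T hT] at h3
        have h4 := congrArg List.length h3
        rw [← List.countP_eq_length_filter (p := fun t : ℕ => decide (2 * a + 1 ≤ (t : ℤ)))] at h4
        change _ = targetCount T (2 * a + 1) at h4
        rw [← h4, targetCount, List.countP_eq_length_filter]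
        generalize T.filter (fun t : ℕ => decide (2 * a ≤ (t : ℤ))) = S
        by_cases hb : S.head?.map (fun t : ℕ => (t : ℤ)) = some (2 * a)
        · cases S with
          | nil => simp at hb
          | cons u S => simp at hb; simp [hb, add_comm]
        · simp [hb]
      · have : targetCount T (2 * a) ≤ T.length := List.countP_le_length
        omega
    | succ i =>
      rw [hsteps]
      simp only [List.getD_cons_succ]
      have hi' : i < A.length := by simpa using hi
      have hmem : A.getD i 0 ∈ A := by
        rw [List.getD_eq_getElem _ _ hi']; exact List.getElem_mem _
      have hai : a < A.getD i 0 := hA.1 _ hmem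
      obtain ⟨h1, h2, h3, h4⟩ := ih (T.filter fun t : ℕ => decide (2 * a + 1 ≤ (t : ℤ)))
        (D.filter fun d : ℕ => decide (a < (d : ℤ))) hA.2 (hT.filter _) (hD.filter _) (by
          intro d hd
          rw [List.mem_filter] at hd
          rcases List.mem_cons.1 (hDA d hd.1) with h | h
          · have := hd.2; simp at this; omega
          · exact h) i hi'
      rw [targetCount_filter T (by omega), targetCount_filter T (by omega)] at h2
      rw [targetCount_filter T (by omega)] at h3 h4
      refine ⟨?_, h2, fun h => by omega, fun j hj => ?_⟩
      · rw [h1, List.countP_filter]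
        refine List.countP_congr fun d _ => ?_
        simp only [Bool.and_eq_true, decide_eq_true_eq]; omega
      · obtain rfl : i = j := by omega
        cases i with
        | zero =>
          rw [h3 rfl, List.getD_cons_zero, targetCount, List.countP_eq_length_filter]
        | succ i =>
          have hmem' : A.getD i 0 ∈ A := by
            rw [List.getD_eq_getElem _ _ (by omega)]; exact List.getElem_mem _
          have := hA.1 _ hmem'
          rw [h4 i rfl, List.getD_cons_succ, targetCount_filter T (by omega)]

/-! ### Correctness of the reduction -/

theorem List.drop_flatMap_range {α : Type*} (f : ℕ → List α) (n i : ℕ) (hi : i ≤ n) :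
    ((List.range n).flatMap f).drop (∑ j ∈ Finset.range i, (f j).length) =
      (List.range' i (n - i)).flatMap f := by
  have h1 : List.range n = List.range i ++ List.range' i (n - i) := by
    rw [List.range_eq_range', List.range_eq_range', ← Nat.add_sub_cancel' hi,
      ← List.range'_append_1, Nat.add_sub_cancel_left, zero_add]
  have h2 : ((List.range i).flatMap f).length = ∑ j ∈ Finset.range i, (f j).length := by
    rw [List.length_flatMap, Finset.sum_range, ← List.sum_ofFn]
    congr 1
    rw [List.ofFn_eq_map, ← List.map_coe_finRange_eq_range, List.map_map]
    rfl
  rw [h1, List.flatMap_append, ← h2, List.drop_left]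

theorem List.drop_flatMap_range_succ {α : Type*} (f : ℕ → List α) (n i r : ℕ) (hi : i < n)
    (hr : r ≤ (f i).length) :
    ((List.range n).flatMap f).drop (∑ j ∈ Finset.range i, (f j).length + r) =
      (f i).drop r ++ ((List.range n).flatMap f).drop
        (∑ j ∈ Finset.range (i + 1), (f j).length) := by
  rw [← List.drop_drop, List.drop_flatMap_range f n i hi.le, List.drop_flatMap_range f n (i + 1) hi,
    show n - i = (n - (i + 1)) + 1 by omega, List.range'_succ, List.flatMap_cons,
    List.drop_append_of_le_length hr]

theorem List.eq_map_getD_range {α : Type*} (l : List α) (d : α) :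
    l = (List.range l.length).map fun i => l.getD i d := by
  refine List.ext_getElem (by simp) fun i h1 h2 => ?_
  simp [h1]

theorem List.countP_eq_card_filter_range (l : List ℕ) (p : ℕ → Prop) [DecidablePred p] :
    l.countP (fun x => decide (p x)) =
      ((Finset.range l.length).filter fun j => p (l.getD j 0)).card := by
  conv_lhs => rw [List.eq_map_getD_range l 0]
  rw [List.countP_map]
  have : (Finset.range l.length).val = (List.range l.length : Multiset ℕ) := rfl
  rw [Finset.card_def, Finset.filter_val, this, Multiset.filter_coe, Multiset.coe_card,
    List.countP_eq_length_filter]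
  rfl

theorem Multiset.map_eq_sum_singleton {ι β : Type*} (s : Finset ι) (f : ι → β) :
    s.val.map f = ∑ i ∈ s, {f i} := by
  rw [Finset.sum, ← Multiset.sum_map_singleton (s.val.map f), Multiset.map_map]
  rfl

/-- A sum over all positions is regrouped by gaps, each with its extra positions followed by the
proper one. -/
theorem sum_range_gapStart {M : Type*} [AddCommMonoid M] (K : ℕ → ℕ) (h : ℕ → M) (n : ℕ) :
    ∑ p ∈ Finset.range (gapStart K n), h p =
      ∑ i ∈ Finset.range n, (∑ r ∈ Finset.range (K i), h (gapStart K i + r) +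
        h (properPos K i)) := by
  induction n with
  | zero => simp [gapStart]
  | succ n ih =>
    rw [Finset.sum_range_succ, ← ih, gapStart_succ, properPos, add_assoc, Finset.sum_range_add,
      Finset.sum_range_succ]

theorem notMem_range_properPos (K : ℕ → ℕ) (i r : ℕ) (hr : r < K i) :
    ¬ ∃ j, properPos K j = gapStart K i + r := by
  rintro ⟨j, hj⟩
  rcases lt_or_ge j i with h | h
  · have := (properPos_lt_gapStart K).2 h; omega
  · have := (properPos_strictMono K).monotone h
    simp only [properPos] at this hj
    omega

theorem emitted_replicate_pair (x m : ℕ) :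
    emitted x (List.replicate m [false, true]).flatten = (List.range m).map fun r => x + 1 + r := by
  induction m with
  | zero => rfl
  | succ m ih =>
    rw [List.replicate_succ', List.flatten_append, emitted_append, ih, List.range_succ,
      List.map_append]
    have : ((List.replicate m [false, true]).flatten).count false = m := by
      simp [List.count_flatten]
    rw [this]
    simp [emitted]
    omega

theorem emitted_replicate_triple (m : ℕ) :
    emitted 0 (List.replicate m [false, true, false]).flatten =
      (List.range m).map fun r => 2 * r + 1 := by
  induction m with
  | zero => rfl
  | succ m ih =>
    rw [List.replicate_succ', List.flatten_append, emitted_append, ih, List.range_succ,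
      List.map_append]
    have : ((List.replicate m [false, true, false]).flatten).count false = 2 * m := by
      simp [List.count_flatten, mul_comm]
    rw [this]
    simp [emitted]

theorem count_stepDeadlines (s : ℕ × Bool × ℕ) : (stepDeadlines s).count false = s.1 - 1 + 1 := by
  simp [stepDeadlines, List.count_flatten, List.count_replicate]

theorem length_stepSlots (s : ℕ × Bool × ℕ) : (stepSlots s).length = 2 * (s.1 - 1 + 1) := by
  simp [stepSlots]
  omega

/-! ### The arrangement of positions and slots -/

section Layout

variable (st : ℕ → ℕ × Bool × ℕ) (n : ℕ)

/-- The numbers of extra positions of a sequence of steps. -/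
def extraCount (i : ℕ) : ℕ := (st i).1 - 1

/-- The slots of a sequence of steps. -/
def allSlots : List Bool := (List.range n).flatMap fun i => stepSlots (st i)

/-- The number of targets in the slots from the given one on. -/
def slotTargets (s : ℕ) : ℕ := ((allSlots st n).drop s).count false

theorem count_stepDeadlines_range :
    ((List.range n).flatMap fun i => stepDeadlines (st i)).count false =
      gapStart (extraCount st) n := by
  induction n with
  | zero => rfl
  | succ n ih =>
    rw [List.range_succ, List.flatMap_append, List.count_append, ih, gapStart_succ, properPos]
    simp [count_stepDeadlines, extraCount, add_assoc]

theorem sum_length_stepSlots (i : ℕ) :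
    ∑ j ∈ Finset.range i, (stepSlots (st j)).length = 2 * gapStart (extraCount st) i := by
  simp only [length_stepSlots, gapStart, extraCount, Finset.mul_sum]

theorem length_allSlots : (allSlots st n).length = 2 * gapStart (extraCount st) n := by
  induction n with
  | zero => rfl
  | succ n ih =>
    rw [allSlots, List.range_succ, List.flatMap_append, List.length_append, ← allSlots, ih,
      gapStart_succ, properPos]
    simp only [List.flatMap_cons, List.flatMap_nil, List.append_nil, length_stepSlots, extraCount]
    ring

theorem emitted_stepDeadlines (x : ℕ) :
    (emitted x ((List.range n).flatMap fun i => stepDeadlines (st i)) : Multiset ℕ) =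
      ∑ i ∈ Finset.range n,
        (∑ r ∈ Finset.range (extraCount st i), {x + 1 + (gapStart (extraCount st) i + r)} +
          (st i).2.2 • {x + 1 + properPos (extraCount st) i}) := by
  induction n with
  | zero => rfl
  | succ n ih =>
    rw [List.range_succ, List.flatMap_append, emitted_append, ← Multiset.coe_add, ih,
      count_stepDeadlines_range, Finset.sum_range_succ]
    congr 1
    rw [List.flatMap_cons, List.flatMap_nil, List.append_nil, stepDeadlines, emitted_append,
      ← Multiset.coe_add, emitted_replicate_pair, emitted, emitted_replicate_true]
    congr 1
    · rw [← Multiset.map_eq_sum_singleton, Finset.range_val, Multiset.range, Multiset.map_coe]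
      congr 1
      refine List.map_congr_left fun r _ => ?_
      omega
    · rw [Multiset.coe_replicate, ← Multiset.nsmul_singleton]
      congr 2
      have : ((List.replicate ((st n).1 - 1) [false, true]).flatten).count false =
        (st n).1 - 1 := by simp [List.count_flatten]
      rw [this, properPos, extraCount]
      omega

variable {st n}

/-- Each step owns `2 * (K i + 1)` consecutive slots with `K = extraCount st`, so targets are
counted block by block from the right. -/
theorem slotTargets_block {i r : ℕ} (hi : i < n) (hr : r ≤ 2 * (extraCount st i + 1)) :
    slotTargets st n (2 * gapStart (extraCount st) i + r) =
      ((stepSlots (st i)).drop r).count false +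
        slotTargets st n (2 * gapStart (extraCount st) (i + 1)) := by
  have := List.drop_flatMap_range_succ (fun i => stepSlots (st i)) n i r hi
    (by rw [length_stepSlots]; exact hr)
  rw [sum_length_stepSlots, sum_length_stepSlots] at this
  rw [slotTargets, allSlots, this, List.count_append]
  rfl

/-- The last slot of a step stands for `2a`, and all the others for values below `2a`. With
truncated subtraction the layout also covers `s.1 = 0`: one slot without a target, then the last
one. -/
theorem count_stepSlots_drop (s : ℕ × Bool × ℕ) :
    ((stepSlots s).drop 0).count false = s.1 + (s.1 - 1) + s.2.1.toNat ∧
    ((stepSlots s).drop (2 * (s.1 - 1) + 1)).count false = s.2.1.toNat := by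
  constructor
  · cases h : s.2.1 <;> simp [stepSlots, h, List.count_replicate]
  · have h1 : (List.replicate (s.1 + (s.1 - 1)) false ++
        List.replicate (s.1 - 1 + 1 - s.1) true).length = 2 * (s.1 - 1) + 1 := by
      simp; omega
    rw [stepSlots, List.drop_left' h1]
    cases h : s.2.1 <;> simp

theorem count_stepSlots_gap (s : ℕ × Bool × ℕ) {r : ℕ} (hr : r ≤ 2 * (s.1 - 1) + 1)
    (hs : 0 < s.1 - 1) : ((stepSlots s).drop r).count false =
      2 * (s.1 - 1) + 1 - r + s.2.1.toNat := by
  have h1 : s.1 - 1 + 1 - s.1 = 0 := by omega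
  have h2 : s.1 + (s.1 - 1) = 2 * (s.1 - 1) + 1 := by omega
  rw [stepSlots, h1, h2, List.replicate_zero, List.append_nil,
    List.drop_append_of_le_length (by simpa using hr), List.drop_replicate]
  cases h : s.2.1 <;> simp

theorem slotTargets_top : slotTargets st n (2 * gapStart (extraCount st) n) = 0 := by
  rw [slotTargets, List.drop_of_length_le (by rw [length_allSlots])]
  rfl

theorem slotTargets_antitone : Antitone (slotTargets st n) := by
  intro s s' h
  rw [slotTargets, slotTargets, ← Nat.add_sub_cancel' h, ← List.drop_drop]
  exact (List.drop_sublist _ _).count_le _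

end Layout

/-! ### Counting the targets of the constructed instance -/

namespace PMInstance

variable (I : PMInstance)

/-- The steps of the reduction as a function of the index. -/
def step (i : ℕ) : ℕ × Bool × ℕ := (pmSteps I.A I.T I.D).getD i default

theorem pmSteps_eq : pmSteps I.A I.T I.D = (List.range I.D.length).map I.step := by
  have h := List.eq_map_getD_range (pmSteps I.A I.T I.D) default
  rw [length_pmSteps, I.length_A] at h
  exact h

theorem getD_A (i : ℕ) (hi : i < I.D.length) : I.A.getD i 0 = I.entryA ⟨i, hi⟩ := by
  rw [List.getD_eq_getElem _ _ (by rw [I.length_A]; exact hi)]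
  rfl

theorem getD_D (i : ℕ) (hi : i < I.D.length) : I.D.getD i 0 = I.D.get ⟨i, hi⟩ := by
  rw [List.getD_eq_getElem _ _ hi]
  rfl

theorem A_lt_succ (i : ℕ) (hi : i + 1 < I.D.length) : I.A.getD i 0 < I.A.getD (i + 1) 0 := by
  have := I.entryA_succ ⟨i, by omega⟩ ⟨i + 1, hi⟩ rfl
  rw [I.getD_A i (by omega), I.getD_A (i + 1) hi]
  omega

theorem A_lt (i j : ℕ) (hij : i < j) (hj : j < I.D.length) : I.A.getD i 0 < I.A.getD j 0 := by
  induction j with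
  | zero => omega
  | succ j ih =>
    have h1 := I.A_lt_succ j hj
    rcases (Nat.lt_succ_iff.1 hij).eq_or_lt with rfl | h
    · exact h1
    · exact (ih h (by omega)).trans h1

theorem A_sorted : I.A.Pairwise (· < ·) := by
  rw [List.pairwise_iff_getElem]
  intro i j hi hj hij
  have := I.A_lt i j hij (by rw [← I.length_A]; exact hj)
  rwa [List.getD_eq_getElem _ _ hi, List.getD_eq_getElem _ _ hj] at this

theorem mem_A_of_mem_D (d : ℕ) (hd : d ∈ I.D) : (d : ℤ) ∈ I.A := by
  rw [I.A_eq]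
  refine mem_discretized _ ?_ _ (List.mem_map_of_mem hd)
  rw [List.pairwise_map]
  exact I.D_sorted.imp fun h => by exact_mod_cast h

theorem step_spec (i : ℕ) (hi : i < I.D.length) :
    (I.step i).2.2 = I.D.countP (fun d : ℕ => decide ((d : ℤ) = I.A.getD i 0)) ∧
    targetCount I.T (2 * I.A.getD i 0) =
      (I.step i).2.1.toNat + targetCount I.T (2 * I.A.getD i 0 + 1) ∧
    (i = 0 → (I.step i).1 + targetCount I.T (2 * I.A.getD i 0) = I.D.length) ∧
    ∀ j, i = j + 1 → (I.step i).1 + targetCount I.T (2 * I.A.getD i 0) =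
      targetCount I.T (2 * I.A.getD j 0 + 1) := by
  have := pmSteps_spec I.A I.T I.D I.A_sorted I.T_sorted I.D_sorted I.mem_A_of_mem_D i
    (by rw [I.length_A]; exact hi)
  rwa [I.T_length] at this

/-- The number of targets above all sums of matched pairs. -/
def excess : ℕ := if I.D.length = 0 then 0 else
  targetCount I.T (2 * I.A.getD (I.D.length - 1) 0 + 1)

/-- Induction from the right, `m` being the number of remaining steps. Their slots hold the old
targets above the last treated value, apart from the excess ones, and one target for each of their
extra positions. -/
theorem slotTargets_proper (m : ℕ) (hm : m < I.D.length) :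
    slotTargets I.step I.D.length (2 * gapStart (extraCount I.step) (I.D.length - m)) + m +
      I.excess = targetCount I.T (2 * I.A.getD (I.D.length - m - 1) 0 + 1) +
        (gapStart (extraCount I.step) I.D.length -
          gapStart (extraCount I.step) (I.D.length - m)) := by
  induction m with
  | zero =>
    rw [Nat.sub_zero, slotTargets_top, excess, if_neg (by omega)]
    omega
  | succ m ih =>
    have h1 := ih (by omega)
    obtain ⟨-, h2, -, h3⟩ := I.step_spec (I.D.length - m - 1) (by omega)
    have h4 := h3 (I.D.length - (m + 1) - 1) (by omega)
    have h5 := slotTargets_block (st := I.step) (n := I.D.length) (i := I.D.length - (m + 1))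
      (r := 0) (by omega) (by omega)
    have h6 := gapStart_succ (extraCount I.step) (I.D.length - (m + 1))
    rw [show I.D.length - (m + 1) + 1 = I.D.length - m by omega] at h5 h6
    rw [(count_stepSlots_drop _).1] at h5
    rw [show I.D.length - m - 1 = I.D.length - (m + 1) by omega] at h2 h4 h1
    have h7 := (gapStart_strictMono (extraCount I.step)).monotone
      (show I.D.length - m ≤ I.D.length by omega)
    simp only [properPos, extraCount, add_zero] at h5 h6 h7 ⊢
    omega

/-- Each extra position adds one target and one position, so the `n` old targets without the excess
give `N` minus the excess in total. Domination needs exactly `N` targets, and this is what detects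
an excess. -/
theorem slotTargets_zero : slotTargets I.step I.D.length 0 + I.excess =
    gapStart (extraCount I.step) I.D.length := by
  by_cases h0 : I.D.length = 0
  · simp [excess, h0, slotTargets, allSlots, gapStart]
  · have h1 := I.slotTargets_proper (I.D.length - 1) (by omega)
    rw [show I.D.length - (I.D.length - 1) = 0 + 1 by omega] at h1
    obtain ⟨-, h2, h3, -⟩ := I.step_spec 0 (by omega)
    have h4 := h3 rfl
    have h5 := slotTargets_block (st := I.step) (n := I.D.length) (i := 0)
      (r := 0) (by omega) (by omega)
    rw [(count_stepSlots_drop _).1] at h5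
    have h6 := gapStart_succ (extraCount I.step) 0
    have h7 := (gapStart_strictMono (extraCount I.step)).monotone
      (show 0 + 1 ≤ I.D.length by omega)
    have h8 : gapStart (extraCount I.step) 0 = 0 := rfl
    simp only [properPos, extraCount, h8, mul_zero, add_zero, zero_add, Nat.sub_self] at *
    omega

/-- The index in `A` of each entry of `D`. -/
theorem exists_index : ∃ δ : ℕ → ℕ, ∀ j < I.D.length, δ j < I.D.length ∧
    I.A.getD (δ j) 0 = I.D.getD j 0 := by
  have : ∀ j, ∃ i, j < I.D.length → i < I.D.length ∧ I.A.getD i 0 = I.D.getD j 0 := by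
    intro j
    by_cases hj : j < I.D.length
    · obtain ⟨i, hi, h⟩ := List.getElem_of_mem (I.mem_A_of_mem_D _ (List.get_mem I.D ⟨j, hj⟩))
      refine ⟨i, fun _ => ⟨by rwa [← I.length_A], ?_⟩⟩
      rw [List.getD_eq_getElem _ _ hi, h, I.getD_D j hj]
    · exact ⟨0, fun h => absurd h hj⟩
  choose δ hδ using this
  exact ⟨δ, hδ⟩

variable {I}

/-- Since `A` is strictly increasing, the condition `a ≤ d` becomes a comparison of indices. -/
theorem index_le {δ : ℕ → ℕ} (hδ : ∀ j < I.D.length, δ j < I.D.length ∧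
    I.A.getD (δ j) 0 = I.D.getD j 0) {i j : ℕ} (hi : i < I.D.length) (hj : j < I.D.length) :
    i ≤ δ j ↔ I.A.getD i 0 ≤ I.D.getD j 0 := by
  obtain ⟨h1, h2⟩ := hδ j hj
  rw [← h2]
  constructor
  · intro h
    rcases h.eq_or_lt with h | h
    · rw [h]
    · exact (I.A_lt i (δ j) h h1).le
  · intro h
    by_contra hlt
    have := I.A_lt (δ j) i (by omega) hi
    omega

/-- The structural facts come from the minimum in the definition of `A`, the counts from
`slotTargets_proper`. Without excess no old target is lost, so the slot counts match the target
counts exactly. -/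
theorem gapFilling {δ : ℕ → ℕ} (hδ : ∀ j < I.D.length, δ j < I.D.length ∧
    I.A.getD (δ j) 0 = I.D.getD j 0) (hex : I.excess = 0) :
    GapFilling I.D.length (extraCount I.step) δ (fun i => I.A.getD i 0) (targetCount I.T)
      (slotTargets I.step I.D.length) := by
  -- The minimum defining `aᵢ` is either `aᵢ₊₁ - 1`, so there is no gap, or `dᵢ`. In the second case
  -- the deadlines up to index `i` are at most `aᵢ`, which is a cut.
  have hcut : ∀ i, i + 1 < I.D.length → (∀ j ≤ i, δ j ≤ i) ∨
      I.A.getD (i + 1) 0 = I.A.getD i 0 + 1 := by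
    intro i hi
    have h1 := I.entryA_succ ⟨i, by omega⟩ ⟨i + 1, hi⟩ rfl
    rw [← I.getD_A, ← I.getD_A] at h1
    rcases min_choice (I.A.getD (i + 1) 0 - 1) ((I.D.get ⟨i, by omega⟩ : ℕ) : ℤ) with h2 | h2
    · right; omega
    · left
      intro j hj
      by_contra hlt
      have h3 := (index_le hδ (i := i + 1) (j := j) hi (by omega)).1 (by omega)
      have h4 := I.get_D_mono (i := ⟨j, by omega⟩) (j := ⟨i, by omega⟩) hj
      rw [I.getD_D j (by omega)] at h3
      have h5 := I.A_lt_succ i hi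
      omega
  -- Between `2aᵢ` and `2aᵢ + 2` there is just one integer, hence at most one target, and one target
  -- in a gap requires no extra position.
  have hsucc : ∀ i, i + 1 < I.D.length → I.A.getD (i + 1) 0 = I.A.getD i 0 + 1 →
      extraCount I.step (i + 1) = 0 := by
    intro i hi h
    obtain ⟨-, -, -, h1⟩ := I.step_spec (i + 1) hi
    have h2 := h1 i rfl
    rw [h] at h2
    have h3 : targetCount I.T (2 * I.A.getD i 0 + 1) ≤
        targetCount I.T (2 * (I.A.getD i 0 + 1)) + 1 := by
      have hnodup : I.T.Nodup := I.T_sorted.imp fun h => h.ne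
      have h4 : I.T.countP (fun t : ℕ => decide ((t : ℤ) = 2 * I.A.getD i 0 + 1)) ≤ 1 := by
        refine le_trans (List.countP_mono_left (q := fun t =>
          t == (2 * I.A.getD i 0 + 1).toNat) ?_) (List.nodup_iff_count_le_one.1 hnodup _)
        intro t _ ht
        simp only [decide_eq_true_eq] at ht
        simp only [beq_iff_eq, ← ht, Int.toNat_natCast]
      have h5 := List.length_eq_countP_add_countP
        (fun t : ℕ => decide ((t : ℤ) = 2 * I.A.getD i 0 + 1))
        (l := I.T.filter fun t : ℕ => decide (2 * I.A.getD i 0 + 1 ≤ (t : ℤ)))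
      rw [← List.countP_eq_length_filter, List.countP_filter, List.countP_filter] at h5
      change targetCount _ _ = _ at h5
      rw [h5, add_comm]
      refine add_le_add (List.countP_mono_left fun t _ ht => ?_)
        (le_trans (List.countP_mono_left fun t _ ht => ?_) h4)
      · simp only [Bool.and_eq_true, decide_eq_true_eq] at ht ⊢
        omega
      · simp only [Bool.and_eq_true, decide_eq_true_eq] at ht ⊢
        omega
    rw [extraCount]
    omega
  have hhigh : ∀ i < I.D.length,
      slotTargets I.step I.D.length (2 * properPos (extraCount I.step) i + 2) +
        (I.D.length - (i + 1)) = targetCount I.T (2 * I.A.getD i 0 + 1) +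
        (gapStart (extraCount I.step) I.D.length - gapStart (extraCount I.step) (i + 1)) := by
    intro i hi
    have h1 := I.slotTargets_proper (I.D.length - (i + 1)) (by omega)
    rw [show I.D.length - (I.D.length - (i + 1)) = i + 1 by omega, hex, add_zero,
      Nat.add_sub_cancel, gapStart_succ, mul_add, mul_one] at h1
    rw [h1, gapStart_succ]
  refine ⟨fun j hj => ?_, fun j hj => (hδ j hj).1, I.A_lt, targetCount_antitone _, fun y => ?_,
    slotTargets_antitone, ?_, slotTargets_top, fun i hi => ?_, hhigh, fun i hi r hr => ?_, ?_, ?_⟩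
  · rw [index_le hδ hj hj, I.getD_A j hj, I.getD_D j hj]
    exact I.entryA_le _
  · rw [← I.T_length]
    exact List.countP_le_length
  · have := I.slotTargets_zero; omega
  · have h1 := hhigh i hi
    have h2 := slotTargets_block (st := I.step) (n := I.D.length) (i := i)
      (r := 2 * extraCount I.step i + 1) hi (by omega)
    have h3 := (I.step_spec i hi).2.1
    have h4 := (count_stepSlots_drop (I.step i)).2
    rw [extraCount, h4, gapStart_succ] at h2
    rw [show 2 * properPos (extraCount I.step) i + 1 = 2 * gapStart (extraCount I.step) i +
      (2 * ((I.step i).1 - 1) + 1) by simp only [properPos, extraCount]; ring, h2]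
    rw [mul_add, mul_one]
    omega
  · have hblock : ∀ r, r ≤ 2 * extraCount I.step i + 1 → _ := fun r hr =>
      slotTargets_block (st := I.step) (n := I.D.length) (i := i) (r := r) hi (by omega)
    have hcount : ∀ r, r ≤ 2 * extraCount I.step i + 1 → _ := fun r hr' =>
      count_stepSlots_gap (I.step i) (r := r) hr' (by
        simp only [extraCount] at hr; omega)
    have e0 := hblock (2 * r) (by omega)
    have e1 := hblock (2 * r + 1) (by omega)
    have e2 := hblock (2 * r + 2) (by omega)
    rw [hcount _ (by omega)] at e0 e1 e2
    simp only [← add_assoc, ← mul_add] at e0 e1 e2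
    rw [e0, e1, e2]
    simp only [extraCount] at hr ⊢
    omega
  · intro i hi hK j hj
    obtain ⟨i, rfl⟩ : ∃ i', i = i' + 1 := ⟨i - 1, by omega⟩
    rcases hcut i hi with h | h
    · have := h j (by omega); omega
    · rw [hsucc i hi h] at hK; omega
  · intro i hi
    rcases hcut i hi with h | h
    · exact Or.inl h
    · exact Or.inr ⟨h, hsucc i hi h⟩

/-- The word prints the position of `aᵢ` once for each deadline equal to `aᵢ`; grouping the indices
`j` by the value of `δ j` gives the same multiset. -/
theorem emitted_deadlines_eq {δ : ℕ → ℕ} (hδ : ∀ j < I.D.length, δ j < I.D.length ∧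
    I.A.getD (δ j) 0 = I.D.getD j 0) (x : ℕ) :
    (emitted x ((List.range I.D.length).flatMap fun i => stepDeadlines (I.step i)) : Multiset ℕ) =
      Finset.univ.val.map fun p : Fin (gapStart (extraCount I.step) I.D.length) =>
        x + 1 + extendPos (extraCount I.step) δ p := by
  rw [Multiset.map_eq_sum_singleton, ← Finset.sum_range (fun p =>
    ({x + 1 + extendPos (extraCount I.step) δ p} : Multiset ℕ)), sum_range_gapStart,
    emitted_stepDeadlines, Finset.sum_add_distrib, Finset.sum_add_distrib]
  congr 1
  · refine Finset.sum_congr rfl fun i _ => Finset.sum_congr rfl fun r hr => ?_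
    rw [extendPos_of_notMem _ _ (notMem_range_properPos _ i r (Finset.mem_range.1 hr))]
  · simp only [extendPos_properPos]
    conv_rhs => rw [← Finset.sum_fiberwise_of_maps_to (s := Finset.range I.D.length)
      (t := Finset.range I.D.length) (g := δ)
      (fun j hj => Finset.mem_range.2 (hδ j (Finset.mem_range.1 hj)).1)]
    refine Finset.sum_congr rfl fun i hi => ?_
    rw [Finset.mem_range] at hi
    rw [Finset.sum_congr (s₁ := (Finset.range I.D.length).filter fun j => δ j = i) rfl
      (g := fun _ => {x + 1 + properPos (extraCount I.step) i})
      (fun j hj => by rw [(Finset.mem_filter.1 hj).2]), Finset.sum_const, (I.step_spec i hi).1,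
      List.countP_eq_card_filter_range I.D (fun d => (d : ℤ) = I.A.getD i 0)]
    congr 2
    ext j
    simp only [Finset.mem_filter, Finset.mem_range]
    refine and_congr_right fun hj => ?_
    obtain ⟨h1, h2⟩ := hδ j hj
    rw [← h2]
    constructor
    · intro h
      rcases lt_trichotomy (δ j) i with h3 | h3 | h3
      · have := I.A_lt _ _ h3 hi; omega
      · exact h3
      · have := I.A_lt _ _ h3 h1; omega
    · rintro rfl; rfl

theorem solvable_iff_index {δ : ℕ → ℕ} (hδ : ∀ j < I.D.length, δ j < I.D.length ∧
    I.A.getD (δ j) 0 = I.D.getD j 0) :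
    I.Solvable ↔ ∃ α : Equiv.Perm (Fin I.D.length), (∀ j, (α j : ℕ) ≤ δ j) ∧
      ∀ y : ℤ, targetCount I.T y ≤ (Finset.univ.filter fun j : Fin I.D.length =>
        y ≤ I.A.getD (δ j) 0 + I.A.getD (α j) 0).card := by
  rw [I.solvable_iff]
  refine exists_congr fun α => and_congr (forall_congr' fun j => ?_) (forall_congr' fun y => ?_)
  · rw [index_le hδ (α j).2 j.2, I.getD_A _ (α j).2, I.getD_D _ j.2]
  · rw [targetCount]
    have : ∀ j : Fin I.D.length, I.A.getD (δ j) 0 + I.A.getD (α j) 0 =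
        (I.D.get j : ℤ) + I.entryA (α j) := by
      intro j
      rw [(hδ j j.2).2, I.getD_D _ j.2, I.getD_A _ (α j).2]
    simp only [this]

/-- Since `aₙ = dₙ` is the maximum of both `A` and `D`, no sum exceeds `2aₙ`. -/
theorem not_solvable_of_excess (hex : I.excess ≠ 0) : ¬ I.Solvable := by
  intro hs
  rw [I.solvable_iff] at hs
  obtain ⟨α, -, h⟩ := hs
  rw [excess] at hex
  split_ifs at hex with h0
  · exact hex rfl
  have h1 := h (2 * I.A.getD (I.D.length - 1) 0 + 1)
  refine hex (Nat.le_zero.1 (h1.trans (le_of_eq ?_)))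
  rw [Finset.card_eq_zero, Finset.filter_eq_empty_iff]
  intro i _
  set e : Fin I.D.length := ⟨I.D.length - 1, by omega⟩ with he
  have h2 := I.entryA_last e (by simp [he]; omega)
  have h3 := I.get_D_mono (i := i) (j := e) (by rw [Fin.le_def, he]; simp only; omega)
  have h4 : I.entryA (α i) ≤ I.entryA e := by
    rw [← I.getD_A _ (α i).2, ← I.getD_A _ e.2]
    rcases (show (α i : ℕ) ≤ e by rw [he]; simp only; omega).eq_or_lt with h | h
    · exact (congrArg (fun x => I.A.getD x 0) h).le
    · exact (I.A_lt _ _ h e.2).le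
  rw [I.getD_A (I.D.length - 1) (by omega)]
  change ¬ (2 * I.entryA e + 1 ≤ _)
  omega

variable (I)

/-- The constructed list is an instance of the block form with `k = n = N`, where position `p` is
placed at `2N + 1 + p`. A sum of positions is then shifted by `4N + 2`, and the value `4N + 1 + s`
corresponds to slot `s`. Without excess, `GapFilling.solvable_iff` translates the matchings; with
excess both sides fail. -/
theorem solvable_iff_reduction : I.Solvable ↔ TwoVisitsFeasible (reduction I).1 := by
  classical
  obtain ⟨δ, hδ⟩ := I.exists_index
  set n := I.D.length with hn
  set K := extraCount I.step with hK
  set N := gapStart K n with hN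
  have hsize : stepsSize (pmSteps I.A I.T I.D) = N := by
    rw [I.pmSteps_eq, stepsSize, List.map_map, hN, gapStart, Finset.sum_range, ← List.sum_ofFn,
      List.ofFn_eq_map, ← List.map_coe_finRange_eq_range, List.map_map]
    rfl
  -- The values from `3N + 1` to `4N` lie below every sum and are all put into `L`; the `2N` slots
  -- proper occupy `4N + 1` to `6N`.
  set slots := List.replicate N true ++ allSlots I.step n with hslots
  have hlen : slots.length = N + 2 * N := by
    rw [hslots, List.length_append, length_allSlots, List.length_replicate]
  have hred : (reduction I).1 = (List.range N).map (fun s => 2 * s + 1) ++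
      emitted (2 * N) ((List.range n).flatMap fun i => stepDeadlines (I.step i)) ++
        emitted (3 * N) (slotWord slots) := by
    change emitted 0 (reductionWord _) = _
    rw [reductionWord, hsize, emitted_append, emitted_append, emitted_replicate_triple]
    have h1 : ((List.replicate N [false, true, false]).flatten).count false = 2 * N := by
      simp [List.count_flatten, mul_comm]
    have h2 : (pmSteps I.A I.T I.D).flatMap stepDeadlines =
        (List.range n).flatMap fun i => stepDeadlines (I.step i) := by
      rw [I.pmSteps_eq, List.flatMap_map]
    have h3 : (pmSteps I.A I.T I.D).flatMap (fun s => slotWord (stepSlots s)) =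
        slotWord (allSlots I.step n) := by
      rw [I.pmSteps_eq, List.flatMap_map, allSlots, slotWord, List.flatMap_assoc]
      rfl
    rw [List.count_append, h1, h2, count_stepDeadlines_range, h3, ← slotWord_replicate_true,
      ← slotWord_append, zero_add, zero_add, ← hslots]
    congr 2
    change 2 * N + N = 3 * N
    omega
  have hcard : ∀ m, ((Finset.Icc (2 * N + N + 1) (4 * N + 2 * N) \
      (emitted (3 * N) (slotWord slots)).toFinset).filter fun t => 3 * N + 1 + m ≤ t).card =
        (slots.drop m).count false := by
    intro m
    have := card_unmarked_slots (3 * N) slots m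
    rw [hlen] at this
    rw [← this]
    congr 4 <;> omega
  have hdrop : ∀ m, (slots.drop (N + m)).count false = slotTargets I.step n m := by
    intro m
    rw [hslots, ← List.drop_drop, List.drop_left' (by simp), slotTargets]
  have hcount0 : slots.count false = slotTargets I.step n 0 := by
    rw [hslots, List.count_append, slotTargets, List.drop_zero]
    simp [List.count_replicate]
  have hLsub : (emitted (3 * N) (slotWord slots)).toFinset ⊆
      Finset.Icc (2 * N + N + 1) (4 * N + 2 * N) := by
    intro y hy
    have := mem_emitted_slotWord (List.mem_toFinset.1 hy)
    rw [Finset.mem_Icc]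
    omega
  -- There are `3N` slots, of which `N` minus the excess are unmarked.
  have hLcard : (emitted (3 * N) (slotWord slots)).toFinset.card = 2 * N + I.excess := by
    have h1 := hcard 0
    rw [List.drop_zero, hcount0, Finset.filter_true_of_mem, Finset.card_sdiff_of_subset hLsub,
      Nat.card_Icc] at h1
    · have h2 : slotTargets I.step n 0 + I.excess = N := I.slotTargets_zero
      have h3 := Finset.card_le_card hLsub
      rw [Nat.card_Icc] at h3
      omega
    · intro t ht
      have := Finset.mem_Icc.1 (Finset.mem_sdiff.1 ht).1
      omega
  rw [hred, twoVisitsFeasible_append_iff N _ _ _ _ rfl (emitted_deadlines_eq hδ (2 * N))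
    (emitted_slotWord_nodup _ _)]
  have hδle : ∀ j < n, j ≤ δ j := fun j hj => by
    rw [index_le hδ hj hj, I.getD_A j hj, I.getD_D j hj]
    exact I.entryA_le _
  have hple : ∀ p : Fin N, (p : ℕ) ≤ extendPos K δ p := fun p => le_extendPos hδle p.2
  have hplt : ∀ p : Fin N, extendPos K δ p < N := fun p =>
    extendPos_lt (fun j hj => (hδ j hj).1) p.2
  have hX := visitFeasible_blockDeadlines_iff (a := fun p : Fin N => 2 * N + 1 + (p : ℕ))
    (d := fun p : Fin N => 2 * N + 1 + extendPos K δ p)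
    (Fintype.card_fin N) (fun p q h => Fin.ext (by simp only at h; omega))
    (fun p => ⟨by omega, by have := p.2; omega⟩) (fun p => by have := hple p; omega)
    (fun p => by have := hplt p; omega) hLsub (by omega)
  rw [hX]
  by_cases hex : I.excess = 0
  · have hg := gapFilling hδ hex
    rw [solvable_iff_index hδ, hg.solvable_iff, and_iff_right (by omega)]
    refine exists_congr fun α => and_congr (forall_congr' fun p => ?_) ?_
    · exact (Nat.add_le_add_iff_left (n := 2 * N + 1)).symm
    have hset : ∀ s, (Finset.univ.filter fun p : Fin N => s ≤ extendPos K δ p + α p + 1) =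
        Finset.univ.filter fun p : Fin N =>
          3 * N + 1 + (N + s) ≤ 2 * N + 1 + extendPos K δ p + (2 * N + 1 + (α p : ℕ)) := by
      intro s
      ext p
      simp only [Finset.mem_filter, Finset.mem_univ, true_and]
      omega
    constructor
    · intro h y
      -- All sums are at least `4N + 2`, so thresholds up to `4N` count all `N` positions on the
      -- right, against `N` targets in total.
      by_cases hy : 4 * N + 1 ≤ y
      · obtain ⟨s, rfl⟩ : ∃ s, y = 3 * N + 1 + (N + s) := ⟨y - (4 * N + 1), by omega⟩
        rw [hcard, hdrop, ← hset]
        exact h s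
      · rw [Finset.filter_true_of_mem (s := Finset.univ) (by intro p _; omega)]
        refine (Finset.card_filter_le _ _).trans ?_
        rw [Finset.card_sdiff_of_subset hLsub, hLcard, Nat.card_Icc, Finset.card_univ,
          Fintype.card_fin]
        omega
    · intro h s
      have := h (3 * N + 1 + (N + s))
      rw [hcard, hdrop, ← hset] at this
      exact this
  · refine iff_of_false (not_solvable_of_excess hex) fun hf => ?_
    have := hf.1
    omega

end PMInstance

/-! ### A structured language for stack machines -/

/-- Basic operations of a stack machine with stacks `K`, alphabet `Γ` and registers `σ`. -/
inductive StackOp (K Γ σ : Type)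
  | push (k : K) (f : σ → Γ)
  | pop (k : K) (f : σ → Option Γ → σ)
  | peek (k : K) (f : σ → Option Γ → σ)
  | load (f : σ → σ)

/-- Structured programs: blocks of basic operations, sequences, conditionals and loops. -/
inductive StackProg (K Γ σ : Type)
  | basic (ops : List (StackOp K Γ σ))
  | seq (p q : StackProg K Γ σ)
  | ite (c : σ → Bool) (p q : StackProg K Γ σ)
  | loop (c : σ → Bool) (p : StackProg K Γ σ)

section Semantics

variable {K Γ σ : Type} [DecidableEq K]

/-- The effect of a basic operation on the registers and the stacks. -/
def StackOp.run : StackOp K Γ σ → σ × (K → List Γ) → σ × (K → List Γ)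
  | push k f, (v, S) => (v, Function.update S k (f v :: S k))
  | pop k f, (v, S) => (f v (S k).head?, Function.update S k (S k).tail)
  | peek k f, (v, S) => (f v (S k).head?, S)
  | load f, (v, S) => (f v, S)

/-- `Runs p s s' n`: the program `p`, started in `s`, ends in `s'` after `n` steps. -/
inductive StackProg.Runs : StackProg K Γ σ → σ × (K → List Γ) → σ × (K → List Γ) → ℕ → Prop
  | basic (ops : List (StackOp K Γ σ)) (s : σ × (K → List Γ)) :
      Runs (.basic ops) s (ops.foldl (fun s o => o.run s) s) 1
  | seq {p q : StackProg K Γ σ} {s s' s'' : σ × (K → List Γ)} {m n : ℕ} :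
      Runs p s s' m → Runs q s' s'' n → Runs (.seq p q) s s'' (m + n)
  | ite_true {c : σ → Bool} {p q : StackProg K Γ σ} {s s' : σ × (K → List Γ)} {n : ℕ} :
      c s.1 = true → Runs p s s' n → Runs (.ite c p q) s s' (n + 1)
  | ite_false {c : σ → Bool} {p q : StackProg K Γ σ} {s s' : σ × (K → List Γ)} {n : ℕ} :
      c s.1 = false → Runs q s s' n → Runs (.ite c p q) s s' (n + 1)
  | loop_true {c : σ → Bool} {p : StackProg K Γ σ} {s s' s'' : σ × (K → List Γ)} {m n : ℕ} :
      c s.1 = true → Runs p s s' m → Runs (.loop c p) s' s'' n →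
        Runs (.loop c p) s s'' (m + n + 1)
  | loop_false {c : σ → Bool} {p : StackProg K Γ σ} {s : σ × (K → List Γ)} :
      c s.1 = false → Runs (.loop c p) s s 1

end Semantics

/-! ### Compilation -/

section Compile

variable {K Γ σ : Type}

/-- The program points of a structured program. -/
def StackProg.Point : StackProg K Γ σ → Type
  | basic _ => Unit
  | seq p q => p.Point ⊕ q.Point
  | ite _ p q => Option (p.Point ⊕ q.Point)
  | loop _ p => Option p.Point

/-- The first program point. -/
def StackProg.entry : (p : StackProg K Γ σ) → p.Point
  | basic _ => ()
  | seq p _ => Sum.inl p.entry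
  | ite _ _ _ => none
  | loop _ _ => none

theorem StackProg.finite_point (p : StackProg K Γ σ) : Finite p.Point := by
  induction p with
  | basic _ => exact inferInstanceAs (Finite Unit)
  | seq p q hp hq => exact inferInstanceAs (Finite (p.Point ⊕ q.Point))
  | ite _ p q hp hq => exact inferInstanceAs (Finite (Option (p.Point ⊕ q.Point)))
  | loop _ p hp => exact inferInstanceAs (Finite (Option p.Point))

/-- A basic operation as a statement of a stack machine. -/
def StackOp.stmt {Λ : Type} (o : StackOp K Γ σ) (q : Turing.TM2.Stmt (fun _ : K => Γ) Λ σ) :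
    Turing.TM2.Stmt (fun _ : K => Γ) Λ σ :=
  match o with
  | push k f => .push k f q
  | pop k f => .pop k f q
  | peek k f => .peek k f q
  | load f => .load f q

/-- The statement at each program point, where `emb` gives the labels of the program points and
`next` is the label to continue with. -/
def StackProg.code {Λ : Type} : (p : StackProg K Γ σ) → (p.Point → Λ) → Λ → p.Point →
    Turing.TM2.Stmt (fun _ : K => Γ) Λ σ
  | basic ops, _, next, _ => ops.foldr (fun o q => o.stmt q) (.goto fun _ => next)
  | seq p q, emb, _, Sum.inl x => p.code (fun y => emb (Sum.inl y)) (emb (Sum.inr q.entry)) x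
  | seq _ q, emb, next, Sum.inr x => q.code (fun y => emb (Sum.inr y)) next x
  | ite c p q, emb, _, none =>
      .branch c (.goto fun _ => emb (some (Sum.inl p.entry)))
        (.goto fun _ => emb (some (Sum.inr q.entry)))
  | ite _ p _, emb, next, some (Sum.inl x) => p.code (fun y => emb (some (Sum.inl y))) next x
  | ite _ _ q, emb, next, some (Sum.inr x) => q.code (fun y => emb (some (Sum.inr y))) next x
  | loop c p, emb, next, none =>
      .branch c (.goto fun _ => emb (some p.entry)) (.goto fun _ => next)
  | loop _ p, emb, _, some x => p.code (fun y => emb (some y)) (emb none) x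

variable [DecidableEq K]

theorem stepAux_foldr_stmt {Λ : Type} (ops : List (StackOp K Γ σ))
    (q : Turing.TM2.Stmt (fun _ : K => Γ) Λ σ) (s : σ × (K → List Γ)) :
    Turing.TM2.stepAux (ops.foldr (fun o q => o.stmt q) q) s.1 s.2 =
      Turing.TM2.stepAux q (ops.foldl (fun s o => o.run s) s).1
        (ops.foldl (fun s o => o.run s) s).2 := by
  induction ops generalizing s with
  | nil => rfl
  | cons o ops ih =>
    rw [List.foldl_cons, ← ih]
    cases o <;> rfl

/-- Iterated steps of a machine that contains the code of a program. -/
theorem StackProg.Runs.iterate {p : StackProg K Γ σ} {s s' : σ × (K → List Γ)} {n : ℕ}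
    (h : p.Runs s s' n) {Λ : Type} (M : Λ → Turing.TM2.Stmt (fun _ : K => Γ) Λ σ)
    (emb : p.Point → Λ) (next : Λ) (hM : ∀ x, M (emb x) = p.code emb next x) :
    (flip bind (Turing.TM2.step M))^[n] (some ⟨some (emb p.entry), s.1, s.2⟩) =
      some ⟨some next, s'.1, s'.2⟩ := by
  induction h generalizing Λ with
  | basic ops s =>
    have h1 := stepAux_foldr_stmt ops (.goto fun _ => next) s
    change some (Turing.TM2.stepAux (M _) s.1 s.2) = _
    rw [hM]
    change some (Turing.TM2.stepAux (ops.foldr (fun o q => o.stmt q) (.goto fun _ => next))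
      s.1 s.2) = _
    rw [h1]
    rfl
  | @seq p q s s' s'' m n _ _ ihp ihq =>
    rw [Nat.add_comm, Function.iterate_add_apply]
    have h1 := ihp M (fun y => emb (Sum.inl y)) (emb (Sum.inr q.entry)) fun x => hM (Sum.inl x)
    have h2 := ihq M (fun y => emb (Sum.inr y)) next fun x => hM (Sum.inr x)
    exact (congrArg _ h1).trans h2
  | @ite_true c p q s s' n hc _ ih =>
    rw [Function.iterate_succ_apply]
    have h1 := ih M (fun y => emb (some (Sum.inl y))) next fun x => hM (some (Sum.inl x))
    refine Eq.trans (congrArg _ ?_) h1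
    refine congrArg some ((congrArg (fun q => Turing.TM2.stepAux q s.1 s.2) (hM none)).trans ?_)
    change cond (c s.1) _ _ = _
    rw [hc]
    rfl
  | @ite_false c p q s s' n hc _ ih =>
    rw [Function.iterate_succ_apply]
    have h1 := ih M (fun y => emb (some (Sum.inr y))) next fun x => hM (some (Sum.inr x))
    refine Eq.trans (congrArg _ ?_) h1
    refine congrArg some ((congrArg (fun q => Turing.TM2.stepAux q s.1 s.2) (hM none)).trans ?_)
    change cond (c s.1) _ _ = _
    rw [hc]
    rfl
  | @loop_true c p s s' s'' m n hc _ _ ihp ihl =>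
    rw [Function.iterate_succ_apply, Nat.add_comm m n, Function.iterate_add_apply]
    have h1 := ihp M (fun y => emb (some y)) (emb none) fun x => hM (some x)
    have h2 := ihl M emb next hM
    refine Eq.trans (congrArg _ (Eq.trans (congrArg _ ?_) h1)) h2
    refine congrArg some ((congrArg (fun q => Turing.TM2.stepAux q s.1 s.2) (hM none)).trans ?_)
    change cond (c s.1) _ _ = _
    rw [hc]
    rfl
  | @loop_false c p s hc =>
    refine congrArg some ((congrArg (fun q => Turing.TM2.stepAux q s.1 s.2) (hM none)).trans ?_)
    change cond (c s.1) _ _ = _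
    rw [hc]
    rfl

/-- The Turing machine that runs a structured program and halts. -/
noncomputable def StackProg.machine [Fintype K] [Fintype Γ] [Fintype σ] (p : StackProg K Γ σ)
    (k₀ k₁ : K) (v₀ : σ) : Turing.FinTM2 :=
  { K := K
    k₀ := k₀
    k₁ := k₁
    Γ := fun _ => Γ
    Λ := Option p.Point
    main := some p.entry
    ΛFin := @instFintypeOption _ (@Fintype.ofFinite _ p.finite_point)
    σ := σ
    initialState := v₀
    Γk₀Fin := ‹Fintype Γ›
    m := fun l => l.elim .halt (p.code some none) }

/-- A program whose runs compute `f` within polynomial time gives a polynomial-time machine. -/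
theorem StackProg.computableInPolyTime [Fintype K] [Fintype Γ] [Fintype σ]
    (p : StackProg K Γ σ) (k₀ k₁ : K) (v₀ : σ) {α β : Type} (ea : α → List Γ) (eb : β → List Γ)
    (f : α → β) (time : Polynomial ℕ)
    (h : ∀ x, ∃ n ≤ time.eval (ea x).length, p.Runs
      (v₀, fun k => if k = k₀ then ea x else []) (v₀, fun k => if k = k₁ then eb (f x) else []) n) :
    Nonempty (Turing.TM2ComputableInPolyTime ea eb f) := by
  refine ⟨{
    tm := p.machine k₀ k₁ v₀
    inputAlphabet := Equiv.refl _
    outputAlphabet := Equiv.refl _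
    time := time + 1
    outputsFun := fun x => Classical.choice ?_ }⟩
  obtain ⟨n, hn, hrun⟩ := h x
  refine ⟨⟨⟨n + 1, ?_⟩, ?_⟩⟩
  · have h1 := hrun.iterate (p.machine k₀ k₁ v₀).m some none fun _ => rfl
    have h2 : Turing.initList (p.machine k₀ k₁ v₀) ((ea x).map (Equiv.refl Γ).invFun) =
        (⟨some (some p.entry), v₀, fun k : K => if k = k₀ then ea x else []⟩ :
          Turing.TM2.Cfg (fun _ : K => Γ) (Option p.Point) σ) := by
      refine (congrArg (Turing.initList (p.machine k₀ k₁ v₀)) (List.map_id (ea x))).trans ?_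
      refine congrArg (Turing.TM2.Cfg.mk _ _) (funext fun k : K => ?_)
      by_cases hk : k = k₀
      · subst hk
        exact (dif_pos rfl).trans (if_pos rfl).symm
      · exact (dif_neg hk).trans (if_neg hk).symm
    have h3 : Turing.haltList (p.machine k₀ k₁ v₀) ((eb (f x)).map (Equiv.refl Γ).invFun) =
        (⟨none, v₀, fun k : K => if k = k₁ then eb (f x) else []⟩ :
          Turing.TM2.Cfg (fun _ : K => Γ) (Option p.Point) σ) := by
      refine (congrArg (Turing.haltList (p.machine k₀ k₁ v₀)) (List.map_id (eb (f x)))).trans ?_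
      refine congrArg (Turing.TM2.Cfg.mk _ _) (funext fun k : K => ?_)
      by_cases hk : k = k₁
      · subst hk
        exact (dif_pos rfl).trans (if_pos rfl).symm
      · exact (dif_neg hk).trans (if_neg hk).symm
    -- One further step executes the `halt` statement at the exit label; this accounts for `time +
    -- 1`.
    have h4 := congrArg (flip bind (Turing.TM2.step (p.machine k₀ k₁ v₀).m)) h1
    rw [Function.iterate_succ_apply']
    refine Eq.trans ?_ (h4.trans ?_)
    · exact congrArg (fun c => flip bind (Turing.TM2.step (p.machine k₀ k₁ v₀).m)
        ((flip bind (Turing.TM2.step (p.machine k₀ k₁ v₀).m))^[n] (some c))) h2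
    · exact (congrArg some h3).symm
  · rw [Polynomial.eval_add, Polynomial.eval_one]
    exact Nat.succ_le_succ hn

end Compile

/-! ### The stacks and registers of the reduction program -/

/-- The stacks: input, output, reversed output or input, the three sequences `D`, `A`, `T`, two
scratch stacks, and the collected deadline word, slot word and step count. -/
inductive Stk
  | inp | out | rev | d | a | t | tx | ty | wd | wt | wn
  deriving DecidableEq

instance : Fintype Stk where
  elems := {.inp, .out, .rev, .d, .a, .t, .tx, .ty, .wd, .wt, .wn}
  complete k := by cases k <;> decide

/-- The contents of all stacks. -/
structure Stores where
  inp : List Γ' := []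
  out : List Γ' := []
  rev : List Γ' := []
  d : List Γ' := []
  a : List Γ' := []
  t : List Γ' := []
  tx : List Γ' := []
  ty : List Γ' := []
  wd : List Γ' := []
  wt : List Γ' := []
  wn : List Γ' := []

namespace Stores

/-- The contents of a stack. -/
def get (s : Stores) : Stk → List Γ'
  | .inp => s.inp
  | .out => s.out
  | .rev => s.rev
  | .d => s.d
  | .a => s.a
  | .t => s.t
  | .tx => s.tx
  | .ty => s.ty
  | .wd => s.wd
  | .wt => s.wt
  | .wn => s.wn

/-- Replace the contents of a stack. -/
def set (s : Stores) : Stk → List Γ' → Stores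
  | .inp, l => { s with inp := l }
  | .out, l => { s with out := l }
  | .rev, l => { s with rev := l }
  | .d, l => { s with d := l }
  | .a, l => { s with a := l }
  | .t, l => { s with t := l }
  | .tx, l => { s with tx := l }
  | .ty, l => { s with ty := l }
  | .wd, l => { s with wd := l }
  | .wt, l => { s with wt := l }
  | .wn, l => { s with wn := l }

theorem get_set (s : Stores) (k : Stk) (l : List Γ') : (s.set k l).get k = l := by
  cases k <;> rfl

theorem get_set_of_ne (s : Stores) {j k : Stk} (h : j ≠ k) (l : List Γ') :
    (s.set k l).get j = s.get j := by
  cases k <;> cases j <;> first | rfl | exact absurd rfl h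

theorem set_set (s : Stores) (k : Stk) (l m : List Γ') : (s.set k l).set k m = s.set k m := by
  cases k <;> rfl

theorem set_comm (s : Stores) {j k : Stk} (h : j ≠ k) (l m : List Γ') :
    (s.set j l).set k m = (s.set k m).set j l := by
  cases k <;> cases j <;> first | rfl | exact absurd rfl h

theorem set_get (s : Stores) (k : Stk) : s.set k (s.get k) = s := by
  cases k <;> rfl

theorem update_get (s : Stores) (k : Stk) (l : List Γ') :
    Function.update s.get k l = (s.set k l).get := by
  funext j
  by_cases h : j = k
  · subst h
    rw [Function.update_self, get_set]
  · rw [Function.update_of_ne h, get_set_of_ne s h]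

end Stores

/-- The outcome of a comparison; `lock` means that it can no longer change. -/
inductive CmpState
  | lt | eq | gt | lock
  deriving DecidableEq

instance : Fintype CmpState where
  elems := {.lt, .eq, .gt, .lock}
  complete c := by cases c <;> decide

/-- The registers: two symbols, the state of a comparison and two flags. -/
structure Regs where
  x : Option Γ' := none
  y : Option Γ' := none
  cmp : CmpState := .eq
  first : Bool := false
  cont : Bool := false

noncomputable instance : Fintype Regs :=
  Fintype.ofInjective (fun v => (v.x, v.y, v.cmp, v.first, v.cont)) fun v w h => by
    cases v
    cases w
    simpa using h

/-- Structured programs over the stacks and registers of the reduction. -/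
abbrev Prog := StackProg Stk Γ' Regs

/-- The effect of a basic operation. -/
def StackOp.exec : StackOp Stk Γ' Regs → Regs × Stores → Regs × Stores
  | push k f, (v, s) => (v, s.set k (f v :: s.get k))
  | pop k f, (v, s) => (f v (s.get k).head?, s.set k (s.get k).tail)
  | peek k f, (v, s) => (f v (s.get k).head?, s)
  | load f, (v, s) => (f v, s)

/-- Running on a record of named stacks mirrors running on a function of stacks. With records,
concrete states can be compared by reduction and simplification. -/
theorem StackOp.run_get (o : StackOp Stk Γ' Regs) (v : Regs) (s : Stores) :
    o.run (v, s.get) = ((o.exec (v, s)).1, (o.exec (v, s)).2.get) := by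
  cases o <;> simp only [StackOp.run, StackOp.exec, Stores.update_get]

theorem foldl_run_get (ops : List (StackOp Stk Γ' Regs)) (v : Regs) (s : Stores) :
    ops.foldl (fun s o => o.run s) (v, s.get) =
      ((ops.foldl (fun s o => o.exec s) (v, s)).1,
        (ops.foldl (fun s o => o.exec s) (v, s)).2.get) := by
  induction ops generalizing v s with
  | nil => rfl
  | cons o ops ih => rw [List.foldl_cons, List.foldl_cons, StackOp.run_get, ih]

/-- `Exec p v s v' s' t`: the program `p` leads from `(v, s)` to `(v', s')` in at most `t` steps. -/
def Exec (p : Prog) (v : Regs) (s : Stores) (v' : Regs) (s' : Stores) (t : ℕ) : Prop :=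
  ∃ n ≤ t, p.Runs (v, s.get) (v', s'.get) n

namespace Exec

variable {p q : Prog} {c : Regs → Bool} {v v₁ v' : Regs} {s s₁ s' : Stores} {t t₁ t₂ : ℕ}

theorem basic {ops : List (StackOp Stk Γ' Regs)}
    (h : ops.foldl (fun s o => o.exec s) (v, s) = (v', s')) :
    Exec (.basic ops) v s v' s' 1 := by
  refine ⟨1, le_rfl, ?_⟩
  have h1 := StackProg.Runs.basic ops (v, s.get)
  rwa [foldl_run_get, h] at h1

theorem mono (h : Exec p v s v' s' t₁) (ht : t₁ ≤ t) : Exec p v s v' s' t :=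
  let ⟨n, hn, h⟩ := h
  ⟨n, hn.trans ht, h⟩

theorem congr (h : Exec p v s v₁ s₁ t₁) (hv : v₁ = v') (hs : s₁ = s') (ht : t₁ ≤ t) :
    Exec p v s v' s' t :=
  hv ▸ hs ▸ h.mono ht

theorem seq (h₁ : Exec p v s v₁ s₁ t₁) (h₂ : Exec q v₁ s₁ v' s' t₂) :
    Exec (.seq p q) v s v' s' (t₁ + t₂) :=
  let ⟨_, hm, h₁⟩ := h₁
  let ⟨_, hn, h₂⟩ := h₂
  ⟨_, Nat.add_le_add hm hn, .seq h₁ h₂⟩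

theorem ite_true (hc : c v = true) (h : Exec p v s v' s' t) :
    Exec (.ite c p q) v s v' s' (t + 1) :=
  let ⟨_, hn, h⟩ := h
  ⟨_, Nat.succ_le_succ hn, .ite_true hc h⟩

theorem ite_false (hc : c v = false) (h : Exec q v s v' s' t) :
    Exec (.ite c p q) v s v' s' (t + 1) :=
  let ⟨_, hn, h⟩ := h
  ⟨_, Nat.succ_le_succ hn, .ite_false hc h⟩

theorem loop_true (hc : c v = true) (h₁ : Exec p v s v₁ s₁ t₁)
    (h₂ : Exec (.loop c p) v₁ s₁ v' s' t₂) : Exec (.loop c p) v s v' s' (t₁ + t₂ + 1) :=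
  let ⟨_, hm, h₁⟩ := h₁
  let ⟨_, hn, h₂⟩ := h₂
  ⟨_, Nat.succ_le_succ (Nat.add_le_add hm hn), .loop_true hc h₁ h₂⟩

theorem loop_false (hc : c v = false) : Exec (.loop c p) v s v s 1 :=
  ⟨1, le_rfl, .loop_false hc⟩

end Exec

/-! ### Elementary programs -/

/-- Pop into the register `x`. -/
def popX (k : Stk) : StackOp Stk Γ' Regs := .pop k fun v o => { v with x := o }

/-- Pop into the register `y`. -/
def popY (k : Stk) : StackOp Stk Γ' Regs := .pop k fun v o => { v with y := o }

/-- Read the top of a stack into the register `x`. -/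
def peekX (k : Stk) : StackOp Stk Γ' Regs := .peek k fun v o => { v with x := o }

/-- Push the register `x`. -/
def pushX (k : Stk) : StackOp Stk Γ' Regs := .push k fun v => v.x.getD .blank

/-- Push the register `y`. -/
def pushY (k : Stk) : StackOp Stk Γ' Regs := .push k fun v => v.y.getD .blank

/-- Push a fixed symbol. -/
def put (k : Stk) (g : Γ') : StackOp Stk Γ' Regs := .push k fun _ => g

/-- Push a fixed bit. -/
def putBit (k : Stk) (b : Bool) : StackOp Stk Γ' Regs := .push k fun _ => .bit b

/-- Move the contents of a stack to another stack, in reverse order. -/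
def moveAll (i o : Stk) : Prog :=
  .seq (.basic [popX i]) (.loop (fun v => v.x.isSome) (.basic [pushX o, popX i]))

/-- Empty a stack. -/
def clear (k : Stk) : Prog :=
  .seq (.basic [popX k]) (.loop (fun v => v.x.isSome) (.basic [popX k]))

theorem exec_moveAll {i o : Stk} (h : i ≠ o) (v : Regs) (s : Stores) :
    Exec (moveAll i o) v s { v with x := none }
      ((s.set i []).set o ((s.get i).reverse ++ s.get o)) (2 * (s.get i).length + 2) := by
  have main : ∀ (l : List Γ') (s : Stores),
      Exec (.loop (fun v => v.x.isSome) (.basic [pushX o, popX i])) { v with x := l.head? }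
        (s.set i l.tail) { v with x := none } ((s.set i []).set o (l.reverse ++ s.get o))
        (2 * l.length + 1) := by
    intro l
    induction l with
    | nil =>
      intro s
      have h1 : (s.set i []).set o (s.get o) = s.set i [] := by
        conv_lhs => rw [← s.get_set_of_ne h.symm [], Stores.set_get]
      rw [List.reverse_nil, List.nil_append, h1]
      exact .loop_false rfl
    | cons c l ih =>
      intro s
      have h2 := ih (s.set o (c :: s.get o))
      have h3 : ((s.set o (c :: s.get o)).set i []).set o
          (l.reverse ++ (s.set o (c :: s.get o)).get o) =
          (s.set i []).set o ((c :: l).reverse ++ s.get o) := by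
        rw [Stores.get_set, Stores.set_comm _ h.symm, Stores.set_set]
        simp
      rw [h3] at h2
      refine (Exec.loop_true rfl (.basic ?_) h2).mono (by rw [List.length_cons]; omega)
      change (({ v with x := ((((s.set i l).set o (c :: (s.set i l).get o))).get i).head? } : Regs),
        (((s.set i l).set o (c :: (s.set i l).get o))).set i
          ((((s.set i l).set o (c :: (s.set i l).get o))).get i).tail) = _
      rw [Stores.get_set_of_ne _ h, Stores.get_set, Stores.get_set_of_ne _ h.symm,
        Stores.set_comm _ h, Stores.set_set]
  refine (Exec.seq (.basic rfl) (main (s.get i) s)).mono (by omega)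

theorem exec_clear (k : Stk) (v : Regs) (s : Stores) :
    Exec (clear k) v s { v with x := none } (s.set k []) (2 * (s.get k).length + 2) := by
  have main : ∀ (l : List Γ'),
      Exec (.loop (fun v => v.x.isSome) (.basic [popX k])) { v with x := l.head? }
        (s.set k l.tail) { v with x := none } (s.set k []) (2 * l.length + 1) := by
    intro l
    induction l with
    | nil => exact .loop_false rfl
    | cons c l ih =>
      refine (Exec.loop_true rfl (.basic ?_) ih).mono (by rw [List.length_cons]; omega)
      change (({ v with x := ((s.set k l).get k).head? } : Regs),
        (s.set k l).set k ((s.set k l).get k).tail) = _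
      rw [Stores.get_set, Stores.set_set]
  exact (Exec.seq (.basic rfl) (main (s.get k))).mono (by omega)

/-! ### Binary numbers -/

/-- The value of a bit string, least significant bit first. -/
def bitsVal : List Bool → ℕ
  | [] => 0
  | b :: w => b.toNat + 2 * bitsVal w

/-- The binary successor, least significant bit first. -/
def incBits : List Bool → List Bool
  | [] => [true]
  | false :: w => true :: w
  | true :: w => false :: incBits w

theorem bitsVal_encodePosNum (n : PosNum) : bitsVal (encodePosNum n) = (n : ℕ) := by
  induction n with
  | one => rfl
  | bit0 n ih => rw [encodePosNum, bitsVal, ih, PosNum.cast_bit0]; simp; omega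
  | bit1 n ih => rw [encodePosNum, bitsVal, ih, PosNum.cast_bit1]; simp; omega

theorem bitsVal_encodeNat (n : ℕ) : bitsVal (encodeNat n) = n := by
  conv_rhs => rw [← Num.to_of_nat n]
  unfold encodeNat
  cases (n : Num) with
  | zero => rfl
  | pos m => exact bitsVal_encodePosNum m

theorem encodePosNum_succ (n : PosNum) : encodePosNum n.succ = incBits (encodePosNum n) := by
  induction n with
  | one => rfl
  | bit0 n _ => rfl
  | bit1 n ih => rw [PosNum.succ, encodePosNum, ih]; rfl

theorem encodeNat_zero : encodeNat 0 = [] := rfl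

theorem encodeNat_succ (n : ℕ) : encodeNat (n + 1) = incBits (encodeNat n) := by
  unfold encodeNat
  rw [Nat.cast_succ, Num.add_one]
  cases (n : Num) with
  | zero => rfl
  | pos m => exact encodePosNum_succ m

theorem length_incBits_le (w : List Bool) : (incBits w).length ≤ w.length + 1 := by
  induction w with
  | nil => simp [incBits]
  | cons b w ih => cases b <;> simp [incBits, ih]

theorem length_encodeNat_le (n : ℕ) : (encodeNat n).length ≤ n := by
  induction n with
  | zero => simp [encodeNat_zero]
  | succ n ih =>
    rw [encodeNat_succ]
    exact (length_incBits_le _).trans (Nat.succ_le_succ ih)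

/-! ### Bitwise comparison -/

/-- Update a comparison by a pair of more significant bits. -/
def CmpState.upd : CmpState → Bool → Bool → CmpState
  | lock, _, _ => lock
  | _, false, true => lt
  | _, true, false => gt
  | c, _, _ => c

/-- Compare two bit strings, least significant bits first, starting from the state `c`. -/
def cmpBits : CmpState → List Bool → List Bool → CmpState
  | c, [], q => q.foldl (fun c b => c.upd false b) c
  | c, b :: p, [] => cmpBits (c.upd b false) p []
  | c, b :: p, b' :: q => cmpBits (c.upd b b') p q

theorem cmpBits_nil_cons (c : CmpState) (b : Bool) (q : List Bool) :
    cmpBits c [] (b :: q) = cmpBits (c.upd false b) [] q := rfl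

theorem cmpBits_lock (p q : List Bool) : cmpBits .lock p q = .lock := by
  induction p generalizing q with
  | nil =>
    induction q with
    | nil => rfl
    | cons b q ih => exact ih
  | cons b p ih =>
    cases q with
    | nil => exact ih []
    | cons b' q => exact ih q

theorem CmpState.upd_eq {c : CmpState} (hc : c ≠ .lock) (b b' : Bool) :
    c.upd b b' = if b = b' then c else if b' then .lt else .gt := by
  cases c <;> cases b <;> cases b' <;> simp_all [CmpState.upd]

theorem CmpState.upd_ne_lock {c : CmpState} (hc : c ≠ .lock) (b b' : Bool) :
    c.upd b b' ≠ .lock := by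
  cases c <;> cases b <;> cases b' <;> simp_all [CmpState.upd]

/-- Reading from the least significant bit, each later difference overrides the earlier ones. The
last difference therefore decides, and the initial state survives only for equal values; padding
with zeros handles different lengths. -/
theorem cmpBits_eq {c : CmpState} (hc : c ≠ .lock) (p q : List Bool) :
    cmpBits c p q = if bitsVal p < bitsVal q then .lt
      else if bitsVal q < bitsVal p then .gt else c := by
  induction p generalizing q c with
  | nil =>
    induction q generalizing c with
    | nil => rfl
    | cons b q ih =>
      rw [cmpBits_nil_cons, ih (CmpState.upd_ne_lock hc _ _), CmpState.upd_eq hc]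
      cases b <;> simp [bitsVal]
  | cons b p ih =>
    cases q with
    | nil =>
      rw [cmpBits, ih (CmpState.upd_ne_lock hc _ _), CmpState.upd_eq hc]
      cases b <;> simp [bitsVal]
    | cons b' q =>
      rw [cmpBits, ih (CmpState.upd_ne_lock hc _ _), CmpState.upd_eq hc]
      cases b <;> cases b' <;> simp only [bitsVal] <;> grind

/-! ### The comparison program -/

/-- Whether a symbol is a comma. -/
def isComma : Option Γ' → Bool
  | some .comma => true
  | _ => false

/-- Whether a symbol is the bit `1`. -/
def isOne : Option Γ' → Bool
  | some (.bit b) => b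
  | _ => false

/-- Read one more bit of the numbers on the stacks `u` and `a`, as long as they last. -/
def cmpBody (u : Stk) : Prog :=
  .seq (.ite (fun v => isComma v.x) (.basic []) (.basic [popX u, pushX .tx]))
    (.seq (.ite (fun v => isComma v.y) (.basic []) (.basic [popY .a, pushY .ty]))
      (.basic [.load fun v => { v with cmp := v.cmp.upd (isOne v.x) (isOne v.y) }]))

/-- Compare the numbers on top of the stacks `u` and `a`, moving them to `tx` and `ty`. -/
def cmpLoop (u : Stk) : Prog := .loop (fun v => !(isComma v.x && isComma v.y)) (cmpBody u)

section

variable {u : Stk} {v : Regs} {s : Stores} {g h : Γ'} {r r' : List Γ'}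

theorem exec_cmpBody (hu : u = .t ∨ u = .d) (hx : isComma v.x = false) (hy : isComma v.y = false)
    (hr : s.get u = g :: r) (hr' : s.a = h :: r') :
    Exec (cmpBody u) v s
      { v with x := some g, y := some h, cmp := v.cmp.upd (isOne (some g)) (isOne (some h)) }
      (({ s with a := r', tx := g :: s.tx, ty := h :: s.ty } : Stores).set u r) 5 := by
  refine .seq (t₁ := 2) (.ite_false hx (.basic rfl)) (.seq (t₁ := 2)
    (.ite_false hy (.basic rfl)) (.basic ?_))
  cases s
  rcases hu with rfl | rfl <;> cases hr <;> cases hr' <;> rfl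

theorem exec_cmpBody_left (hu : u = .t ∨ u = .d) (hx : isComma v.x = false) (hy : v.y = some .comma)
    (hr : s.get u = g :: r) :
    Exec (cmpBody u) v s { v with x := some g, cmp := v.cmp.upd (isOne (some g)) false }
      (({ s with tx := g :: s.tx } : Stores).set u r) 5 := by
  cases v
  cases hy
  refine .seq (t₁ := 2) (.ite_false hx (.basic rfl)) (.seq (t₁ := 2)
    (.ite_true rfl (.basic rfl)) (.basic ?_))
  cases s
  rcases hu with rfl | rfl <;> cases hr <;> rfl

theorem exec_cmpBody_right (hx : v.x = some .comma) (hy : isComma v.y = false)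
    (hr' : s.a = h :: r') :
    Exec (cmpBody u) v s { v with y := some h, cmp := v.cmp.upd false (isOne (some h)) }
      { s with a := r', ty := h :: s.ty } 5 := by
  cases v
  cases hx
  refine .seq (t₁ := 2) (.ite_true rfl (.basic rfl)) (.seq (t₁ := 2)
    (.ite_false hy (.basic rfl)) (.basic ?_))
  cases s
  cases hr'
  rfl

/-- The other number has ended: its register stays at the comma, which `isOne` reads as a zero bit.
-/
theorem exec_cmpLoop_right (q : List Bool) (hx : v.x = some .comma) (hy : isComma v.y = false)
    (hr' : s.a = q.map .bit ++ .comma :: r') :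
    Exec (cmpLoop u) v s { v with y := some .comma, cmp := cmpBits v.cmp [] q }
      { s with a := r', ty := .comma :: (q.map Γ'.bit).reverse ++ s.ty } (6 * q.length + 7) := by
  induction q generalizing v s with
  | nil =>
    refine Exec.congr (.loop_true (by rw [hy, Bool.and_false]; rfl) (exec_cmpBody_right hx hy hr')
      (.loop_false (by rw [hx]; rfl))) ?_ rfl (by simp)
    cases v.cmp <;> rfl
  | cons b q ih =>
    refine Exec.congr (.loop_true (by rw [hy, Bool.and_false]; rfl)
      (exec_cmpBody_right hx hy hr') (ih hx rfl rfl)) ?_ ?_ (by rw [List.length_cons]; omega)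
    all_goals simp [cmpBits_nil_cons, isOne]

theorem exec_cmpLoop_left (hu : u = .t ∨ u = .d) (p : List Bool)
    (hx : isComma v.x = false) (hy : v.y = some .comma)
    (hr : s.get u = p.map .bit ++ .comma :: r) :
    Exec (cmpLoop u) v s { v with x := some .comma, cmp := cmpBits v.cmp p [] }
      (({ s with tx := .comma :: (p.map Γ'.bit).reverse ++ s.tx } : Stores).set u r)
      (6 * p.length + 7) := by
  induction p generalizing v s with
  | nil =>
    have hc : v.cmp.upd false false = v.cmp := by cases v.cmp <;> rfl
    have h1 := exec_cmpBody_left hu hx hy hr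
    rw [show isOne (some Γ'.comma) = false from rfl, hc] at h1
    exact Exec.congr (.loop_true (by rw [hx, Bool.false_and]; rfl) h1
      (.loop_false (by rw [hy]; rfl))) rfl rfl (by simp)
  | cons b p ih =>
    have h1 := exec_cmpBody_left hu hx hy hr
    refine Exec.congr (.loop_true (by rw [hx, Bool.false_and]; rfl) h1 (ih rfl hy
      (Stores.get_set _ _ _))) ?_ ?_ (by rw [List.length_cons]; omega)
    all_goals
      rcases hu with rfl | rfl <;> simp [cmpBits, isOne, Stores.set]

theorem exec_cmpLoop (hu : u = .t ∨ u = .d) (p q : List Bool)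
    (hx : isComma v.x = false) (hy : isComma v.y = false)
    (hr : s.get u = p.map .bit ++ .comma :: r) (hr' : s.a = q.map .bit ++ .comma :: r') :
    Exec (cmpLoop u) v s
      { v with x := some .comma, y := some .comma, cmp := cmpBits v.cmp p q }
      (({ s with
        a := r'
        tx := .comma :: (p.map Γ'.bit).reverse ++ s.tx
        ty := .comma :: (q.map Γ'.bit).reverse ++ s.ty } : Stores).set u r)
      (6 * (p.length + q.length) + 13) := by
  induction p generalizing v s q with
  | nil =>
    cases q with
    | nil =>
      have hc : v.cmp.upd false false = v.cmp := by cases v.cmp <;> rfl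
      have h1 := exec_cmpBody hu hx hy hr hr'
      rw [show isOne (some Γ'.comma) = false from rfl, hc] at h1
      exact Exec.congr (.loop_true (by rw [hx, Bool.false_and]; rfl) h1 (.loop_false rfl)) rfl rfl
        (by simp)
    | cons b q =>
      have h1 := exec_cmpBody hu hx hy hr hr'
      refine Exec.congr (.loop_true (by rw [hx, Bool.false_and]; rfl) h1
        (exec_cmpLoop_right q rfl rfl (by rcases hu with rfl | rfl <;> rfl))) ?_ ?_ (by simp; omega)
      all_goals
        rcases hu with rfl | rfl <;> simp [cmpBits, isOne, Stores.set]
  | cons b p ih =>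
    cases q with
    | nil =>
      have h1 := exec_cmpBody hu hx hy hr hr'
      refine Exec.congr (.loop_true (by rw [hx, Bool.false_and]; rfl) h1
        (exec_cmpLoop_left hu p rfl rfl (Stores.get_set _ _ _))) ?_ ?_ (by simp; omega)
      all_goals
        rcases hu with rfl | rfl <;> simp [cmpBits, isOne, Stores.set]
    | cons b' q =>
      have h1 := exec_cmpBody hu hx hy hr hr'
      refine Exec.congr (.loop_true (by rw [hx, Bool.false_and]; rfl) h1 (ih q rfl rfl
        (Stores.get_set _ _ _) (by rcases hu with rfl | rfl <;> rfl))) ?_ ?_ (by simp; omega)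
      all_goals
        rcases hu with rfl | rfl <;> simp [cmpBits, isOne, Stores.set]

end

/-! ### Comparing targets and deadlines with elements of the discretized sequence -/

/-- The encoding of a sequence without its brackets. -/
def seqBody {α : Type} (e : α → List Bool) (l : List α) : List Γ' :=
  l.flatMap fun x => (e x).map Γ'.bit ++ [Γ'.comma]

theorem seqBody_cons {α : Type} (e : α → List Bool) (x : α) (l : List α) :
    seqBody e (x :: l) = (e x).map Γ'.bit ++ Γ'.comma :: seqBody e l := by
  simp [seqBody]

/-- Compare the number on `t` with twice the number on `a`. -/
def tCmp : Prog :=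
  .seq (.basic [popY .a, pushY .ty, popX .t, pushX .tx, .load fun v =>
      { v with cmp := if isOne v.y then .lock else if isOne v.x then .gt else .eq }])
    (.seq (cmpLoop .t) (.seq (moveAll .ty .a) (.basic [.load fun v => { v with y := none }])))

/-- Compare the number on `d` with the number on `a`. -/
def dCmp : Prog :=
  .seq (.basic [popY .a, pushY .ty, .load fun v =>
      { v with x := none, cmp := if isOne v.y then .lock else .eq }])
    (.seq (cmpLoop .d) (.seq (moveAll .ty .a) (.basic [.load fun v => { v with y := none }])))

/-- Comparing with twice a number drops the lowest bit `b` of the target and compares the rest; on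
equality `b` decides, so it provides the initial state. A negative sign locks the comparison, since
a target is then larger in any case. The target remains reversed on `tx`, to be restored or
discarded. -/
theorem exec_tCmp_bits {v : Regs} {s : Stores} {r r' : List Γ'} (b sg : Bool) (p q : List Bool)
    (ht : s.t = (b :: p).map .bit ++ .comma :: r) (ha : s.a = (sg :: q).map .bit ++ .comma :: r')
    (hx : s.tx = []) (hy : s.ty = []) :
    Exec tCmp v s
      { v with
        x := none
        y := none
        cmp := cmpBits (if sg then .lock else if b then .gt else .eq) p q }
      { s with t := r, tx := .comma :: ((b :: p).map Γ'.bit).reverse }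
      (8 * (p.length + q.length) + 21) := by
  cases s
  cases ht
  cases ha
  cases hx
  cases hy
  refine Exec.congr (.seq (.basic rfl) (.seq (exec_cmpLoop (.inl rfl) p q rfl rfl rfl rfl)
    (.seq (exec_moveAll (by decide) _ _) (.basic rfl)))) rfl ?_ ?_
  · simp [Stores.set, Stores.get]
  · simp [Stores.set, Stores.get]
    omega

theorem exec_dCmp_bits {v : Regs} {s : Stores} {r r' : List Γ'} (sg : Bool) (p q : List Bool)
    (hd : s.d = p.map .bit ++ .comma :: r) (ha : s.a = (sg :: q).map .bit ++ .comma :: r')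
    (hx : s.tx = []) (hy : s.ty = []) :
    Exec dCmp v s
      { v with x := none, y := none, cmp := cmpBits (if sg then .lock else .eq) p q }
      { s with d := r, tx := .comma :: (p.map Γ'.bit).reverse }
      (8 * (p.length + q.length) + 21) := by
  cases s
  cases hd
  cases ha
  cases hx
  cases hy
  refine Exec.congr (.seq (.basic rfl) (.seq (exec_cmpLoop (.inr rfl) p q rfl rfl rfl rfl)
    (.seq (exec_moveAll (by decide) _ _) (.basic rfl)))) rfl ?_ ?_
  · simp [Stores.set, Stores.get]
  · simp [Stores.set, Stores.get]
    omega

theorem exec_tCmp {v : Regs} {s : Stores} {r r' : List Γ'} {t : ℕ} {a : ℤ} (ht0 : 0 < t)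
    (ht : s.t = (encodeNat t).map .bit ++ .comma :: r)
    (ha : s.a = (encodeInt a).map .bit ++ .comma :: r') (hx : s.tx = []) (hy : s.ty = []) :
    ∃ c : CmpState, (c = .lt ↔ (t : ℤ) < 2 * a) ∧ (c = .eq ↔ (t : ℤ) = 2 * a) ∧
      Exec tCmp v s { v with x := none, y := none, cmp := c }
        { s with t := r, tx := .comma :: ((encodeNat t).map Γ'.bit).reverse }
        (8 * ((encodeNat t).length + (encodeInt a).length) + 21) := by
  have hv := bitsVal_encodeNat t
  have hw := bitsVal_encodeNat a.natAbs
  -- Positivity of `t` guarantees a lowest bit; the code of zero is empty, and the comma would be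
  -- mistaken for that bit.
  cases hb : encodeNat t with
  | nil => rw [hb, bitsVal] at hv; omega
  | cons b p =>
    rw [hb] at hv ht
    rw [bitsVal] at hv
    refine ⟨_, ?_, ?_, (exec_tCmp_bits b (decide (a < 0)) p (encodeNat a.natAbs) ht ha hx hy).mono
      (by simp [encodeInt]; omega)⟩
    all_goals
      by_cases ha0 : a < 0
      · simp only [ha0, decide_true, if_true, cmpBits_lock, reduceCtorEq, false_iff]
        omega
      · simp only [ha0, decide_false, Bool.false_eq_true, if_false]
        rw [cmpBits_eq (by cases b <;> simp), hw]
        cases b <;> simp at hv ⊢ <;> grind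

theorem exec_dCmp {v : Regs} {s : Stores} {r r' : List Γ'} {d : ℕ} {a : ℤ}
    (hd : s.d = (encodeNat d).map .bit ++ .comma :: r)
    (ha : s.a = (encodeInt a).map .bit ++ .comma :: r') (hx : s.tx = []) (hy : s.ty = []) :
    ∃ c : CmpState, (c = .eq ↔ (d : ℤ) = a) ∧
      Exec dCmp v s { v with x := none, y := none, cmp := c }
        { s with d := r, tx := .comma :: ((encodeNat d).map Γ'.bit).reverse }
        (8 * ((encodeNat d).length + (encodeInt a).length) + 21) := by
  have hv := bitsVal_encodeNat d
  have hw := bitsVal_encodeNat a.natAbs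
  refine ⟨_, ?_, (exec_dCmp_bits (decide (a < 0)) _ (encodeNat a.natAbs) hd ha hx hy).mono
    (by simp [encodeInt])⟩
  by_cases ha0 : a < 0
  · simp only [ha0, decide_true, if_true, cmpBits_lock, reduceCtorEq, false_iff]
    omega
  · simp only [ha0, decide_false, Bool.false_eq_true, if_false]
    rw [cmpBits_eq (by simp), hw, hv]
    grind

/-! ### Processing the targets of one step -/

/-- Process one target. -/
def tBody : Prog :=
  .seq (.basic [peekX .t])
    (.ite (fun v => v.x.isNone)
      (.basic [.load fun v => { v with x := none, y := none, cont := false, cmp := .gt }])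
      (.seq tCmp
        (.ite (fun v => decide (v.cmp = .lt))
          (.seq (clear .tx)
            (.ite (fun v => v.first)
              (.basic [putBit .wt false, .load fun v => { v with first := false }])
              (.basic [putBit .wt false, putBit .wt false, putBit .wd false, putBit .wd true,
                put .wn .blank])))
          (.ite (fun v => decide (v.cmp = .eq))
            (.seq (clear .tx) (.basic [.load fun v => { v with cont := false }]))
            (.seq (moveAll .tx .t)
              (.basic [.load fun v => { v with cont := false, cmp := .gt }]))))))

/-- Process all targets that are at most twice the number on `a`. -/
def tLoop : Prog := .loop (fun v => v.cont) tBody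

section

variable {B : ℕ} {a : ℤ} {r' : List Γ'}

theorem exec_tBody_nil {v : Regs} {s : Stores} (ht : s.t = []) :
    Exec tBody v s { v with x := none, y := none, cont := false, cmp := .gt } s 3 := by
  cases s
  cases ht
  exact .seq (.basic rfl) (.ite_true rfl (.basic rfl))

theorem exec_tBody_lt_first (haB : (encodeInt a).length ≤ B) {v : Regs} {s : Stores} {t : ℕ}
    {T : List ℕ} (ht0 : 0 < t) (htB : (encodeNat t).length ≤ B)
    (ht : s.t = seqBody encodeNat (t :: T))
    (ha : s.a = (encodeInt a).map .bit ++ .comma :: r') (hx : s.tx = []) (hy : s.ty = [])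
    (hta : (t : ℤ) < 2 * a) (hf : v.first = true) :
    Exec tBody v s { v with x := none, y := none, first := false, cmp := .lt }
      { s with t := seqBody encodeNat T, wt := .bit false :: s.wt } (20 * B + 40) := by
  rw [seqBody_cons] at ht
  obtain ⟨c, hc, -, h⟩ := exec_tCmp (v := { v with x := s.t.head? }) ht0 ht ha hx hy
  obtain rfl := hc.2 hta
  refine Exec.congr (.seq (.basic rfl) (.ite_false ?_ (.seq h (.ite_true rfl
    (.seq (exec_clear _ _ _) (.ite_true hf (.basic rfl))))))) rfl ?_ ?_
  · simp [Stores.get, ht]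
  · simp [Stores.set, Stores.get, hx]
  · simp [Stores.get]
    omega

theorem exec_tBody_lt_rest (haB : (encodeInt a).length ≤ B) {v : Regs} {s : Stores} {t : ℕ}
    {T : List ℕ} (ht0 : 0 < t) (htB : (encodeNat t).length ≤ B)
    (ht : s.t = seqBody encodeNat (t :: T))
    (ha : s.a = (encodeInt a).map .bit ++ .comma :: r') (hx : s.tx = []) (hy : s.ty = [])
    (hta : (t : ℤ) < 2 * a) (hf : v.first = false) :
    Exec tBody v s { v with x := none, y := none, cmp := .lt }
      { s with
        t := seqBody encodeNat T
        wt := .bit false :: .bit false :: s.wt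
        wd := .bit true :: .bit false :: s.wd
        wn := .blank :: s.wn } (20 * B + 40) := by
  rw [seqBody_cons] at ht
  obtain ⟨c, hc, -, h⟩ := exec_tCmp (v := { v with x := s.t.head? }) ht0 ht ha hx hy
  obtain rfl := hc.2 hta
  refine Exec.congr (.seq (.basic rfl) (.ite_false ?_ (.seq h (.ite_true rfl
    (.seq (exec_clear _ _ _) (.ite_false hf (.basic rfl))))))) rfl ?_ ?_
  · simp [Stores.get, ht]
  · simp [Stores.set, Stores.get, hx]
  · simp [Stores.get]
    omega

theorem exec_tBody_eq (haB : (encodeInt a).length ≤ B) {v : Regs} {s : Stores} {t : ℕ}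
    {T : List ℕ} (ht0 : 0 < t) (htB : (encodeNat t).length ≤ B)
    (ht : s.t = seqBody encodeNat (t :: T))
    (ha : s.a = (encodeInt a).map .bit ++ .comma :: r') (hx : s.tx = []) (hy : s.ty = [])
    (hta : (t : ℤ) = 2 * a) :
    Exec tBody v s { v with x := none, y := none, cont := false, cmp := .eq }
      { s with t := seqBody encodeNat T } (20 * B + 40) := by
  rw [seqBody_cons] at ht
  obtain ⟨c, -, hc, h⟩ := exec_tCmp (v := { v with x := s.t.head? }) ht0 ht ha hx hy
  obtain rfl := hc.2 hta
  refine Exec.congr (.seq (.basic rfl) (.ite_false ?_ (.seq h (.ite_false rfl (.ite_true rfl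
    (.seq (exec_clear _ _ _) (.basic rfl))))))) rfl ?_ ?_
  · simp [Stores.get, ht]
  · simp [Stores.set, hx]
  · simp [Stores.get]
    omega

theorem exec_tBody_gt (haB : (encodeInt a).length ≤ B) {v : Regs} {s : Stores} {t : ℕ}
    {T : List ℕ} (ht0 : 0 < t) (htB : (encodeNat t).length ≤ B)
    (ht : s.t = seqBody encodeNat (t :: T))
    (ha : s.a = (encodeInt a).map .bit ++ .comma :: r') (hx : s.tx = []) (hy : s.ty = [])
    (hta : 2 * a < (t : ℤ)) :
    Exec tBody v s { v with x := none, y := none, cont := false, cmp := .gt } s (20 * B + 40) := by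
  rw [seqBody_cons] at ht
  obtain ⟨c, hc, hc', h⟩ := exec_tCmp (v := { v with x := s.t.head? }) ht0 ht ha hx hy
  have h1 : c ≠ .lt := fun h => by have := hc.1 h; omega
  have h2 : c ≠ .eq := fun h => by have := hc'.1 h; omega
  refine Exec.congr (.seq (.basic rfl) (.ite_false ?_ (.seq h (.ite_false (decide_eq_false h1)
    (.ite_false (decide_eq_false h2)
    (.seq (exec_moveAll (by decide) _ _) (.basic rfl))))))) rfl ?_ ?_
  · simp [Stores.get, ht]
  · cases s
    cases hx
    cases ht
    simp [Stores.set, Stores.get]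
  · simp [Stores.get]
    omega

end

theorem replicate_succ_append {α : Type} (n : ℕ) (x : α) (l : List α) :
    List.replicate (n + 1) x ++ l = List.replicate n x ++ x :: l := by
  simp [List.replicate_succ']

theorem flatten_replicate_succ_append {α : Type} (n : ℕ) (w l : List α) :
    (List.replicate (n + 1) w).flatten ++ l = (List.replicate n w).flatten ++ (w ++ l) := by
  simp [List.replicate_succ']

/-- The effect of `tLoop`: `k` targets are below `2 * a`, and `b` tells whether `2 * a` is a
target. -/
theorem exec_tLoop {B : ℕ} {a : ℤ} {r' : List Γ'} (haB : (encodeInt a).length ≤ B) (T : List ℕ)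
    (hT : ∀ t ∈ T, 0 < t ∧ (encodeNat t).length ≤ B) {v : Regs} {s : Stores}
    (hv : v.cont = true) (ht : s.t = seqBody encodeNat T)
    (ha : s.a = (encodeInt a).map .bit ++ .comma :: r') (hx : s.tx = []) (hy : s.ty = [])
    {T₁ : List ℕ} {k m : ℕ} {b : Bool}
    (hT₁ : T₁ = T.dropWhile (fun t : ℕ => decide ((t : ℤ) < 2 * a)))
    (hk : k = T.length - T₁.length) (hm : m = k - v.first.toNat)
    (hb : b = decide (T₁.head?.map (fun t : ℕ => (t : ℤ)) = some (2 * a))) :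
    Exec tLoop v s
      { v with
        x := none
        y := none
        cont := false
        first := v.first && decide (k = 0)
        cmp := if b then .eq else .gt }
      { s with
        t := seqBody encodeNat (if b then T₁.tail else T₁)
        wt := List.replicate (k + m) (.bit false) ++ s.wt
        wd := (List.replicate m [.bit true, .bit false]).flatten ++ s.wd
        wn := List.replicate m .blank ++ s.wn } ((T.length + 1) * (20 * B + 41) + 1) := by
  induction T generalizing v s k m with
  | nil =>
    subst hT₁
    have h0 : k = 0 := by simpa using hk
    subst h0
    have h0 : m = 0 := by omega
    subst h0
    have h0 : b = false := by simpa using hb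
    subst h0
    refine Exec.congr (.loop_true hv (exec_tBody_nil ht) (.loop_false rfl)) ?_ ?_ (by simp)
    · simp
    · simp [← ht]
  | cons t T ih =>
    obtain ⟨ht0, htB⟩ := hT t (by simp)
    rcases lt_trichotomy (t : ℤ) (2 * a) with hta | hta | hta
    · rw [List.dropWhile_cons_of_pos (by simpa using hta)] at hT₁
      have hlen : T₁.length ≤ T.length := by
        rw [hT₁]
        exact (List.dropWhile_suffix _).length_le
      have hk' : k = (T.length - T₁.length) + 1 := by rw [hk, List.length_cons]; omega
      generalize hkk : T.length - T₁.length = k' at hk'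
      subst hk'
      have hT' := fun t ht => hT t (List.mem_cons_of_mem _ ht)
      -- The first target below `2a` fills one slot. Each further one fills two slots and opens an
      -- extra position, so `k > 0` targets produce `2k - 1` slots and `k - 1` extra positions.
      cases hf : v.first with
      | true =>
        have h1 := exec_tBody_lt_first haB ht0 htB ht ha hx hy hta hf
        refine Exec.congr (.loop_true hv h1 (ih hT' (by exact hv) (by rfl) (by exact ha)
          (by exact hx) (by exact hy) hT₁ hkk.symm rfl)) ?_ ?_ ?_
        · simp
        · have hm' : m = k' := by rw [hm, hf]; simp
          subst hm'
          have : m + 1 + m = (m + m) + 1 := by omega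
          simp only [Bool.toNat_false, Nat.sub_zero, this, replicate_succ_append]
        · rw [List.length_cons]; ring_nf; omega
      | false =>
        have h1 := exec_tBody_lt_rest haB ht0 htB ht ha hx hy hta hf
        refine Exec.congr (.loop_true hv h1 (ih hT' (by exact hv) (by rfl) (by exact ha)
          (by exact hx) (by exact hy) hT₁ hkk.symm rfl)) ?_ ?_ ?_
        · simp [hf]
        · have hm' : m = k' + 1 := by rw [hm, hf]; simp
          subst hm'
          have : k' + 1 + (k' + 1) = (k' + k') + 1 + 1 := by omega
          simp only [hf, Bool.toNat_false, Nat.sub_zero, this, replicate_succ_append,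
            flatten_replicate_succ_append, List.cons_append, List.nil_append]
        · rw [List.length_cons]; ring_nf; omega
    · rw [List.dropWhile_cons_of_neg (by simp [hta])] at hT₁
      subst hT₁
      have h0 : k = 0 := by simpa using hk
      subst h0
      have h0 : m = 0 := by omega
      subst h0
      have h0 : b = true := by simpa [hta] using hb
      subst h0
      refine Exec.congr (.loop_true hv (exec_tBody_eq haB ht0 htB ht ha hx hy hta)
        (.loop_false rfl)) ?_ ?_ ?_
      · simp
      · simp
      · rw [List.length_cons]; ring_nf; omega
    · rw [List.dropWhile_cons_of_neg (by simp; omega)] at hT₁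
      subst hT₁
      have h0 : k = 0 := by simpa using hk
      subst h0
      have h0 : m = 0 := by omega
      subst h0
      have h0 : b = false := by simpa [hta.ne'] using hb
      subst h0
      refine Exec.congr (.loop_true hv (exec_tBody_gt haB ht0 htB ht ha hx hy hta)
        (.loop_false rfl)) ?_ ?_ ?_
      · simp
      · simp [← ht]
      · rw [List.length_cons]; ring_nf; omega

/-- Process the targets of one step. -/
def tStep : Prog :=
  .seq (.basic [.load fun v => { v with first := true, cont := true }])
    (.seq tLoop
      (.seq (.ite (fun v => v.first) (.basic [putBit .wt false, putBit .wt true]) (.basic []))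
        (.ite (fun v => decide (v.cmp = .eq)) (.basic [putBit .wt false])
          (.basic [putBit .wt false, putBit .wt true]))))

/-- Stacks collect words in reverse. The three pieces are what the target loop, the test for an
untouched `first` flag, and the test for `2a` being a target push in turn. -/
theorem map_bit_slotWord_stepSlots (k j : ℕ) (b : Bool) :
    ((slotWord (stepSlots (k, b, j))).map Γ'.bit).reverse =
      (if b then [.bit false] else [.bit true, .bit false]) ++
        ((if k = 0 then [.bit true, .bit false] else []) ++
          List.replicate (k + (k - 1)) (.bit false)) := by
  have h : slotWord (List.replicate (k + (k - 1)) false) = List.replicate (k + (k - 1)) false := by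
    generalize k + (k - 1) = n
    induction n with
    | zero => rfl
    | succ n ih => rw [List.replicate_succ, slotWord, List.flatMap_cons, ← slotWord, ih]; rfl
  rw [stepSlots, slotWord, List.flatMap_append, List.flatMap_append, ← slotWord, h]
  obtain rfl | hk := Nat.eq_zero_or_pos k
  · cases b <;> rfl
  · have h1 : k - 1 + 1 - k = 0 := by omega
    have h2 : k ≠ 0 := by omega
    cases b <;> simp [h1, h2]

/-- The slots do not depend on the number of deadlines in the step, so `j` is arbitrary here and is
chosen when the deadlines have been processed. -/
theorem exec_tStep {B : ℕ} {a : ℤ} {r' : List Γ'} (haB : (encodeInt a).length ≤ B) (T : List ℕ)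
    (hT : ∀ t ∈ T, 0 < t ∧ (encodeNat t).length ≤ B) {v : Regs} {s : Stores}
    (ht : s.t = seqBody encodeNat T)
    (ha : s.a = (encodeInt a).map .bit ++ .comma :: r') (hx : s.tx = []) (hy : s.ty = [])
    {T₁ : List ℕ} {k : ℕ} {b : Bool}
    (hT₁ : T₁ = T.dropWhile (fun t : ℕ => decide ((t : ℤ) < 2 * a)))
    (hk : k = T.length - T₁.length)
    (hb : b = decide (T₁.head?.map (fun t : ℕ => (t : ℤ)) = some (2 * a))) (j : ℕ) :
    ∃ v' : Regs, Exec tStep v s v'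
      { s with
        t := seqBody encodeNat (if b then T₁.tail else T₁)
        wt := ((slotWord (stepSlots (k, b, j))).map Γ'.bit).reverse ++ s.wt
        wd := (List.replicate (k - 1) [.bit true, .bit false]).flatten ++ s.wd
        wn := List.replicate (k - 1) .blank ++ s.wn } ((T.length + 1) * (20 * B + 41) + 6) := by
  have h1 := exec_tLoop haB T hT (v := { v with first := true, cont := true }) rfl ht ha hx hy
    hT₁ hk rfl hb
  refine ⟨{ v with
        x := none
        y := none
        cont := false
        first := decide (k = 0)
        cmp := if b then .eq else .gt },
    Exec.congr (.seq (.basic rfl) (.seq h1 (t₂ := 4) (.seq (t₁ := 2) (t₂ := 2)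
    (v₁ := { v with
        x := none
        y := none
        cont := false
        first := decide (k = 0)
        cmp := if b then .eq else .gt })
    (s₁ := { s with
        t := seqBody encodeNat (if b then T₁.tail else T₁)
        wt := (if k = 0 then [.bit true, .bit false] else []) ++
          (List.replicate (k + (k - 1)) (.bit false) ++ s.wt)
        wd := (List.replicate (k - 1) [.bit true, .bit false]).flatten ++ s.wd
        wn := List.replicate (k - 1) .blank ++ s.wn }) ?_ (s' := { s with
        t := seqBody encodeNat (if b then T₁.tail else T₁)
        wt := (if b then [.bit false] else [.bit true, .bit false]) ++
          ((if k = 0 then [.bit true, .bit false] else []) ++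
          (List.replicate (k + (k - 1)) (.bit false) ++ s.wt))
        wd := (List.replicate (k - 1) [.bit true, .bit false]).flatten ++ s.wd
        wn := List.replicate (k - 1) .blank ++ s.wn }) ?_))) rfl ?_ (by omega)⟩
  · by_cases hk0 : k = 0
    · simp only [hk0]
      exact .ite_true rfl (.basic rfl)
    · simp only [hk0]
      exact .ite_false rfl (.basic rfl)
  · cases b
    · exact .ite_false rfl (.basic rfl)
    · exact .ite_true rfl (.basic rfl)
  · simp [map_bit_slotWord_stepSlots]

/-! ### Processing the deadlines of one step -/

/-- Process one deadline. -/
def dBody : Prog :=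
  .seq (.basic [peekX .d])
    (.ite (fun v => v.x.isNone) (.basic [.load fun v => { v with cont := false }])
      (.seq dCmp
        (.ite (fun v => decide (v.cmp = .eq))
          (.seq (clear .tx) (.basic [putBit .wd true]))
          (.seq (moveAll .tx .d) (.basic [.load fun v => { v with cont := false }])))))

/-- Process the deadlines of one step. -/
def dStep : Prog :=
  .seq (.basic [putBit .wd false, put .wn .blank, .load fun v => { v with cont := true }])
    (.loop (fun v => v.cont) dBody)

theorem exec_dLoop {B : ℕ} {a : ℤ} {r' : List Γ'} (haB : (encodeInt a).length ≤ B) (D : List ℕ)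
    (hD : ∀ d ∈ D, (encodeNat d).length ≤ B) {v : Regs} {s : Stores}
    (hv : v.cont = true) (hd : s.d = seqBody encodeNat D)
    (ha : s.a = (encodeInt a).map .bit ++ .comma :: r') (hx : s.tx = []) (hy : s.ty = [])
    {D₁ : List ℕ} (hD₁ : D₁ = D.dropWhile (fun d : ℕ => decide ((d : ℤ) = a))) :
    ∃ v' : Regs, Exec (.loop (fun v => v.cont) dBody) v s v'
      { s with
        d := seqBody encodeNat D₁
        wd := List.replicate (D.length - D₁.length) (.bit true) ++ s.wd }
      ((D.length + 1) * (20 * B + 41) + 1) := by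
  induction D generalizing v s with
  | nil =>
    subst hD₁
    have h1 : Exec dBody v s { v with x := none, cont := false } s 3 := by
      cases s
      cases hd
      exact .seq (.basic rfl) (.ite_true rfl (.basic rfl))
    refine ⟨_, Exec.congr (.loop_true hv h1 (.loop_false rfl)) rfl ?_ (by simp)⟩
    simp [← hd]
  | cons d D ih =>
    have hdB := hD d (by simp)
    rw [seqBody_cons] at hd
    obtain ⟨c, hc, h⟩ := exec_dCmp (v := { v with x := s.d.head? }) hd ha hx hy
    by_cases hda : (d : ℤ) = a
    · rw [List.dropWhile_cons_of_pos (by simpa using hda)] at hD₁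
      have hlen : D₁.length ≤ D.length := by
        rw [hD₁]
        exact (List.dropWhile_suffix _).length_le
      obtain rfl := hc.2 hda
      have h1 : Exec dBody v s { v with x := none, y := none, cmp := .eq }
          { s with d := seqBody encodeNat D, wd := .bit true :: s.wd } (20 * B + 40) := by
        refine Exec.congr (.seq (.basic rfl) (.ite_false ?_ (.seq h (.ite_true rfl
          (.seq (exec_clear _ _ _) (.basic rfl)))))) rfl ?_ ?_
        · simp [Stores.get, hd]
        · simp [Stores.set, Stores.get, hx]
        · simp [Stores.get]
          omega
      obtain ⟨v', h2⟩ := ih (fun d hd => hD d (List.mem_cons_of_mem _ hd))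
        (v := { v with x := none, y := none, cmp := .eq })
        (s := { s with d := seqBody encodeNat D, wd := .bit true :: s.wd }) hv rfl ha hx hy hD₁
      refine ⟨v', Exec.congr (.loop_true hv h1 h2) rfl ?_ ?_⟩
      · rw [List.length_cons, Nat.sub_add_comm hlen, replicate_succ_append]
      · rw [List.length_cons]; ring_nf; omega
    · rw [List.dropWhile_cons_of_neg (by simpa using hda)] at hD₁
      subst hD₁
      have hc' : c ≠ .eq := fun h => hda (hc.1 h)
      refine ⟨_, Exec.congr (.loop_true hv (.seq (.basic rfl) (.ite_false ?_ (.seq h (.ite_false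
        (decide_eq_false hc') (.seq (exec_moveAll (by decide) _ _) (.basic rfl))))))
        (.loop_false rfl)) rfl ?_ ?_⟩
      · simp [Stores.get, hd]
      · cases s
        cases hx
        cases hd
        simp [Stores.set, Stores.get, seqBody_cons]
      · simp [Stores.get]
        ring_nf
        omega

theorem exec_dStep {B : ℕ} {a : ℤ} {r' : List Γ'} (haB : (encodeInt a).length ≤ B) (D : List ℕ)
    (hD : ∀ d ∈ D, (encodeNat d).length ≤ B) {v : Regs} {s : Stores}
    (hd : s.d = seqBody encodeNat D)
    (ha : s.a = (encodeInt a).map .bit ++ .comma :: r') (hx : s.tx = []) (hy : s.ty = [])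
    {D₁ : List ℕ} (hD₁ : D₁ = D.dropWhile (fun d : ℕ => decide ((d : ℤ) = a))) :
    ∃ v' : Regs, Exec dStep v s v'
      { s with
        d := seqBody encodeNat D₁
        wd := List.replicate (D.length - D₁.length) (.bit true) ++ .bit false :: s.wd
        wn := .blank :: s.wn }
      ((D.length + 1) * (20 * B + 41) + 2) := by
  obtain ⟨v', h⟩ := exec_dLoop haB D hD (v := { v with cont := true })
    (s := { s with wd := .bit false :: s.wd, wn := .blank :: s.wn }) rfl hd ha hx hy hD₁
  exact ⟨v', Exec.congr (.seq (.basic rfl) h) rfl rfl (by omega)⟩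

/-! ### The main loop -/

/-- Remove the first number from the stack `a`. -/
def skipA : Prog :=
  .seq (.basic [popX .a]) (.loop (fun v => !isComma v.x) (.basic [popX .a]))

theorem exec_skipA (w : List Bool) {v : Regs} {s : Stores} {r' : List Γ'}
    (ha : s.a = w.map .bit ++ .comma :: r') :
    Exec skipA v s { v with x := some .comma } { s with a := r' } (2 * w.length + 2) := by
  have main : ∀ (w : List Bool) (g : Γ') (s : Stores), s.a = w.map .bit ++ .comma :: r' →
      isComma (some g) = false →
      Exec (.loop (fun v => !isComma v.x) (.basic [popX .a])) { v with x := some g } s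
        { v with x := some .comma } { s with a := r' } (2 * w.length + 3) := by
    intro w
    induction w with
    | nil =>
      intro g s ha hg
      cases s
      cases ha
      exact Exec.congr (.loop_true (by rw [hg]; rfl) (.basic rfl) (.loop_false rfl)) rfl rfl
        (by simp)
    | cons b w ih =>
      intro g s ha hg
      cases s
      cases ha
      exact Exec.congr (.loop_true (by rw [hg]; rfl) (.basic rfl) (ih (.bit b) _ rfl rfl)) rfl rfl
        (by rw [List.length_cons]; omega)
  cases s
  cases ha
  cases w with
  | nil => exact Exec.congr (.seq (.basic rfl) (.loop_false rfl)) rfl rfl (by simp)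
  | cons b w =>
    exact Exec.congr (.seq (.basic rfl) (main w (.bit b) _ rfl rfl)) rfl rfl
      (by rw [List.length_cons]; omega)

theorem reverse_map_bit_stepDeadlines_append (s : ℕ × Bool × ℕ) (l : List Γ') :
    ((stepDeadlines s).map Γ'.bit).reverse ++ l = List.replicate s.2.2 (.bit true) ++ .bit false ::
      ((List.replicate (s.1 - 1) [.bit true, .bit false]).flatten ++ l) := by
  have h : ∀ n, ((List.replicate n [false, true]).flatten.map Γ'.bit).reverse =
      (List.replicate n [.bit true, .bit false]).flatten := by
    intro n
    induction n with
    | zero => rfl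
    | succ n ih =>
      rw [List.replicate_succ, List.flatten_cons, List.map_append, List.reverse_append, ih,
        List.replicate_succ', List.flatten_append]
      rfl
  rw [stepDeadlines, List.map_append, List.reverse_append, h]
  simp

theorem replicate_stepsSize_cons_append (s : ℕ × Bool × ℕ) (L : List (ℕ × Bool × ℕ))
    (l : List Γ') :
    List.replicate (stepsSize (s :: L)) Γ'.blank ++ l =
      List.replicate (stepsSize L) .blank ++ .blank :: (List.replicate (s.1 - 1) .blank ++ l) := by
  have h : stepsSize (s :: L) = stepsSize L + 1 + (s.1 - 1) := by
    simp only [stepsSize, List.map_cons, List.sum_cons]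
    omega
  rw [h, List.replicate_add, List.append_assoc, replicate_succ_append]

/-- Process one element of the discretized sequence. -/
def mainBody : Prog :=
  .seq tStep (.seq dStep (.seq skipA (.basic [.load fun _ => {}, peekX .a])))

/-- Process the discretized sequence. -/
def mainLoop : Prog := .loop (fun v => v.x.isSome) mainBody

/-- The program consumes the lists exactly as `pmSteps` does, appending each step's words to the
collecting stacks. The unprocessed remainders `T'` and `D'` are recorded only as suffixes, which
suffices to bound the time of clearing them. -/
theorem exec_mainLoop {B M : ℕ} (A : List ℤ) (hA : ∀ a ∈ A, (encodeInt a).length ≤ B)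
    (T D : List ℕ) (hT : ∀ t ∈ T, 0 < t ∧ (encodeNat t).length ≤ B)
    (hD : ∀ d ∈ D, (encodeNat d).length ≤ B) (hTM : T.length ≤ M) (hDM : D.length ≤ M)
    {s : Stores} (ha : s.a = seqBody encodeInt A) (ht : s.t = seqBody encodeNat T)
    (hd : s.d = seqBody encodeNat D) (hx : s.tx = []) (hy : s.ty = []) :
    ∃ T' D' : List ℕ, T' <:+ T ∧ D' <:+ D ∧ Exec mainLoop { x := s.a.head? } s {}
      { s with
        a := []
        t := seqBody encodeNat T'
        d := seqBody encodeNat D'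
        wd := (((pmSteps A T D).flatMap stepDeadlines).map Γ'.bit).reverse ++ s.wd
        wt := (((pmSteps A T D).flatMap fun s => slotWord (stepSlots s)).map Γ'.bit).reverse ++ s.wt
        wn := List.replicate (stepsSize (pmSteps A T D)) .blank ++ s.wn }
      (A.length * (2 * ((M + 1) * (20 * B + 41)) + 2 * B + 20) + 1) := by
  induction A generalizing T D s with
  | nil =>
    refine ⟨T, D, List.suffix_rfl, List.suffix_rfl, ?_⟩
    have h0 : s.a = [] := ha
    rw [h0]
    refine Exec.congr (.loop_false rfl) rfl ?_ (by omega)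
    cases s
    cases h0
    cases ht
    cases hd
    rfl
  | cons a A ih =>
    rw [seqBody_cons] at ha
    have haB := hA a (by simp)
    generalize hT₁ : T.dropWhile (fun t : ℕ => decide ((t : ℤ) < 2 * a)) = T₁
    generalize hb : decide (T₁.head?.map (fun t : ℕ => (t : ℤ)) = some (2 * a)) = b
    generalize hD₁ : D.dropWhile (fun d : ℕ => decide ((d : ℤ) = a)) = D₁
    have hsteps : pmSteps (a :: A) T D = (T.length - T₁.length, b, D.length - D₁.length) ::
        pmSteps A (if b then T₁.tail else T₁) D₁ := by
      subst hb hT₁ hD₁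
      rfl
    have hTs : (if b then T₁.tail else T₁) <:+ T := by
      have h1 : T₁ <:+ T := hT₁ ▸ List.dropWhile_suffix _
      cases b
      · exact h1
      · exact (List.tail_suffix _).trans h1
    have hDs : D₁ <:+ D := hD₁ ▸ List.dropWhile_suffix _
    obtain ⟨v₁, h1⟩ := exec_tStep haB T hT (v := { x := s.a.head? }) ht ha hx hy hT₁.symm rfl
      hb.symm (D.length - D₁.length)
    obtain ⟨v₂, h2⟩ := exec_dStep haB D hD (v := v₁) (s := { s with
        t := seqBody encodeNat (if b then T₁.tail else T₁)
        wt := ((slotWord (stepSlots (T.length - T₁.length, b, D.length - D₁.length))).map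
          Γ'.bit).reverse ++ s.wt
        wd := (List.replicate (T.length - T₁.length - 1) [.bit true, .bit false]).flatten ++ s.wd
        wn := List.replicate (T.length - T₁.length - 1) .blank ++ s.wn }) hd ha hx hy hD₁.symm
    obtain ⟨T', D', hT', hD', h3⟩ := ih (fun a ha => hA a (List.mem_cons_of_mem _ ha)) _ D₁
      (fun t ht => hT t (hTs.subset ht)) (fun d hd => hD d (hDs.subset hd))
      (hTs.length_le.trans hTM) (hDs.length_le.trans hDM) (s := { s with
        a := seqBody encodeInt A
        t := seqBody encodeNat (if b then T₁.tail else T₁)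
        d := seqBody encodeNat D₁
        wt := ((slotWord (stepSlots (T.length - T₁.length, b, D.length - D₁.length))).map
          Γ'.bit).reverse ++ s.wt
        wd := List.replicate (D.length - D₁.length) (.bit true) ++ .bit false ::
          ((List.replicate (T.length - T₁.length - 1) [.bit true, .bit false]).flatten ++ s.wd)
        wn := .blank :: (List.replicate (T.length - T₁.length - 1) .blank ++ s.wn) })
      rfl rfl rfl hx hy
    refine ⟨T', D', hT'.trans hTs, hD'.trans hDs, ?_⟩
    have hsome : s.a.head?.isSome = true := by simp [ha]
    refine Exec.congr (.loop_true hsome (.seq h1 (.seq h2 (.seq (exec_skipA (encodeInt a) ha)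
      (.basic rfl)))) h3) rfl ?_ ?_
    · rw [hsteps]
      simp only [List.flatMap_cons, List.map_append, List.reverse_append, List.append_assoc,
        reverse_map_bit_stepDeadlines_append, replicate_stepsSize_cons_append]
    · rw [List.length_cons]
      have e1 := Nat.mul_le_mul_right (20 * B + 41) (Nat.succ_le_succ hTM)
      have e2 := Nat.mul_le_mul_right (20 * B + 41) (Nat.succ_le_succ hDM)
      have e3 := Nat.succ_mul A.length (2 * ((M + 1) * (20 * B + 41)) + 2 * B + 20)
      simp only [Nat.succ_eq_add_one] at e1 e2 e3
      omega

/-! ### Reading the input -/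

/-- Whether a symbol is an opening bracket. -/
def isBra : Option Γ' → Bool
  | some .bra => true
  | _ => false

/-- Move one of the encoded sequences from `rev` to the stack `k`. -/
def loadSeq (k : Stk) : Prog :=
  .seq (.basic [popX .rev, popX .rev])
    (.loop (fun v => !isBra v.x) (.basic [pushX k, popX .rev]))

/-- On the reversed input a sequence starts with its closing bracket and ends with its opening one;
moving the symbols in between to `k` restores their order. -/
theorem exec_loadSeq {k : Stk} (h : Stk.rev ≠ k) (l r : List Γ')
    (hl : ∀ c ∈ l, isBra (some c) = false) {v : Regs} {s : Stores}
    (hr : s.rev = .ket :: (l.reverse ++ .bra :: r)) (hk : s.get k = []) :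
    Exec (loadSeq k) v s { v with x := some .bra } ((s.set .rev r).set k l) (2 * l.length + 2) := by
  have main : ∀ (l : List Γ') (s : Stores), (∀ c ∈ l, isBra (some c) = false) →
      Exec (.loop (fun v => !isBra v.x) (.basic [pushX k, popX .rev]))
        { v with x := (l ++ .bra :: r).head? } (s.set .rev (l ++ .bra :: r).tail)
        { v with x := some .bra } ((s.set .rev r).set k (l.reverse ++ s.get k))
        (2 * l.length + 1) := by
    intro l
    induction l with
    | nil =>
      intro s _
      have h1 : (s.set .rev r).set k (s.get k) = s.set .rev r := by
        conv_lhs => rw [← s.get_set_of_ne h.symm r, Stores.set_get]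
      rw [List.reverse_nil, List.nil_append (s.get k), h1]
      exact .loop_false rfl
    | cons c l ih =>
      intro s hl
      have h2 := ih (s.set k (c :: s.get k)) fun c hc => hl c (List.mem_cons_of_mem _ hc)
      have h3 : ((s.set k (c :: s.get k)).set .rev r).set k
          (l.reverse ++ (s.set k (c :: s.get k)).get k) =
          (s.set .rev r).set k ((c :: l).reverse ++ s.get k) := by
        rw [Stores.get_set, Stores.set_comm _ h.symm, Stores.set_set]
        simp
      rw [h3] at h2
      refine Exec.congr (.loop_true ?_ (.basic ?_) h2) rfl rfl (by rw [List.length_cons]; omega)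
      · change (!isBra (some c)) = true
        rw [hl c (by simp)]
        rfl
      generalize hm : l ++ Γ'.bra :: r = m
      change (({ v with x := ((((s.set .rev (c :: l ++ .bra :: r).tail).set k
          (c :: (s.set .rev (c :: l ++ .bra :: r).tail).get k))).get .rev).head? } : Regs),
        (((s.set .rev (c :: l ++ .bra :: r).tail).set k
          (c :: (s.set .rev (c :: l ++ .bra :: r).tail).get k))).set .rev
          ((((s.set .rev (c :: l ++ .bra :: r).tail).set k
            (c :: (s.set .rev (c :: l ++ .bra :: r).tail).get k))).get .rev).tail) = _
      rw [Stores.get_set_of_ne _ h, Stores.get_set, Stores.get_set_of_ne _ h.symm,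
        Stores.set_comm _ h, Stores.set_set, List.cons_append, List.tail_cons, hm]
  have h1 := main l.reverse s (by simpa using hl)
  rw [hk, List.reverse_reverse, List.append_nil, List.length_reverse] at h1
  refine Exec.congr (.seq (.basic ?_) h1) rfl rfl (by omega)
  cases s
  cases hr
  rfl

/-! ### Assembling the instructions -/

/-- For each step count, prepend `01` to the instructions and leave a mark on `ty`. -/
def expandPairs : Prog :=
  .seq (.basic [popX .wn]) (.loop (fun v => v.x.isSome)
    (.basic [putBit .inp true, putBit .inp false, put .ty .blank, popX .wn]))

/-- For each mark on `ty`, prepend `010` to the instructions. -/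
def expandTriples : Prog :=
  .seq (.basic [popX .ty]) (.loop (fun v => v.x.isSome)
    (.basic [putBit .inp false, putBit .inp true, putBit .inp false, popX .ty]))

theorem exec_expandPairs (n : ℕ) {v : Regs} {s : Stores} (hn : s.wn = List.replicate n .blank) :
    Exec expandPairs v s { v with x := none }
      { s with
        wn := []
        inp := (List.replicate n [.bit false, .bit true]).flatten ++ s.inp
        ty := List.replicate n .blank ++ s.ty } (2 * n + 2) := by
  have main : ∀ (n : ℕ) (s : Stores),
      Exec (.loop (fun v => v.x.isSome)
        (.basic [putBit .inp true, putBit .inp false, put .ty .blank, popX .wn]))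
        { v with x := (List.replicate n Γ'.blank).head? }
        { s with wn := (List.replicate n Γ'.blank).tail } { v with x := none }
        { s with
          wn := []
          inp := (List.replicate n [.bit false, .bit true]).flatten ++ s.inp
          ty := List.replicate n .blank ++ s.ty } (2 * n + 1) := by
    intro n
    induction n with
    | zero => exact fun s => .loop_false rfl
    | succ n ih =>
      intro s
      refine Exec.congr (.loop_true rfl (.basic rfl) (ih { s with
        inp := .bit false :: .bit true :: s.inp
        ty := .blank :: s.ty })) rfl ?_ (by omega)
      simp only [replicate_succ_append, flatten_replicate_succ_append, List.cons_append,
        List.nil_append]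
  cases s
  cases hn
  exact Exec.congr (.seq (.basic rfl) (main n _)) rfl rfl (by omega)

theorem exec_expandTriples (n : ℕ) {v : Regs} {s : Stores} (hn : s.ty = List.replicate n .blank) :
    Exec expandTriples v s { v with x := none }
      { s with
        ty := []
        inp := (List.replicate n [.bit false, .bit true, .bit false]).flatten ++ s.inp }
      (2 * n + 2) := by
  have main : ∀ (n : ℕ) (s : Stores),
      Exec (.loop (fun v => v.x.isSome)
        (.basic [putBit .inp false, putBit .inp true, putBit .inp false, popX .ty]))
        { v with x := (List.replicate n Γ'.blank).head? }
        { s with ty := (List.replicate n Γ'.blank).tail } { v with x := none }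
        { s with
          ty := []
          inp := (List.replicate n [.bit false, .bit true, .bit false]).flatten ++ s.inp }
        (2 * n + 1) := by
    intro n
    induction n with
    | zero => exact fun s => .loop_false rfl
    | succ n ih =>
      intro s
      refine Exec.congr (.loop_true rfl (.basic rfl) (ih { s with
        inp := .bit false :: .bit true :: .bit false :: s.inp })) rfl ?_ (by omega)
      simp only [flatten_replicate_succ_append, List.cons_append, List.nil_append]
  cases s
  cases hn
  exact Exec.congr (.seq (.basic rfl) (main n _)) rfl rfl (by omega)

/-! ### Printing the output -/

/-- Increment the counter on `tx`. -/
def incr : Prog :=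
  .seq (.basic [popX .tx])
    (.seq (.loop (fun v => isOne v.x) (.basic [putBit .ty false, popX .tx]))
      (.seq (.basic [putBit .tx true]) (moveAll .ty .tx)))

/-- Print the counter on `tx`. -/
def emit : Prog :=
  .seq (.basic [popX .tx])
    (.seq (.loop (fun v => v.x.isSome) (.basic [pushX .rev, pushX .ty, popX .tx]))
      (.seq (.basic [put .rev .comma]) (moveAll .ty .tx)))

/-- Follow the instructions on `inp`. -/
def printAll : Prog :=
  .seq (.basic [popX .inp])
    (.loop (fun v => v.x.isSome) (.seq (.ite (fun v => isOne v.x) emit incr) (.basic [popX .inp])))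

/-- The leading ones, least significant first, are turned into zeros parked on `ty`; the next bit,
or a new top bit, becomes one, and the zeros are moved back. -/
theorem exec_incr (w : List Bool) {v : Regs} {s : Stores} (hx : s.tx = w.map .bit)
    (hy : s.ty = []) :
    Exec incr v s { v with x := none } { s with tx := (incBits w).map .bit }
      (4 * w.length + 5) := by
  have main : ∀ (w : List Bool) (s : Stores), ∃ (x' : Option Γ') (m : ℕ) (w' : List Bool),
      incBits w = List.replicate m false ++ true :: w' ∧ m ≤ w.length ∧
      Exec (.loop (fun v => isOne v.x) (.basic [putBit .ty false, popX .tx]))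
        { v with x := (w.map Γ'.bit).head? } { s with tx := (w.map Γ'.bit).tail }
        { v with x := x' }
        { s with tx := w'.map Γ'.bit, ty := List.replicate m (.bit false) ++ s.ty }
        (2 * w.length + 1) := by
    intro w
    induction w with
    | nil => exact fun s => ⟨none, 0, [], rfl, le_rfl, .loop_false rfl⟩
    | cons b w ih =>
      intro s
      cases b with
      | false => exact ⟨some (.bit false), 0, w, rfl, Nat.zero_le _,
          (Exec.loop_false rfl).mono (by simp)⟩
      | true =>
        obtain ⟨x', m, w', h1, h2, h3⟩ := ih { s with ty := .bit false :: s.ty }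
        refine ⟨x', m + 1, w', ?_, by simpa using h2, ?_⟩
        · rw [incBits, h1]
          rfl
        · refine Exec.congr (.loop_true rfl (.basic ?_) h3) rfl ?_
            (by rw [List.length_cons]; omega)
          · rfl
          · rw [replicate_succ_append]
  obtain ⟨x', m, w', h1, h2, h3⟩ := main w s
  cases s
  cases hx
  cases hy
  refine Exec.congr (.seq (.basic rfl) (.seq h3 (.seq (.basic rfl)
    (exec_moveAll (by decide) _ _)))) rfl ?_ ?_
  · simp [Stores.set, Stores.get, h1]
  · simp [Stores.set, Stores.get]
    omega

theorem exec_emit {v : Regs} {s : Stores} (hy : s.ty = []) :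
    Exec emit v s { v with x := none } { s with rev := .comma :: (s.tx.reverse ++ s.rev) }
      (4 * s.tx.length + 5) := by
  have main : ∀ (l : List Γ') (s : Stores),
      Exec (.loop (fun v => v.x.isSome) (.basic [pushX .rev, pushX .ty, popX .tx]))
        { v with x := l.head? } { s with tx := l.tail } { v with x := none }
        { s with tx := [], ty := l.reverse ++ s.ty, rev := l.reverse ++ s.rev }
        (2 * l.length + 1) := by
    intro l
    induction l with
    | nil => exact fun s => .loop_false rfl
    | cons c l ih =>
      intro s
      refine Exec.congr (.loop_true rfl (.basic rfl) (ih { s with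
        ty := c :: s.ty
        rev := c :: s.rev })) rfl ?_ (by rw [List.length_cons]; omega)
      simp
  refine Exec.congr (.seq (.basic rfl) (.seq (main s.tx s) (.seq (.basic rfl)
    (exec_moveAll (by decide) _ _)))) rfl ?_ ?_
  · simp [Stores.set, Stores.get, hy]
  · simp [Stores.set, Stores.get, hy]
    omega

/-- The counter never exceeds its initial value plus the length of the word, and the length of a
binary number is at most its value. Each instruction thus takes time linear in the word, which gives
a quadratic total. -/
theorem exec_printAll (W : List Bool) {v : Regs} {s : Stores} (hi : s.inp = W.map .bit)
    (hx : s.tx = []) (hy : s.ty = []) :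
    Exec printAll v s { v with x := none }
      { s with
        inp := []
        tx := (encodeNat (W.count false)).map .bit
        rev := (seqBody encodeNat (emitted 0 W)).reverse ++ s.rev }
      (W.length * (4 * W.length + 8) + 2) := by
  have main : ∀ (W : List Bool) (c : ℕ) (s : Stores), s.tx = (encodeNat c).map .bit → s.ty = [] →
      Exec (.loop (fun v => v.x.isSome)
          (.seq (.ite (fun v => isOne v.x) emit incr) (.basic [popX .inp])))
        { v with x := (W.map Γ'.bit).head? } { s with inp := (W.map Γ'.bit).tail }
        { v with x := none }
        { s with
          inp := []
          tx := (encodeNat (c + W.count false)).map .bit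
          rev := (seqBody encodeNat (emitted c W)).reverse ++ s.rev }
        (W.length * (4 * (c + W.length) + 8) + 1) := by
    intro W
    induction W with
    | nil =>
      intro c s hx hy
      refine Exec.congr (.loop_false rfl) rfl ?_ (by simp)
      cases s
      cases hx
      rfl
    | cons b W ih =>
      intro c s hx hy
      have hlen := length_encodeNat_le c
      cases b with
      | false =>
        have h1 := ih (c + 1) { s with tx := (incBits (encodeNat c)).map .bit }
          (by rw [encodeNat_succ]) hy
        refine Exec.congr (.loop_true rfl (.seq (.ite_false rfl (exec_incr (encodeNat c)
          (by exact hx) (by exact hy))) (.basic rfl)) h1) rfl ?_ ?_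
        · rw [List.count_cons_self, emitted, Nat.add_assoc, Nat.add_comm 1]
        · rw [List.length_cons, Nat.add_assoc c 1, Nat.add_comm 1, Nat.succ_mul W.length]
          omega
      | true =>
        have h1 := ih c { s with rev := .comma :: (s.tx.reverse ++ s.rev) } hx hy
        refine Exec.congr (.loop_true rfl (.seq (.ite_true rfl (exec_emit (by exact hy)))
          (.basic rfl)) h1) rfl ?_ ?_
        · rw [emitted, seqBody_cons, List.count_cons_of_ne (by decide), hx]
          simp
        · have h2 : s.tx.length ≤ c := by rw [hx, List.length_map]; exact hlen
          have h3 : W.length * (4 * (c + W.length) + 8) ≤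
              W.length * (4 * (c + (W.length + 1)) + 8) :=
            Nat.mul_le_mul_left _ (by omega)
          rw [List.length_cons, Nat.succ_mul W.length]
          simp only
          omega
  have h1 := main W 0 s hx hy
  rw [Nat.zero_add, Nat.zero_add] at h1
  cases s
  cases hi
  exact Exec.congr (.seq (.basic rfl) h1) rfl rfl (by omega)

theorem length_seqBody_emitted_le (c : ℕ) (W : List Bool) :
    (seqBody encodeNat (emitted c W)).length ≤ W.length * (c + W.length + 1) := by
  induction W generalizing c with
  | nil => simp [emitted, seqBody]
  | cons b W ih =>
    cases b with
    | false =>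
      rw [emitted, List.length_cons]
      refine (ih (c + 1)).trans ?_
      rw [Nat.succ_mul, show c + 1 + W.length + 1 = c + (W.length + 1) + 1 by omega]
      omega
    | true =>
      have h1 := ih c
      have h2 := length_encodeNat_le c
      have h3 : W.length * (c + W.length + 1) ≤ W.length * (c + (W.length + 1) + 1) :=
        Nat.mul_le_mul_left _ (by omega)
      rw [emitted, seqBody_cons, List.length_append, List.length_cons, List.length_map,
        List.length_cons, Nat.succ_mul W.length]
      omega

/-! ### The reduction program -/

/-- The program that computes the reduction. -/
def reductionProg : Prog :=
  .seq (moveAll .inp .rev) <| .seq (loadSeq .t) <| .seq (loadSeq .a) <| .seq (loadSeq .d) <|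
  .seq (.basic [.load fun _ => {}, peekX .a]) <| .seq mainLoop <|
  .seq (clear .t) <| .seq (clear .d) <|
  .seq (moveAll .wt .inp) <| .seq expandPairs <| .seq (moveAll .wd .inp) <| .seq expandTriples <|
  .seq (.basic [put .rev .bra]) <| .seq printAll <| .seq (.basic [put .rev .ket]) <|
  .seq (clear .tx) <| .seq (moveAll .rev .out) <| .basic [.load fun _ => {}]

theorem encodeSeq_eq {α : Type} (e : α → List Bool) (l : List α) :
    encodeSeq e l = Γ'.bra :: (seqBody e l ++ [Γ'.ket]) := rfl

theorem isBra_of_mem_seqBody {α : Type} {e : α → List Bool} {l : List α} {c : Γ'}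
    (h : c ∈ seqBody e l) : isBra (some c) = false := by
  simp only [seqBody, List.mem_flatMap, List.mem_append, List.mem_map, List.mem_singleton] at h
  obtain ⟨_, _, ⟨_, _, rfl⟩ | rfl⟩ := h <;> rfl

theorem length_le_length_seqBody {α : Type} (e : α → List Bool) (l : List α) :
    l.length ≤ (seqBody e l).length := by
  induction l with
  | nil => exact le_rfl
  | cons x l ih => rw [seqBody_cons, List.length_append, List.length_cons, List.length_cons]; omega

theorem length_encode_le_length_seqBody {α : Type} (e : α → List Bool) {l : List α} {x : α}
    (hx : x ∈ l) : (e x).length ≤ (seqBody e l).length := by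
  induction l with
  | nil => simp at hx
  | cons y l ih =>
    rw [seqBody_cons, List.length_append, List.length_cons, List.length_map]
    rcases List.mem_cons.1 hx with rfl | hx
    · omega
    · have := ih hx
      omega

theorem length_seqBody_le_of_suffix {α : Type} (e : α → List Bool) {l l' : List α}
    (h : l' <:+ l) : (seqBody e l').length ≤ (seqBody e l).length := by
  obtain ⟨m, rfl⟩ := h
  simp [seqBody]

theorem length_slotWord_le (w : List Bool) : (slotWord w).length ≤ 2 * w.length := by
  induction w with
  | nil => exact le_rfl
  | cons f w ih =>
    rw [slotWord, List.flatMap_cons, ← slotWord, List.length_append, List.length_cons]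
    cases f <;> simp <;> omega

/-- Every target and every deadline is consumed in at most one step, so the steps' contributions
telescope to linear bounds independent of the size of the numbers. -/
theorem length_pmSteps_words_le (A : List ℤ) (T D : List ℕ) :
    stepsSize (pmSteps A T D) ≤ T.length + A.length ∧
    ((pmSteps A T D).flatMap stepDeadlines).length ≤ 2 * T.length + A.length + D.length ∧
    ((pmSteps A T D).flatMap fun s => slotWord (stepSlots s)).length ≤
      4 * T.length + 4 * A.length := by
  induction A generalizing T D with
  | nil => simp [pmSteps, stepsSize]
  | cons a A ih =>
    rw [pmSteps]
    generalize hT₁ : T.dropWhile (fun t : ℕ => decide ((t : ℤ) < 2 * a)) = T₁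
    generalize hD₁ : D.dropWhile (fun d : ℕ => decide ((d : ℤ) = a)) = D₁
    have hT : T₁.length ≤ T.length := hT₁ ▸ (List.dropWhile_suffix _).length_le
    have hD : D₁.length ≤ D.length := hD₁ ▸ (List.dropWhile_suffix _).length_le
    generalize hb : decide (T₁.head?.map (fun t : ℕ => (t : ℤ)) = some (2 * a)) = b
    have hT' : (if b then T₁.tail else T₁).length ≤ T₁.length := by
      cases b <;> simp
    obtain ⟨h1, h2, h3⟩ := ih (if b then T₁.tail else T₁) D₁
    have h4 := length_slotWord_le (stepSlots (T.length - T₁.length, b, D.length - D₁.length))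
    simp only [stepSlots, List.length_append, List.length_replicate, List.length_singleton] at h4
    simp only [stepsSize, List.map_cons, List.sum_cons] at h1 ⊢
    simp only [List.flatMap_cons, List.length_append, stepDeadlines, List.length_flatten,
      List.map_replicate, List.sum_replicate, List.length_cons, List.length_nil,
      List.length_replicate, smul_eq_mul, stepSlots] at h2 h3 h4 ⊢
    omega

theorem map_bit_reductionWord (l : List (ℕ × Bool × ℕ)) :
    (reductionWord l).map Γ'.bit =
      (List.replicate (stepsSize l) [.bit false, .bit true, .bit false]).flatten ++
        ((l.flatMap stepDeadlines).map Γ'.bit ++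
          ((List.replicate (stepsSize l) [.bit false, .bit true]).flatten ++
            (l.flatMap fun s => slotWord (stepSlots s)).map Γ'.bit)) := by
  simp [reductionWord, List.map_flatten]

/-- The instruction word is assembled on `inp` from its end: slots, pairs, deadlines, triples. The
cubic term of the time stems from the main loop: at most `L` entries of `A`, for each at most `L`
targets or deadlines, each compared in time linear in `L`. -/
theorem exec_reductionProg (I : PMInstance) :
    Exec reductionProg {} { inp := encodePM I } {} { out := encodeTwoVisits (reduction I) }
      (10000 * ((encodePM I).length + 1) ^ 3) := by
  have hlen : (encodePM I).length = (seqBody encodeNat I.D).length +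
      (seqBody encodeInt I.A).length + (seqBody encodeNat I.T).length + 6 := by
    simp only [encodePM, encodeSeq_eq, List.length_append, List.length_cons, List.length_nil]
    omega
  have hrev : (encodePM I).reverse = .ket :: ((seqBody encodeNat I.T).reverse ++ .bra ::
      .ket :: ((seqBody encodeInt I.A).reverse ++ .bra ::
        .ket :: ((seqBody encodeNat I.D).reverse ++ [.bra]))) := by
    simp [encodePM, encodeSeq_eq]
  generalize hL : (encodePM I).length = L at hlen
  obtain ⟨hN, hWD, hWT⟩ := length_pmSteps_words_le I.A I.T I.D
  have hD := length_le_length_seqBody encodeNat I.D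
  have hA := length_le_length_seqBody encodeInt I.A
  have hT := length_le_length_seqBody encodeNat I.T
  obtain ⟨T', D', hT', hD', h5⟩ := exec_mainLoop (B := L) (M := L) I.A
    (fun a ha => by have := length_encode_le_length_seqBody encodeInt ha; omega) I.T I.D
    (fun t ht => ⟨I.T_pos t ht, by have := length_encode_le_length_seqBody encodeNat ht; omega⟩)
    (fun d hd => by have := length_encode_le_length_seqBody encodeNat hd; omega)
    (by omega) (by omega)
    (s := { d := seqBody encodeNat I.D, a := seqBody encodeInt I.A, t := seqBody encodeNat I.T })
    rfl rfl rfl rfl rfl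
  replace hT' := length_seqBody_le_of_suffix encodeNat hT'
  replace hD' := length_seqBody_le_of_suffix encodeNat hD'
  have hWord := map_bit_reductionWord (pmSteps I.A I.T I.D)
  have hout : encodeTwoVisits (reduction I) = .bra ::
      (seqBody encodeNat (emitted 0 (reductionWord (pmSteps I.A I.T I.D))) ++ [.ket]) := rfl
  generalize reductionWord (pmSteps I.A I.T I.D) = W at hWord hout
  generalize (pmSteps I.A I.T I.D).flatMap stepDeadlines = wd at h5 hWord hWD
  generalize ((pmSteps I.A I.T I.D).flatMap fun s => slotWord (stepSlots s)) = wt at h5 hWord hWT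
  generalize stepsSize (pmSteps I.A I.T I.D) = N at h5 hWord hN
  -- The word consists of `5N` instructions for pairs and triples and the two collected words; all
  -- are linear in the lengths of `D`, `A`, `T`, and the constant is generous.
  have hW : W.length ≤ 22 * L := by
    have := congrArg List.length hWord
    simp only [List.length_map, List.length_append, List.length_flatten, List.map_replicate,
      List.sum_replicate, List.length_cons, List.length_nil, smul_eq_mul] at this
    omega
  have hE := length_seqBody_emitted_le 0 W
  have hC : (encodeNat (W.count false)).length ≤ W.length :=
    (length_encodeNat_le _).trans List.count_le_length
  have h0 : Exec (moveAll .inp .rev) {} { inp := encodePM I } {}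
      { rev := .ket :: ((seqBody encodeNat I.T).reverse ++ .bra ::
        .ket :: ((seqBody encodeInt I.A).reverse ++ .bra ::
          .ket :: ((seqBody encodeNat I.D).reverse ++ [.bra]))) } (2 * L + 2) := by
    refine Exec.congr (exec_moveAll (by decide) _ _) rfl ?_ (by simp [Stores.get, hL])
    simp [Stores.set, Stores.get, hrev]
  have h1 := exec_loadSeq (k := .t) (by decide) (seqBody encodeNat I.T) _
    (fun _ => isBra_of_mem_seqBody) (v := {}) (s := { rev := .ket ::
      ((seqBody encodeNat I.T).reverse ++ .bra :: .ket :: ((seqBody encodeInt I.A).reverse ++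
        .bra :: .ket :: ((seqBody encodeNat I.D).reverse ++ [.bra]))) }) rfl rfl
  have h2 := exec_loadSeq (k := .a) (by decide) (seqBody encodeInt I.A) _
    (fun _ => isBra_of_mem_seqBody) (v := { x := some .bra })
    (s := {
      rev := .ket :: ((seqBody encodeInt I.A).reverse ++
        .bra :: .ket :: ((seqBody encodeNat I.D).reverse ++ [.bra]))
      t := seqBody encodeNat I.T })
    rfl rfl
  have h3 := exec_loadSeq (k := .d) (by decide) (seqBody encodeNat I.D) []
    (fun _ => isBra_of_mem_seqBody) (v := { x := some .bra })
    (s := {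
      rev := .ket :: ((seqBody encodeNat I.D).reverse ++ [.bra])
      t := seqBody encodeNat I.T
      a := seqBody encodeInt I.A }) rfl rfl
  have h8 : Exec (moveAll .wt .inp) {} {
        wd := (wd.map Γ'.bit).reverse
        wt := (wt.map Γ'.bit).reverse
        wn := List.replicate N .blank } {}
      { inp := wt.map Γ'.bit, wd := (wd.map Γ'.bit).reverse, wn := List.replicate N .blank }
      (2 * wt.length + 2) := by
    refine Exec.congr (exec_moveAll (by decide) _ _) rfl ?_ (by simp [Stores.get])
    simp [Stores.set, Stores.get]
  have h9 := exec_expandPairs N (v := {}) (s := {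
    inp := wt.map Γ'.bit
    wd := (wd.map Γ'.bit).reverse
    wn := List.replicate N .blank }) rfl
  have h10 : Exec (moveAll .wd .inp) {}
      { inp := (List.replicate N [.bit false, .bit true]).flatten ++ wt.map Γ'.bit
        wd := (wd.map Γ'.bit).reverse
        ty := List.replicate N .blank } {}
      { inp := wd.map Γ'.bit ++ ((List.replicate N [.bit false, .bit true]).flatten ++
          wt.map Γ'.bit)
        ty := List.replicate N .blank } (2 * wd.length + 2) := by
    refine Exec.congr (exec_moveAll (by decide) _ _) rfl ?_ (by simp [Stores.get])
    simp [Stores.set, Stores.get]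
  have h11 : Exec expandTriples {}
      { inp := wd.map Γ'.bit ++ ((List.replicate N [.bit false, .bit true]).flatten ++
          wt.map Γ'.bit)
        ty := List.replicate N .blank } {} { inp := W.map Γ'.bit } (2 * N + 2) := by
    rw [hWord]
    exact exec_expandTriples N rfl
  have h13 := exec_printAll W (v := {}) (s := { inp := W.map Γ'.bit, rev := [.bra] }) rfl rfl rfl
  have h16 : Exec (moveAll .rev .out) {}
      { rev := .ket :: ((seqBody encodeNat (emitted 0 W)).reverse ++ [.bra]) } {}
      { out := encodeTwoVisits (reduction I) }
      (2 * ((seqBody encodeNat (emitted 0 W)).length + 2) + 2) := by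
    refine Exec.congr (exec_moveAll (by decide) _ _) rfl ?_ (by simp [Stores.get])
    simp [Stores.set, Stores.get, hout]
  refine Exec.congr (.seq h0 <| .seq h1 <| .seq h2 <| .seq h3 <| .seq (.basic rfl) <|
    .seq h5 <| .seq (exec_clear _ _ _) <| .seq (exec_clear _ _ _) <| .seq (s₁ := {
      inp := wt.map Γ'.bit
      wd := (wd.map Γ'.bit).reverse
      wn := List.replicate N .blank }) (v₁ := {}) (t₁ := 2 * wt.length + 2) ?_ <| .seq h9 <|
    .seq (s₁ := {
      inp := wd.map Γ'.bit ++ ((List.replicate N [.bit false, .bit true]).flatten ++ wt.map Γ'.bit)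
      ty := List.replicate N .blank }) (v₁ := {}) (t₁ := 2 * wd.length + 2) ?_ <|
    .seq h11 <| .seq (.basic rfl) <| .seq h13 <| .seq (.basic rfl) <|
    .seq (exec_clear _ _ _) <| .seq h16 (.basic rfl)) rfl rfl ?_
  · simpa [Stores.set] using h8
  · simpa using h10
  simp only [Stores.get, Stores.set, List.length_map]
  have e1 : W.length * (4 * W.length + 8) ≤ 22 * L * (4 * (22 * L) + 8) := by gcongr
  have e2 : W.length * (0 + W.length + 1) ≤ 22 * L * (0 + 22 * L + 1) := by gcongr
  have e3 : I.A.length * (2 * ((L + 1) * (20 * L + 41)) + 2 * L + 20) ≤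
      L * (2 * ((L + 1) * (20 * L + 41)) + 2 * L + 20) := Nat.mul_le_mul_right _ (by omega)
  generalize W.length * (4 * W.length + 8) = w1 at *
  generalize W.length * (0 + W.length + 1) = w2 at *
  generalize I.A.length * (2 * ((L + 1) * (20 * L + 41)) + 2 * L + 20) = w3 at *
  ring_nf at e1 e2 e3 ⊢
  omega

theorem computableInPolyTime_reduction :
    Nonempty (Turing.TM2ComputableInPolyTime encodePM encodeTwoVisits reduction) := by
  refine reductionProg.computableInPolyTime .inp .out {} encodePM encodeTwoVisits reduction
    (10000 * (Polynomial.X + 1) ^ 3) fun I => ?_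
  obtain ⟨n, hn, h⟩ := exec_reductionProg I
  have h1 : ∀ w : List Γ', ({ inp := w } : Stores).get = fun k => if k = .inp then w else [] :=
    fun w => funext fun k => by cases k <;> rfl
  have h2 : ∀ w : List Γ', ({ out := w } : Stores).get = fun k => if k = .out then w else [] :=
    fun w => funext fun k => by cases k <;> rfl
  rw [h1, h2] at h
  exact ⟨n, by simpa using hn, h⟩

theorem mainTheorem2 :
    PolyTimeReducible encodePM PMInstance.Solvable
      encodeTwoVisits (fun D => TwoVisitsFeasible D.1) ∧
    ∀ I : PMInstance, I.Normalized →
      IsDeadlineSeq (I.small ++ I.D ++ I.large) ∧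
      (TwoVisitsFeasible (I.small ++ I.D ++ I.large) ↔ I.Solvable) := by
  exact ⟨⟨reduction, computableInPolyTime_reduction, PMInstance.solvable_iff_reduction⟩,
    fun I hI => ⟨hI.isDeadlineSeq, hI.feasible_iff⟩⟩
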